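/- Let $\epsilon_B,\ell_B>0$ (magnetic energy and magnetic length), and on $L^2(\mathbb R^2)$ let $$K_1=-i\ell_B\partial_{x_1}-\tfrac{x_2}{2\ell_B},\quad K_2=-i\ell_B\partial_{x_2}+\tfrac{x_1}{2\ell_B},\quad G_1=-i\ell_B\partial_{x_2}-\tfrac{x_1}{2\ell_B},\quad G_2=-i\ell_B\partial_{x_1}+\tfrac{x_2}{2\ell_B}.$$ Let $H_B=\frac{\epsilon_B}{2}(K_1^2+K_2^2)$ (the Landau Hamiltonian) and $Q_B=\frac12(K_1^2+K_2^2+G_1^2+G_2^2)$ be the self-adjoint closures of these operators on the Schwartz space. For $j\in\mathbb N_0$ let $\Pi_j$ be the orthogonal projection onto the eigenspace of $H_B$ for $E_j=\epsilon_B(j+\frac12)$. For $\xi\ge 0$ put $Q_{B,\xi}^{-1}=(Q_B+2\xi\mathbf 1)^{-1}$, and $\partial_i(A)=-i[X_i,A]$ with $X_1,X_2$ the position operators. For $m\in\mathbb Z^2$ let $(T_m\psi)(x)=(-1)^{m_1m_2}e^{-i\sqrt{\pi/2}\,(m_1x_2-m_2x_1)/\ell_B}\,\psi(x-\sqrt{2\pi}\,\ell_B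 m)$ be the magnetic translations, let $Y_B=[0,\sqrt{2\pi}\,\ell_B]^2$, and let $\mathbb B_B=\mathbb R^2/(\frac{\sqrt{2\pi}}{\ell_B}\mathbb Z)^2$ be the Brillouin torus, with normalized measure $d\mu(k)=\frac{\ell_B^2}{2\pi}dk$. The magnetic Bloch–Floquet–Zak transform $$(\mathcal U_B\psi)_k(y)=\sum_{m\in\mathbb Z^2}e^{-ik\cdot(y-\sqrt{2\pi}\ell_Bm)}(T_m\psi)(y)$$ identifies $L^2(\mathbb R^2)$ with the space of families $k\mapsto\varphi_k\in L^2(Y_B)$ satisfying $\varphi_{k+G}(y)=e^{-iG\cdot y}\varphi_k(y)$ for $G\in\frac{\sqrt{2\pi}}{\ell_B}\mathbb Z^2$, with norm $\big(\int_{\mathbb B_B}\|\varphi_k\|^2d\mu(k)\big)^{1/2}$. Let $k\mapsto\Pi_j(k)$ be the norm-continuous family of operators on $L^2(Y_B)$ with $\mathcal U_B\Pi_j\,\mathcal U_B^{-1}=\int^\oplus_{\mathbb B_B}d\mu(k)\,\Pi_j(k)$, and let $\mathcal E_j\to\mathbb B_B$ be the complex vector bundle with fibers $\mathrm{Ran}\,\Pi_j(k)$.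 Its Chern number is $$c_1(\mathcal E_j)=\frac{i}{2\pi}\int_{\mathbb B_B}\mathrm{Tr}_{L^2(Y_B)}\big(\Pi_j(k)[\partial_{k_1}\Pi_j(k),\partial_{k_2}\Pi_j(k)]\big)\,dk_1\,dk_2 .$$ Then, for every $j\in\mathbb N_0$ and every $\xi\ge0$: the family $k\mapsto\Pi_j(k)$ exists, is continuously differentiable in norm and consists of rank-one orthogonal projections (so $\mathcal E_j$, the $j$-th Landau line bundle, is a line bundle); $$\Pi_j[\partial_1(\Pi_j),\partial_2(\Pi_j)]=-i\ell_B^2\,\Pi_j ;$$ the operator $Q_{B,\xi}^{-1}\Pi_j[\partial_1(\Pi_j),\partial_2(\Pi_j)]$ is a measurable element of the Dixmier ideal; and $$c_1(\mathcal E_j)=\frac{i}{\ell_B^2}\,\mathrm{Tr}_{\mathrm{Dix}}\Big(Q_{B,\xi}^{-1}\,\Pi_j\,[\partial_1(\Pi_j),\partial_2(\Pi_j)]\Big)=1 .$$ Here, for a compact operator $T$ with singular values $\mu_0(T)\ge\mu_1(T)\ge\dots$, put $\gamma_N(T)=\frac1{\log N}\sum_{n<N}\mu_n(T)$. The operator $T$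 is in the Dixmier ideal if $\sup_{N>1}\gamma_N(T)<\infty$, and such a $T$ is measurable if $\gamma_N(T)$ converges. Put $\sigma_s(T)=\inf\{\|R\|_1+s\|S\|: R,S\text{ compact},\,R+S=T\}$, with $\|\cdot\|_1$ the trace norm, and, for $\lambda\ge\lambda_0>e$, $\tau_\lambda(T)=\frac1{\log\lambda}\int_{\lambda_0}^\lambda\frac{\sigma_s(T)}{\log s}\frac{ds}{s}$. For a state $\omega$ of the $C^*$-algebra $C_b([\lambda_0,\infty))/C_0([\lambda_0,\infty))$, the Dixmier trace $\mathrm{Tr}_{\mathrm{Dix},\omega}$ is the linear extension to the Dixmier ideal of the functional $T\mapsto\omega([\lambda\mapsto\tau_\lambda(T)])$ on positive operators. The displayed formula holds for $\mathrm{Tr}_{\mathrm{Dix}}=\mathrm{Tr}_{\mathrm{Dix},\omega}$ with every $\lambda_0>e$ and every $\omega$. -/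

import Mathlib

open MeasureTheory Filter Topology Complex
open scoped SchwartzMap LineDeriv ENNReal ComplexOrder ComplexStarModule BoundedContinuousFunction

noncomputable section

namespace Landau

/-! ### Hilbert spaces -/

/-- The plane `ℝ²`, with Euclidean norm and Lebesgue measure. -/
abbrev Plane : Type := EuclideanSpace ℝ (Fin 2)

/-- The Hilbert space `L²(ℝ²)`. -/
abbrev L2 : Type := Lp ℂ 2 (volume : Measure Plane)

/-- The class in `L²(μ)` of a square integrable function (zero for other functions). -/
def toL2 (μ : Measure Plane) (f : Plane → ℂ) : Lp ℂ 2 μ := by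
  classical exact if h : MemLp f 2 μ then h.toLp f else 0

/-! ### Kinetic momenta and the operators built from them -/

/-- `∂/∂x_i` on Schwartz functions (`i = 0, 1` stand for the coordinates `x₁, x₂`). -/
def partialD (i : Fin 2) : 𝓢(Plane, ℂ) →L[ℂ] 𝓢(Plane, ℂ) :=
  LineDeriv.lineDerivOpCLM ℂ 𝓢(Plane, ℂ) (EuclideanSpace.single i (1 : ℝ))

/-- Multiplication by the coordinate `x_i` on Schwartz functions. -/
def coordMul (i : Fin 2) : 𝓢(Plane, ℂ) →L[ℂ] 𝓢(Plane, ℂ) :=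
  SchwartzMap.smulLeftCLM ℂ (fun x : Plane => ((x i : ℝ) : ℂ))

/-- `K₁ = -i ℓ ∂₁ - x₂ / (2ℓ)`. -/
def K₁ (ℓ : ℝ) : 𝓢(Plane, ℂ) →L[ℂ] 𝓢(Plane, ℂ) :=
  (-I * (ℓ : ℂ)) • partialD 0 - (1 / (2 * (ℓ : ℂ))) • coordMul 1

/-- `K₂ = -i ℓ ∂₂ + x₁ / (2ℓ)`. -/
def K₂ (ℓ : ℝ) : 𝓢(Plane, ℂ) →L[ℂ] 𝓢(Plane, ℂ) :=
  (-I * (ℓ : ℂ)) • partialD 1 + (1 / (2 * (ℓ : ℂ))) • coordMul 0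

/-- `G₁ = -i ℓ ∂₂ - x₁ / (2ℓ)`. -/
def G₁ (ℓ : ℝ) : 𝓢(Plane, ℂ) →L[ℂ] 𝓢(Plane, ℂ) :=
  (-I * (ℓ : ℂ)) • partialD 1 - (1 / (2 * (ℓ : ℂ))) • coordMul 0

/-- `G₂ = -i ℓ ∂₁ + x₂ / (2ℓ)`. -/
def G₂ (ℓ : ℝ) : 𝓢(Plane, ℂ) →L[ℂ] 𝓢(Plane, ℂ) :=
  (-I * (ℓ : ℂ)) • partialD 0 + (1 / (2 * (ℓ : ℂ))) • coordMul 1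

/-- The inclusion of the Schwartz space into `L²(ℝ²)`. -/
def schwartzIncl : 𝓢(Plane, ℂ) →ₗ[ℂ] L2 :=
  (SchwartzMap.toLpCLM ℂ ℂ 2 (volume : Measure Plane)).toLinearMap

theorem schwartzIncl_injective : Function.Injective schwartzIncl :=
  SchwartzMap.injective_toLp 2 (volume : Measure Plane)

/-- The unbounded operator on `L²(ℝ²)` with domain the Schwartz functions which acts as `A`. -/
def schwartzOperator (A : 𝓢(Plane, ℂ) →L[ℂ] 𝓢(Plane, ℂ)) : L2 →ₗ.[ℂ] L2 where
  domain := LinearMap.range schwartzIncl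
  toFun := schwartzIncl ∘ₗ A.toLinearMap ∘ₗ
    (LinearEquiv.ofInjective schwartzIncl schwartzIncl_injective).symm.toLinearMap

/-- The Landau Hamiltonian `H_B = (ε/2) (K₁² + K₂²)`: the closure of the (essentially self-adjoint)
differential operator on the Schwartz core. Here `ε` is the magnetic energy and `ℓ` the magnetic
length. -/
def landauHamiltonian (ε ℓ : ℝ) : L2 →ₗ.[ℂ] L2 :=
  (schwartzOperator (((ε / 2 : ℝ) : ℂ) • (K₁ ℓ ∘L K₁ ℓ + K₂ ℓ ∘L K₂ ℓ))).closure

/-- The harmonic oscillator `Q_B = (1/2) (K₁² + K₂² + G₁² + G₂²)`, i.e. the self-adjoint realization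
of `∑ i, (-ℓ² ∂_i² + x_i² / (4 ℓ²))`. -/
def oscillator (ℓ : ℝ) : L2 →ₗ.[ℂ] L2 :=
  (schwartzOperator ((1 / 2 : ℂ) •
    (K₁ ℓ ∘L K₁ ℓ + K₂ ℓ ∘L K₂ ℓ + G₁ ℓ ∘L G₁ ℓ + G₂ ℓ ∘L G₂ ℓ))).closure

/-- The eigenspace `{ψ ∈ dom H : H ψ = E ψ}` of an unbounded operator. -/
def eigenspace (H : L2 →ₗ.[ℂ] L2) (E : ℂ) : Submodule ℂ L2 :=
  H.graph.comap (LinearMap.prod LinearMap.id (E • LinearMap.id))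

/-- The `j`-th Landau level `E_j = ε (j + 1/2)`. -/
def landauLevel (ε : ℝ) (j : ℕ) : ℝ := ε * (j + 1 / 2)

/-- The Landau projection `Π_j`: the orthogonal projection of `L²(ℝ²)` onto the eigenspace of the
Landau Hamiltonian for `E_j`. (The closure changes nothing, an eigenspace of a closed operator being
closed.) -/
def landauProjection (ε ℓ : ℝ) (j : ℕ) : L2 →L[ℂ] L2 :=
  (eigenspace (landauHamiltonian ε ℓ) (landauLevel ε j : ℂ)).topologicalClosure.starProjection

/-- `R` is the bounded, everywhere defined inverse of the unbounded operator `T`. -/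
def IsBoundedInverse (T : L2 →ₗ.[ℂ] L2) (R : L2 →L[ℂ] L2) : Prop :=
  (∀ ψ : L2, ∃ h : R ψ ∈ T.domain, T ⟨R ψ, h⟩ = ψ) ∧ ∀ φ : T.domain, R (T φ) = φ

/-- The bounded inverse of `T` (zero if there is none). It is unique when it exists. -/
def boundedInverse (T : L2 →ₗ.[ℂ] L2) : L2 →L[ℂ] L2 := by
  classical exact if h : ∃ R, IsBoundedInverse T R then h.choose else 0

/-- The resolvent `Q_{B,ξ}⁻¹ = (Q_B + 2 ξ 1)⁻¹`. -/
def oscillatorResolvent (ℓ ξ : ℝ) : L2 →L[ℂ] L2 :=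
  boundedInverse ((((2 * ξ : ℝ) : ℂ) • (LinearMap.id : L2 →ₗ[ℂ] L2)) +ᵥ oscillator ℓ)

/-! ### Position operators and the associated derivations -/

/-- The maximal domain `{ψ ∈ L²(ℝ²) : x_i ψ ∈ L²(ℝ²)}` of the multiplication by `x_i`. -/
def positionDomain (i : Fin 2) : Submodule ℂ L2 where
  carrier := {ψ | MemLp (fun x : Plane => ((x i : ℝ) : ℂ) * ψ x) 2 volume}
  add_mem' := by
    intro ψ φ hψ hφ
    refine (MemLp.add hψ hφ).ae_eq ?_
    filter_upwards [Lp.coeFn_add ψ φ] with x hx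
    rw [hx]
    simp only [Pi.add_apply, mul_add]
  zero_mem' := by
    refine (MemLp.zero (p := 2) (μ := (volume : Measure Plane)) (ε := ℂ)).ae_eq ?_
    filter_upwards [Lp.coeFn_zero ℂ 2 (volume : Measure Plane)] with x hx
    rw [hx]
    simp only [Pi.zero_apply, mul_zero]
  smul_mem' := by
    intro c ψ hψ
    refine (MemLp.const_smul hψ c).ae_eq ?_
    filter_upwards [Lp.coeFn_smul c ψ] with x hx
    rw [hx]
    simp only [Pi.smul_apply, smul_eq_mul, mul_left_comm]

/-- Multiplication by `x_i` on its maximal domain. -/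
def positionFun (i : Fin 2) (ψ : positionDomain i) : L2 :=
  MemLp.toLp (fun x : Plane => ((x i : ℝ) : ℂ) * (ψ : L2) x) ψ.2

theorem positionFun_coe (i : Fin 2) (ψ : positionDomain i) :
    positionFun i ψ =ᵐ[volume] fun x : Plane => ((x i : ℝ) : ℂ) * (ψ : L2) x :=
  MemLp.coeFn_toLp _

/-- The position operator `X_i`, the multiplication by `x_i` on its maximal domain. -/
def position (i : Fin 2) : L2 →ₗ.[ℂ] L2 where
  domain := positionDomain i
  toFun :=
    { toFun := positionFun i
      map_add' := by
        intro ψ φ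
        refine Lp.ext ?_
        filter_upwards [Lp.coeFn_add (ψ : L2) (φ : L2), positionFun_coe i (ψ + φ),
          positionFun_coe i ψ, positionFun_coe i φ,
          Lp.coeFn_add (positionFun i ψ) (positionFun i φ)] with x h1 h2 h3 h4 h5
        rw [h2, h5, Submodule.coe_add, h1, Pi.add_apply, Pi.add_apply, h3, h4, mul_add]
      map_smul' := by
        intro c ψ
        refine Lp.ext ?_
        rw [RingHom.id_apply]
        filter_upwards [Lp.coeFn_smul c (ψ : L2), positionFun_coe i (c • ψ),
          positionFun_coe i ψ, Lp.coeFn_smul c (positionFun i ψ)] with x h1 h2 h3 h4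
        rw [h2, h4, Submodule.coe_smul, h1, Pi.smul_apply, Pi.smul_apply, h3, smul_eq_mul,
          smul_eq_mul, mul_left_comm] }

/-- `D = -i [X, A]`: the bounded operator `A` preserves the domain of `X`, and on that domain
`D ψ = -i (X A ψ - A X ψ)`. -/
def IsCommutatorDerivative (X : L2 →ₗ.[ℂ] L2) (A D : L2 →L[ℂ] L2) : Prop :=
  ∀ ψ : X.domain, ∃ h : A ψ ∈ X.domain, D ψ = (-I) • (X ⟨A ψ, h⟩ - A (X ψ))

/-- `∂_i(A) = -i [X_i, A]` as a bounded operator (zero if there is no such bounded operator). It is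
unique when it exists, the domain of `X_i` being dense. -/
def derivation (i : Fin 2) (A : L2 →L[ℂ] L2) : L2 →L[ℂ] L2 := by
  classical exact if h : ∃ D, IsCommutatorDerivative (position i) A D then h.choose else 0

/-- `Π_j [∂₁(Π_j), ∂₂(Π_j)]`. -/
def curvatureOperator (ε ℓ : ℝ) (j : ℕ) : L2 →L[ℂ] L2 :=
  landauProjection ε ℓ j *
    (derivation 0 (landauProjection ε ℓ j) * derivation 1 (landauProjection ε ℓ j) -
      derivation 1 (landauProjection ε ℓ j) * derivation 0 (landauProjection ε ℓ j))

/-! ### Dixmier ideal and Dixmier traces -/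

section Dixmier

variable {E : Type*} [NormedAddCommGroup E] [InnerProductSpace ℂ E] [CompleteSpace E]

/-- The `n`-th singular value `μ_n(T) = inf {‖T|_{V^⊥}‖ : dim V = n}` (for compact `T`, the `n`-th
eigenvalue of `|T|` in decreasing order with multiplicities, `n = 0, 1, …`). -/
def singularValue (T : E →L[ℂ] E) (n : ℕ) : ℝ :=
  sInf {r : ℝ | ∃ V : Submodule ℂ E, FiniteDimensional ℂ V ∧ Module.finrank ℂ V = n ∧
    r = ‖T ∘L Vᗮ.subtypeL‖}

/-- `γ_N(T) = (1 / log N) ∑_{n < N} μ_n(T)`. -/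
def gammaSeq (T : E →L[ℂ] E) (N : ℕ) : ℝ :=
  (∑ n ∈ Finset.range N, singularValue T n) / Real.log N

/-- The Dixmier ideal `𝓛^{1⁺}`: compact operators with `sup_{N > 1} γ_N(T) < ∞`. -/
def MemDixmierIdeal (T : E →L[ℂ] E) : Prop :=
  IsCompactOperator T ∧ BddAbove {r : ℝ | ∃ N : ℕ, 1 < N ∧ r = gammaSeq T N}

/-- Measurable elements of the Dixmier ideal: the sequence `γ_N(T)` converges. -/
def IsDixmierMeasurable (T : E →L[ℂ] E) : Prop :=
  MemDixmierIdeal T ∧ ∃ L : ℝ, Tendsto (gammaSeq T) atTop (𝓝 L)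

/-- `σ_s(T) = inf {‖R‖₁ + s ‖S‖ : R, S compact, R + S = T}`, where `‖R‖₁ = ∑ μ_n(R)` is the trace
norm (operators `R` of infinite trace norm do not contribute). -/
def sigmaNorm (T : E →L[ℂ] E) (s : ℝ) : ℝ :=
  sInf {r : ℝ | ∃ R S : E →L[ℂ] E, IsCompactOperator R ∧ IsCompactOperator S ∧ R + S = T ∧
    Summable (singularValue R) ∧ r = (∑' n, singularValue R n) + s * ‖S‖}

/-- The Cesàro mean `τ_t(T) = (1 / log t) ∫_{t₀}^t (σ_s(T) / log s) ds / s`. -/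
def cesaroMean (t₀ : ℝ) (T : E →L[ℂ] E) (t : ℝ) : ℝ :=
  (1 / Real.log t) * ∫ s in t₀..t, sigmaNorm T s / Real.log s / s

/-- A state on the quotient `C*`-algebra `C_b([t₀, ∞)) / C₀([t₀, ∞))`: a positive normalized linear
functional on `C_b([t₀, ∞))` which vanishes on `C₀([t₀, ∞))`. -/
structure DixmierState (t₀ : ℝ) where
  /-- The functional. -/
  toFun : (Set.Ici t₀ →ᵇ ℂ) →ₗ[ℂ] ℂ
  nonneg : ∀ f : Set.Ici t₀ →ᵇ ℂ, (∀ x, 0 ≤ f x) → 0 ≤ toFun f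
  map_one : toFun (BoundedContinuousFunction.const _ 1) = 1
  map_vanishing : ∀ f : Set.Ici t₀ →ᵇ ℂ, Tendsto f atTop (𝓝 0) → toFun f = 0

/-- A bounded continuous real function on `[t₀, ∞)` as an element of `C_b([t₀, ∞))` (zero for other
functions). -/
def toCb (t₀ : ℝ) (f : ℝ → ℝ) : Set.Ici t₀ →ᵇ ℂ := by
  classical exact
    if h : ∃ g : Set.Ici t₀ →ᵇ ℂ, ∀ x : Set.Ici t₀, g x = ((f x : ℝ) : ℂ) then h.choose else 0

/-- The Dixmier trace `ω(τ(T))` of a positive element `T` of the Dixmier ideal. -/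
def dixmierTracePos {t₀ : ℝ} (ω : DixmierState t₀) (T : E →L[ℂ] E) : ℂ :=
  ω.toFun (toCb t₀ (cesaroMean t₀ T))

/-- The Dixmier trace associated with the state `ω`: the linear extension of `ω ∘ τ` from the
positive cone, `T = (A₊ - A₋) + i (B₊ - B₋)` with `A = Re T`, `B = Im T`. -/
def dixmierTrace {t₀ : ℝ} (ω : DixmierState t₀) (T : E →L[ℂ] E) : ℂ :=
  (dixmierTracePos ω (posPart (realPart T : E →L[ℂ] E)) -
      dixmierTracePos ω (negPart (realPart T : E →L[ℂ] E))) +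
    I * (dixmierTracePos ω (posPart (imaginaryPart T : E →L[ℂ] E)) -
      dixmierTracePos ω (negPart (imaginaryPart T : E →L[ℂ] E)))

/-- The trace `∑_n ⟨e_n, T e_n⟩` (in a chosen orthonormal basis; for trace class `T` it does not
depend on that choice). -/
def opTrace (T : E →L[ℂ] E) : ℂ :=
  ∑' i : (exists_hilbertBasis ℂ E).choose,
    inner ℂ ((exists_hilbertBasis ℂ E).choose_spec.choose i)
      (T ((exists_hilbertBasis ℂ E).choose_spec.choose i))

end Dixmier

/-! ### The magnetic Bloch–Floquet–Zak transform -/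

/-- The magnetic unit cell `Y_B = [0, √(2π) ℓ]²`. -/
def unitCell (ℓ : ℝ) : Set Plane := {y | ∀ i, y i ∈ Set.Icc 0 (√(2 * Real.pi) * ℓ)}

/-- The fundamental domain `[0, √(2π) / ℓ]²` of the magnetic Brillouin torus. -/
def brillouinCell (ℓ : ℝ) : Set Plane := {k | ∀ i, k i ∈ Set.Icc 0 (√(2 * Real.pi) / ℓ)}

/-- The fiber Hilbert space `L²(Y_B)`. -/
abbrev Fiber (ℓ : ℝ) : Type := Lp ℂ 2 ((volume : Measure Plane).restrict (unitCell ℓ))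

/-- The integer vector `m`, as a point of the plane. -/
def latticePt (m : Fin 2 → ℤ) : Plane := WithLp.toLp 2 fun i => (m i : ℝ)

/-- The magnetic translation
`(T_m ψ)(x) = (-1)^{m₁ m₂} exp(-i √(π/2) (m ∧ x) / ℓ) ψ(x - √(2π) ℓ m)`,
with `m ∧ x = m₁ x₂ - m₂ x₁`. -/
def magneticTranslation (ℓ : ℝ) (m : Fin 2 → ℤ) (ψ : Plane → ℂ) (x : Plane) : ℂ :=
  ((-1 : ℂ) ^ (m 0 * m 1)) *
    exp (-I * ((√(Real.pi / 2) * (m 0 * x 1 - m 1 * x 0) / ℓ : ℝ) : ℂ)) *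
    ψ (x - (√(2 * Real.pi) * ℓ) • latticePt m)

/-- `(U_B ψ)_k(y) = ∑_m exp(-i k · (y - √(2π) ℓ m)) (T_m ψ)(y)`. -/
def blochZakFun (ℓ : ℝ) (ψ : Plane → ℂ) (k y : Plane) : ℂ :=
  ∑' m : Fin 2 → ℤ,
    exp (-I * ((inner ℝ k (y - (√(2 * Real.pi) * ℓ) • latticePt m) : ℝ) : ℂ)) *
      magneticTranslation ℓ m ψ y

/-- `(U_B ψ)_k` as an element of the fiber `L²(Y_B)`. -/
def blochZak (ℓ : ℝ) (ψ : Plane → ℂ) (k : Plane) : Fiber ℓ :=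
  toL2 _ (blochZakFun ℓ ψ k)

/-- Multiplication of `f ∈ L²(Y_B)` by the phase `exp(-i (√(2π)/ℓ) n · y)`. -/
def phaseMul (ℓ : ℝ) (n : Fin 2 → ℤ) (f : Fiber ℓ) : Fiber ℓ :=
  toL2 _ fun y =>
    exp (-I * ((inner ℝ ((√(2 * Real.pi) / ℓ) • latticePt n) y : ℝ) : ℂ)) * f y

/-- `k ↦ P(k)` is the norm-continuous family of fiber operators of `T` in the magnetic
Bloch–Floquet–Zak representation, `U_B T U_B⁻¹ = ∫^⊕ dμ(k) P(k)`, with `dμ(k) = (ℓ²/2π) dk` the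
normalized measure of the Brillouin torus. The decomposition is expressed through the matrix elements
of `T` on the dense space of continuous compactly supported functions; `equivariant` says that the
family acts on the space of functions with `φ_{k+G}(y) = exp(-i G · y) φ_k(y)`, `G = (√(2π)/ℓ) n`. -/
structure IsBlochFamily (ℓ : ℝ) (T : L2 →L[ℂ] L2) (P : Plane → Fiber ℓ →L[ℂ] Fiber ℓ) : Prop where
  continuous : Continuous P
  equivariant : ∀ (n : Fin 2 → ℤ) (k : Plane) (f : Fiber ℓ),
    P (k + (√(2 * Real.pi) / ℓ) • latticePt n) (phaseMul ℓ n f) = phaseMul ℓ n (P k f)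
  decomposition : ∀ φ ψ : Plane → ℂ, Continuous φ → HasCompactSupport φ →
    Continuous ψ → HasCompactSupport ψ →
    inner ℂ (toL2 volume φ) (T (toL2 volume ψ)) =
      ((ℓ ^ 2 / (2 * Real.pi) : ℝ) : ℂ) *
        ∫ k in brillouinCell ℓ, inner ℂ (blochZak ℓ φ k) (P k (blochZak ℓ ψ k))

/-- The family `k ↦ Π_j(k)` of fiber projections of the Landau projection `Π_j`. -/
def landauFamily (ε ℓ : ℝ) (j : ℕ) : Plane → Fiber ℓ →L[ℂ] Fiber ℓ := by
  classical exact
    if h : ∃ P, IsBlochFamily ℓ (landauProjection ε ℓ j) P then h.choose else 0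

/-- The fiber `Ran Π_j(k)` of the spectral bundle over (the class of) `k` in the Brillouin torus. -/
def landauBundle (ε ℓ : ℝ) (j : ℕ) (k : Plane) : Submodule ℂ (Fiber ℓ) :=
  LinearMap.range (landauFamily ε ℓ j k).toLinearMap

/-- The partial derivative `∂_{k_i} P(k)` in operator norm. -/
def familyDeriv {ℓ : ℝ} (P : Plane → Fiber ℓ →L[ℂ] Fiber ℓ) (i : Fin 2) (k : Plane) :
    Fiber ℓ →L[ℂ] Fiber ℓ :=
  fderiv ℝ P k (EuclideanSpace.single i (1 : ℝ))

/-- The trace `R(k) = Tr (P(k) [∂_{k₁} P(k), ∂_{k₂} P(k)])` of the Grassmann–Berry curvature. -/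
def berryCurvature {ℓ : ℝ} (P : Plane → Fiber ℓ →L[ℂ] Fiber ℓ) (k : Plane) : ℂ :=
  opTrace (P k * (familyDeriv P 0 k * familyDeriv P 1 k - familyDeriv P 1 k * familyDeriv P 0 k))

/-- The (first) Chern number of the vector bundle with fibers `Ran P(k)` over the Brillouin torus:
the integral of the Chern form `(i/2π) R(k) dk₁ ∧ dk₂` of the Grassmann–Berry connection. -/
def chernNumber {ℓ : ℝ} (P : Plane → Fiber ℓ →L[ℂ] Fiber ℓ) : ℂ :=
  ∫ k in brillouinCell ℓ, I / (2 * (Real.pi : ℂ)) * berryCurvature P k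

end Landau

end

/-! Both sides of the formula are computed by explicit diagonalisation.

The pairs `(K₁, K₂)` and `(G₁, G₂)` satisfy canonical commutation relations and commute with each
other. They give ladder operators `a`, `a†` (between Landau levels) and `b`, `b†` (inside a level),
and the normalised vectors obtained from a Gaussian are the functions `landauFun ℓ (n, m)`. These
form a Hilbert basis of Schwartz functions: their span is stable under multiplication by
coordinates, and a function orthogonal to all polynomials times a Gaussian vanishes
(`ae_eq_zero_of_moments`). In this basis `H_B` is `ε (n + 1/2)` and `Q_B` is `n + m + 1`, closures
included (`mem_graph_closure`), so `Π_j` is the projection onto `n = j`.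

Noncommutative side: the positions are linear in the ladder operators, and `b`, `b†` commute with
`Π_j`, so `∂_i(Π_j)` involves only `[a, Π_j]` and `[a†, Π_j]`. In `Π_j [∂₁(Π_j), ∂₂(Π_j)]` the
weights `j + 1` and `j` are subtracted, which leaves `-i ℓ² Π_j` for every `j`. Times the resolvent
this is `-i` times a positive operator with eigenvalues `ℓ² / (m + j + 1 + 2ξ)`. Harmonic
eigenvalues give `σ_s = ℓ² log s + O(1)` (`harmonic_asymptotics`), so the Cesàro means converge and
every state `ω` takes the same value `-i ℓ²`.

Geometric side: `landauFun ℓ (n, m)` is a superposition over `s` of generalised eigenfunctions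
`planarWave ℓ n s`, with weight the Hermite function `h_m(s)` (`landauFun_eq_superposition`). Hence
`Π_j` is the integral over `s` of the rank-one forms of these waves, and grouping `s` by cosets of
`√(2π) ℤ` produces the Zak transform. The fiber at `k` is the projection onto one unit vector `u_k`,
the Zak image of the phase-space translate of `h_j` by `ℓ k` (`decomposition_blochProjection`). The
Zak map is isometric from the line to the fiber, so the curvature reduces to inner products of
`h_j`, `t h_j` and `h_j'`. Since `⟨t h_j, h_j'⟩ = -1/2`, the curvature is the constant `-i ℓ²`, and
the area `2π / ℓ²` of the Brillouin torus gives Chern number `1`.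

The family in the statement is obtained by choice. It equals the explicit one because the fiber
operators of a decomposable operator are unique (`IsBlochFamily.unique`): matrix elements against
translates of bumps are Fourier coefficients in `k`. -/

noncomputable section

namespace Landau

/-! ### Diagonal operators and their singular values. -/

section Diagonal

variable {E : Type*} [NormedAddCommGroup E] [InnerProductSpace ℂ E] {ι : Type*}

/-- `T = ∑ i, c i |f i⟩⟨e i|`, the sum converging strongly. -/
def IsTransfer (e f : ι → E) (c : ι → ℂ) (T : E →L[ℂ] E) : Prop :=
  ∀ x, HasSum (fun i => (c i * inner ℂ (e i) x) • f i) (T x)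

theorem norm_sum_smul_sq {f : ι → E} (hf : Orthonormal ℂ f) (a : ι → ℂ) (s : Finset ι) :
    ‖∑ i ∈ s, a i • f i‖ ^ 2 = ∑ i ∈ s, ‖a i‖ ^ 2 := by
  have h := hf.inner_sum a a s
  rw [inner_self_eq_norm_sq_to_K] at h
  have h2 : ((‖∑ i ∈ s, a i • f i‖ ^ 2 : ℝ) : ℂ) = ((∑ i ∈ s, ‖a i‖ ^ 2 : ℝ) : ℂ) := by
    push_cast
    rw [← Complex.coe_algebraMap] at *
    refine h.trans (Finset.sum_congr rfl fun i _ => ?_)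
    rw [RCLike.conj_mul]
  exact_mod_cast h2

/-- Pythagoras for finite partial sums in `f`, then Bessel's inequality for `e`. Both the existence
and the norm bounds of diagonal operators rest on it. -/
theorem norm_le_of_hasSum {e f : ι → E} (he : Orthonormal ℂ e) (hf : Orthonormal ℂ f) {a : ι → ℂ}
    {x y : E} (hy : HasSum (fun i => a i • f i) y) {C : ℝ} (hC : 0 ≤ C)
    (ha : ∀ i, ‖a i‖ ≤ C * ‖inner ℂ (e i) x‖) : ‖y‖ ≤ C * ‖x‖ := by
  refine le_of_tendsto hy.norm (Eventually.of_forall fun s => ?_)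
  refine (sq_le_sq₀ (norm_nonneg _) (by positivity)).1 ?_
  rw [norm_sum_smul_sq hf, mul_pow]
  calc ∑ i ∈ s, ‖a i‖ ^ 2 ≤ ∑ i ∈ s, C ^ 2 * ‖inner ℂ (e i) x‖ ^ 2 := by
        refine Finset.sum_le_sum fun i _ => ?_
        rw [← mul_pow]
        exact pow_le_pow_left₀ (norm_nonneg _) (ha i) 2
    _ ≤ C ^ 2 * ‖x‖ ^ 2 := by
        rw [← Finset.mul_sum]
        exact mul_le_mul_of_nonneg_left (he.sum_inner_products_le x) (by positivity)

theorem exists_isTransfer [CompleteSpace E] {e f : ι → E} (he : Orthonormal ℂ e)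
    (hf : Orthonormal ℂ f) {c : ι → ℂ} {C : ℝ} (hc : ∀ i, ‖c i‖ ≤ C) :
    ∃ T, IsTransfer e f c T := by
  have hsum : ∀ x, Summable fun i => (c i * inner ℂ (e i) x) • f i := by
    intro x
    have h := (hf.orthogonalFamily.summable_iff_norm_sq_summable
      (fun i => (c i * inner ℂ (e i) x : ℂ))).2 ?_
    · simpa using h
    · refine Summable.of_nonneg_of_le (fun i => by positivity) (fun i => ?_)
        ((he.inner_products_summable x).mul_left (C ^ 2))
      rw [norm_mul, mul_pow]
      gcongr
      exact hc i
  have hC : 0 ≤ max C 0 := le_max_right _ _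
  refine ⟨LinearMap.mkContinuous
    { toFun := fun x => ∑' i, (c i * inner ℂ (e i) x) • f i
      map_add' := fun x y => by
        rw [← (hsum x).tsum_add (hsum y)]
        simp only [inner_add_right, mul_add, add_smul]
      map_smul' := fun r x => by
        rw [RingHom.id_apply, ← (hsum x).tsum_const_smul]
        refine tsum_congr fun i => ?_
        rw [inner_smul_right, smul_smul, mul_left_comm] } (max C 0) fun x => ?_,
    fun x => (hsum x).hasSum⟩
  refine norm_le_of_hasSum he hf (hsum x).hasSum hC fun i => ?_
  rw [norm_mul]
  gcongr
  exact (hc i).trans (le_max_left _ _)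

namespace IsTransfer

variable {e f : ι → E} {c : ι → ℂ} {T : E →L[ℂ] E}

theorem inner_right (hT : IsTransfer e f c T) (x y : E) :
    HasSum (fun i => c i * inner ℂ (e i) x * inner ℂ y (f i)) (inner ℂ y (T x)) := by
  have := (hT x).mapL (innerSL ℂ y)
  simpa [inner_smul_right] using this

theorem apply_self (hT : IsTransfer e f c T) (he : Orthonormal ℂ e) (i : ι) :
    T (e i) = c i • f i := by
  classical
  refine (hT (e i)).unique ?_
  convert hasSum_ite_eq i (c i • f i) using 2 with k
  rw [orthonormal_iff_ite.1 he]
  split_ifs with h <;> simp [h]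

theorem apply_eq_zero (hT : IsTransfer e f c T) {x : E} (hx : ∀ i, inner ℂ (e i) x = 0) :
    T x = 0 := by
  refine (hT x).unique ?_
  simp [hx]

theorem opNorm_le (hT : IsTransfer e f c T) (he : Orthonormal ℂ e) (hf : Orthonormal ℂ f) {C : ℝ}
    (hC : 0 ≤ C) (hc : ∀ i, ‖c i‖ ≤ C) : ‖T‖ ≤ C := by
  refine T.opNorm_le_bound hC fun x => norm_le_of_hasSum he hf (hT x) hC fun i => ?_
  rw [norm_mul]
  gcongr
  exact hc i

theorem sub {c' : ι → ℂ} {T' : E →L[ℂ] E} (hT : IsTransfer e f c T) (hT' : IsTransfer e f c' T') :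
    IsTransfer e f (fun i => c i - c' i) (T - T') := by
  intro x
  simpa [sub_mul, sub_smul] using (hT x).sub (hT' x)

theorem isCompactOperator_of_finite [DecidableEq ι] (hT : IsTransfer e f c T) (s : Finset ι)
    (hs : ∀ i ∉ s, c i = 0) : IsCompactOperator T := by
  have h : T = ∑ i ∈ s, (c i • innerSL ℂ (e i)).smulRight (f i) := by
    ext x
    refine (hT x).unique ?_
    have : HasSum (fun i => (c i * inner ℂ (e i) x) • f i)
        (∑ i ∈ s, (c i * inner ℂ (e i) x) • f i) :=
      hasSum_sum_of_ne_finset_zero (fun i hi => by simp [hs i hi])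
    simpa [sum_apply] using this
  have h2 : ∀ i ∈ s, (c i • innerSL ℂ (e i)).smulRight (f i) ∈
      compactOperator (RingHom.id ℂ) E E := fun i _ => by
    have h3 : IsCompactOperator (c i • innerSL ℂ (e i) : E →L[ℂ] ℂ) :=
      isCompactOperator_of_locallyCompactSpace_dom _
    exact (h3.clm_comp ((ContinuousLinearMap.id ℂ ℂ).smulRight (f i)))
  have := Submodule.sum_mem _ h2
  rw [h]
  simpa [compactOperator] using this

theorem isPositive (hT : IsTransfer e e c T) (hc : ∀ i, 0 ≤ c i) : T.IsPositive := by
  have key : ∀ x, 0 ≤ inner ℂ x (T x) := fun x => by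
    refine (hT.inner_right x x).nonneg fun i => ?_
    rw [mul_assoc, ← inner_conj_symm x (e i), Complex.mul_conj]
    exact mul_nonneg (hc i) (by exact_mod_cast Complex.normSq_nonneg _)
  rw [ContinuousLinearMap.isPositive_iff_complex]
  intro x
  have h := key x
  rw [← inner_conj_symm] at h
  have h2 : 0 ≤ inner ℂ (T x) x := by
    have := star_nonneg_iff.2 h
    simpa using this
  rw [Complex.nonneg_iff] at h2
  refine ⟨?_, h2.1⟩
  apply Complex.ext
  · simp
  · simpa using h2.2

end IsTransfer

theorem singularValue_nonneg (T : E →L[ℂ] E) (n : ℕ) : 0 ≤ singularValue T n := by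
  refine Real.sInf_nonneg ?_
  rintro r ⟨V, _, _, rfl⟩
  exact norm_nonneg (T ∘L Vᗮ.subtypeL)

theorem singularValue_le (T : E →L[ℂ] E) (V : Submodule ℂ E) [FiniteDimensional ℂ V] :
    singularValue T (Module.finrank ℂ V) ≤ ‖T ∘L Vᗮ.subtypeL‖ := by
  refine csInf_le ⟨0, ?_⟩ ⟨V, inferInstance, rfl, rfl⟩
  rintro r ⟨W, _, _, rfl⟩
  exact norm_nonneg (T ∘L Wᗮ.subtypeL)

theorem finrank_span_range_fin {e : ℕ → E} (he : Orthonormal ℂ e) (n : ℕ) :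
    Module.finrank ℂ (Submodule.span ℂ (Set.range fun i : Fin n => e i)) = n := by
  have h : LinearIndependent ℂ (fun i : Fin n => e i) :=
    he.linearIndependent.comp _ Fin.val_injective
  simpa using finrank_span_eq_card h

/-- The orthonormal sequence only ensures that subspaces of dimension `n` exist; otherwise the
infimum would be that of the empty set, which is `0` by convention. -/
theorem le_singularValue {e : ℕ → E} (he : Orthonormal ℂ e) {T : E →L[ℂ] E} {n : ℕ} {b : ℝ}
    (h : ∀ V : Submodule ℂ E, FiniteDimensional ℂ V → Module.finrank ℂ V = n →
      b ≤ ‖T ∘L Vᗮ.subtypeL‖) : b ≤ singularValue T n := by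
  refine le_csInf ⟨_, _, ?_, finrank_span_range_fin he n, rfl⟩ ?_
  · exact FiniteDimensional.span_of_finite ℂ (Set.finite_range _)
  · rintro r ⟨V, hV, hn, rfl⟩
    exact h V hV hn

/-- Every subspace that is admissible for `R` is admissible for `R + S`, at an additional cost of at
most `‖S‖`. -/
theorem singularValue_add_le {e : ℕ → E} (he : Orthonormal ℂ e) (R S : E →L[ℂ] E) (n : ℕ) :
    singularValue (R + S) n ≤ singularValue R n + ‖S‖ := by
  rw [← sub_le_iff_le_add]
  refine le_singularValue he fun V hV hn => ?_
  rw [sub_le_iff_le_add]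
  subst hn
  refine (singularValue_le (R + S) V).trans ?_
  rw [ContinuousLinearMap.add_comp]
  refine (norm_add_le (R ∘L Vᗮ.subtypeL) (S ∘L Vᗮ.subtypeL)).trans ?_
  gcongr
  refine (ContinuousLinearMap.opNorm_comp_le _ _).trans ?_
  exact mul_le_of_le_one_right (norm_nonneg S) (Submodule.norm_subtypeL_le Vᗮ)

/-- Min-max principle. The span of the first `n` vectors gives the upper bound. For the lower bound,
the span of the first `n + 1` vectors meets `Vᗮ` for every `V` of dimension `n`, and `T` expands
that span by at least `c n`. -/
theorem singularValue_of_isTransfer {e : ℕ → E} (he : Orthonormal ℂ e) {c : ℕ → ℝ}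
    (hc : Antitone c) (h0 : ∀ n, 0 ≤ c n) {T : E →L[ℂ] E}
    (hT : IsTransfer e e (fun n => (c n : ℂ)) T) (n : ℕ) : singularValue T n = c n := by
  refine le_antisymm ?_ ?_
  · have : FiniteDimensional ℂ (Submodule.span ℂ (Set.range fun i : Fin n => e i)) :=
      FiniteDimensional.span_of_finite ℂ (Set.finite_range _)
    have h := singularValue_le T (Submodule.span ℂ (Set.range fun i : Fin n => e i))
    rw [finrank_span_range_fin he n] at h
    refine h.trans (ContinuousLinearMap.opNorm_le_bound _ (h0 n) fun x => ?_)
    refine norm_le_of_hasSum he he (hT x) (h0 n) fun i => ?_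
    rw [norm_mul, Complex.norm_real, Real.norm_of_nonneg (h0 i)]
    by_cases hi : i < n
    · have : inner ℂ (e i) (x : E) = 0 :=
        (Submodule.mem_orthogonal _ _).1 x.2 _ (Submodule.subset_span ⟨⟨i, hi⟩, rfl⟩)
      simp [this]
    · exact mul_le_mul_of_nonneg_right (hc (not_lt.1 hi)) (norm_nonneg _)
  · refine le_singularValue he fun V hV hn => ?_
    let Φ : (Fin (n + 1) → ℂ) →ₗ[ℂ] V := V.orthogonalProjectionOnto.toLinearMap ∘ₗ
      Fintype.linearCombination ℂ (fun i : Fin (n + 1) => e i)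
    have hker : LinearMap.ker Φ ≠ ⊥ := LinearMap.ker_ne_bot_of_finrank_lt (by simp [hn])
    obtain ⟨α, hα, hα0⟩ := (Submodule.ne_bot_iff _).1 hker
    let v : E := ∑ i, α i • e i
    have hv : v ∈ Vᗮ := by
      have : V.orthogonalProjectionOnto v = 0 := by
        simpa [Φ, v, Fintype.linearCombination_apply] using hα
      exact Submodule.orthogonalProjectionOnto_eq_zero_iff.1 this
    have hof : Orthonormal ℂ (fun i : Fin (n + 1) => e i) := he.comp _ Fin.val_injective
    have hvn : ‖v‖ ^ 2 = ∑ i, ‖α i‖ ^ 2 := norm_sum_smul_sq hof α Finset.univ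
    have hTv : T v = ∑ i : Fin (n + 1), ((c i : ℂ) * α i) • e i := by
      simp only [v, map_sum, map_smul, hT.apply_self he, smul_smul]
      simp only [mul_comm]
    have hTn : ‖T v‖ ^ 2 = ∑ i : Fin (n + 1), ‖(c i : ℂ) * α i‖ ^ 2 := by
      rw [hTv]; exact norm_sum_smul_sq hof _ Finset.univ
    have hvpos : 0 < ‖v‖ := by
      have : 0 < ‖v‖ ^ 2 := by
        rw [hvn]
        obtain ⟨i, hi⟩ := Function.ne_iff.1 hα0
        refine Finset.sum_pos' (fun _ _ => by positivity) ⟨i, Finset.mem_univ _, ?_⟩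
        have : 0 < ‖α i‖ := norm_pos_iff.2 hi
        positivity
      exact pos_of_mul_pos_left (by rwa [← sq]) (norm_nonneg _)
    have hle : c n * ‖v‖ ≤ ‖T v‖ := by
      refine (sq_le_sq₀ (by have := h0 n; positivity) (norm_nonneg _)).1 ?_
      rw [hTn, mul_pow, hvn, Finset.mul_sum]
      refine Finset.sum_le_sum fun i _ => ?_
      rw [norm_mul, mul_pow, Complex.norm_real, Real.norm_of_nonneg (h0 i)]
      have h3 := hc (Nat.lt_succ_iff.1 i.2)
      exact mul_le_mul_of_nonneg_right (pow_le_pow_left₀ (h0 n) h3 2) (by positivity)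
    have h2 := (T ∘L Vᗮ.subtypeL).le_opNorm ⟨v, hv⟩
    exact le_of_mul_le_mul_right (hle.trans h2) hvpos

/-- The operator is a norm limit of its finite-rank truncations. The truncations are part of the
conclusion because they are the trace class summands that bound `sigmaNorm` from above. -/
theorem isCompactOperator_of_isTransfer [CompleteSpace E] {e : ℕ → E} (he : Orthonormal ℂ e)
    {c : ℕ → ℝ} (hc : Antitone c) (h0 : ∀ n, 0 ≤ c n) (hlim : Tendsto c atTop (𝓝 0))
    {T : E →L[ℂ] E} (hT : IsTransfer e e (fun n => (c n : ℂ)) T) :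
    IsCompactOperator T ∧ ∀ N : ℕ, ∃ R : E →L[ℂ] E,
      IsTransfer e e (fun n => ((if n < N then c n else 0 : ℝ) : ℂ)) R ∧ IsCompactOperator R ∧
      ‖T - R‖ ≤ c N := by
  have hb : ∀ N n : ℕ, ‖((if n < N then c n else 0 : ℝ) : ℂ)‖ ≤ c 0 := by
    intro N n
    rw [Complex.norm_real]
    split_ifs
    · rw [Real.norm_of_nonneg (h0 n)]
      exact hc (Nat.zero_le n)
    · simpa using h0 0
  choose R hR using fun N => exists_isTransfer he he (hb N)
  have hRc : ∀ N, IsCompactOperator (R N) := fun N =>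
    (hR N).isCompactOperator_of_finite (Finset.range N) fun i hi => by
      simp [show ¬ i < N by simpa using hi]
  have hn : ∀ N, ‖T - R N‖ ≤ c N := fun N => by
    refine (hT.sub (hR N)).opNorm_le he he (h0 N) fun i => ?_
    rw [← Complex.ofReal_sub, Complex.norm_real]
    split_ifs with h
    · simpa using h0 N
    · rw [sub_zero, Real.norm_of_nonneg (h0 i)]
      exact hc (not_lt.1 h)
  refine ⟨?_, fun N => ⟨R N, hR N, hRc N, hn N⟩⟩
  refine isCompactOperator_of_tendsto (l := atTop) (F := R) ?_ (Eventually.of_forall hRc)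
  rw [tendsto_iff_norm_sub_tendsto_zero]
  refine squeeze_zero (fun _ => norm_nonneg _) (fun N => ?_) hlim
  rw [norm_sub_rev]
  exact hn N

end Diagonal

/-! ### Harmonic sums, logarithmic Cesàro means and states at infinity. -/

section Asymptotics

/-- Telescoping comparison: the increment `log (x + 1) - log x` lies between `1 / (x + 1)` and `1 /
x`. Only the uniformity of the bound in `N` matters. -/
theorem abs_sum_inv_sub_log_le {a : ℝ} (ha : 0 < a) (N : ℕ) (hN : 1 ≤ N) :
    |∑ n ∈ Finset.range N, 1 / (n + a) - Real.log N| ≤ |Real.log a| + 1 / a + Real.log (1 + a) := by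
  have hstep : ∀ x : ℝ, 0 < x → 1 / (x + 1) ≤ Real.log (x + 1) - Real.log x ∧
      Real.log (x + 1) - Real.log x ≤ 1 / x := by
    intro x hx
    rw [← Real.log_div (by positivity) hx.ne']
    constructor
    · have := Real.one_sub_inv_le_log_of_pos (show 0 < (x + 1) / x by positivity)
      refine le_trans (le_of_eq ?_) this
      field_simp
      ring
    · have := Real.log_le_sub_one_of_pos (show 0 < (x + 1) / x by positivity)
      refine this.trans (le_of_eq ?_)
      field_simp
      ring
  have hlow : ∀ N : ℕ, Real.log (N + a) - Real.log a ≤ ∑ n ∈ Finset.range N, 1 / (n + a) := by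
    intro N
    induction N with
    | zero => simp
    | succ N ih =>
      rw [Finset.sum_range_succ]
      have := (hstep (N + a) (by positivity)).2
      push_cast
      rw [show (N : ℝ) + 1 + a = N + a + 1 by ring]
      linarith
  have hup : ∀ N : ℕ, ∑ n ∈ Finset.range (N + 1), 1 / (n + a) ≤
      1 / a + Real.log (N + a) - Real.log a := by
    intro N
    induction N with
    | zero => simp
    | succ N ih =>
      rw [Finset.sum_range_succ]
      have := (hstep (N + a) (by positivity)).1
      push_cast
      rw [show (N : ℝ) + 1 + a = N + a + 1 by ring]
      linarith
  obtain ⟨M, rfl⟩ : ∃ M, N = M + 1 := ⟨N - 1, by omega⟩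
  have hM : (0 : ℝ) < ((M + 1 : ℕ) : ℝ) := by positivity
  have h1 : Real.log ((M + 1 : ℕ) : ℝ) ≤ Real.log ((M + 1 : ℕ) + a) :=
    Real.log_le_log hM (by linarith)
  have h2 : Real.log (M + a) ≤ Real.log ((M + 1 : ℕ) : ℝ) + Real.log (1 + a) := by
    rw [← Real.log_mul hM.ne' (by positivity)]
    refine Real.log_le_log (by positivity) ?_
    push_cast
    nlinarith [(Nat.cast_nonneg M : (0 : ℝ) ≤ M)]
  have h3 := hlow (M + 1)
  have h4 := hup M
  have h5 : 0 ≤ Real.log (1 + a) := Real.log_nonneg (by linarith)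
  have h6 : 0 < 1 / a := by positivity
  rw [abs_le]
  constructor <;> linarith [neg_abs_le (Real.log a), le_abs_self (Real.log a)]

variable {f : ℝ → ℝ} {K C t₀ : ℝ}

/-- Monotonicity is the regularity of `sigmaNorm` that is at hand, and it suffices for
integrability; `t₀ > e` keeps `log` away from `0`. -/
theorem intervalIntegrable_div_log (hf : MonotoneOn f (Set.Ici 1)) (ht₀ : Real.exp 1 < t₀) {t : ℝ}
    (ht : t₀ ≤ t) : IntervalIntegrable (fun s => f s / Real.log s / s) volume t₀ t := by
  have h1 : (1 : ℝ) < t₀ := (Real.one_lt_exp_iff.2 one_pos).trans ht₀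
  have h2 : IntervalIntegrable f volume t₀ t := by
    refine (hf.mono ?_).intervalIntegrable
    rw [Set.uIcc_of_le ht]
    exact fun x hx => h1.le.trans hx.1
  have h3 : ContinuousOn (fun s => (Real.log s)⁻¹ * s⁻¹) (Set.uIcc t₀ t) := by
    rw [Set.uIcc_of_le ht]
    have hpos : ∀ x ∈ Set.Icc t₀ t, 1 < x := fun x hx => h1.trans_le hx.1
    refine ContinuousOn.mul (ContinuousOn.inv₀ (Real.continuousOn_log.mono fun x hx => ?_)
      fun x hx => (Real.log_pos (hpos x hx)).ne') (continuousOn_id.inv₀ fun x hx => ?_)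
    · have := hpos x hx
      simp only [Set.mem_compl_iff, Set.mem_singleton_iff]
      linarith
    · have := hpos x hx
      simp only [id]
      linarith
  refine (h2.mul_continuousOn h3).congr fun s _ => ?_
  ring_nf

/-- The main term `K log s` contributes `K ∫ ds / s`, and the bounded error at most `C ∫ ds / (s log
s)`, whose primitive is `log log s`. -/
theorem abs_integral_div_log_sub_le (hf : MonotoneOn f (Set.Ici 1)) (ht₀ : Real.exp 1 < t₀)
    (hC : ∀ s, 1 ≤ s → |f s - K * Real.log s| ≤ C) {t : ℝ} (ht : t₀ ≤ t) :
    |(∫ s in t₀..t, f s / Real.log s / s) - K * (Real.log t - Real.log t₀)| ≤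
      C * (Real.log (Real.log t) - Real.log (Real.log t₀)) := by
  have h1 : (1 : ℝ) < t₀ := (Real.one_lt_exp_iff.2 one_pos).trans ht₀
  have hpos : ∀ x ∈ Set.uIcc t₀ t, 1 < x := by
    rw [Set.uIcc_of_le ht]
    exact fun x hx => h1.trans_le hx.1
  have hd1 : ∀ x ∈ Set.uIcc t₀ t, HasDerivAt Real.log (x⁻¹) x := fun x hx =>
    Real.hasDerivAt_log (by linarith [hpos x hx])
  have hd2 : ∀ x ∈ Set.uIcc t₀ t,
      HasDerivAt (fun x => Real.log (Real.log x)) (x⁻¹ / Real.log x) x := fun x hx =>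
    (hd1 x hx).log (Real.log_pos (hpos x hx)).ne'
  have hc1 : ContinuousOn (fun x : ℝ => x⁻¹) (Set.uIcc t₀ t) :=
    continuousOn_id.inv₀ fun x hx => by
      have := hpos x hx
      simp only [id]
      linarith
  have hc2 : ContinuousOn (fun x : ℝ => x⁻¹ / Real.log x) (Set.uIcc t₀ t) :=
    hc1.div (fun x hx => (hd1 x hx).continuousAt.continuousWithinAt)
      fun x hx => (Real.log_pos (hpos x hx)).ne'
  have hi1 := intervalIntegral.integral_eq_sub_of_hasDerivAt hd1 hc1.intervalIntegrable
  have hi2 := intervalIntegral.integral_eq_sub_of_hasDerivAt hd2 hc2.intervalIntegrable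
  have hfi := intervalIntegrable_div_log hf ht₀ ht
  rw [← hi1, ← hi2, ← intervalIntegral.integral_const_mul, ← intervalIntegral.integral_const_mul,
    ← intervalIntegral.integral_sub hfi (hc1.intervalIntegrable.const_mul K)]
  have hi3 : IntervalIntegrable (fun x => C * (x⁻¹ / Real.log x)) volume t₀ t :=
    hc2.intervalIntegrable.const_mul C
  rw [← Real.norm_eq_abs]
  refine intervalIntegral.norm_integral_le_of_norm_le ht (Eventually.of_forall fun x hx => ?_) hi3
  have hx1 : 1 < x := hpos x (by rw [Set.uIcc_of_le ht]; exact ⟨hx.1.le, hx.2⟩)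
  have hl := Real.log_pos hx1
  have hx0 : 0 < x := by linarith
  have : f x / Real.log x / x - K * x⁻¹ = (f x - K * Real.log x) * (x⁻¹ / Real.log x) := by
    field_simp
  rw [this, norm_mul, Real.norm_of_nonneg (show 0 ≤ x⁻¹ / Real.log x by positivity)]
  exact mul_le_mul_of_nonneg_right (hC x hx1.le) (by positivity)

theorem tendsto_log_log_div_log :
    Tendsto (fun t : ℝ => Real.log (Real.log t) / Real.log t) atTop (𝓝 0) := by
  have h : Tendsto (fun x : ℝ => Real.log x / x) atTop (𝓝 0) := by
    simpa using Real.isLittleO_log_id_atTop.tendsto_div_nhds_zero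
  exact h.comp Real.tendsto_log_atTop

theorem tendsto_cesaro (hf : MonotoneOn f (Set.Ici 1)) (ht₀ : Real.exp 1 < t₀)
    (hC : ∀ s, 1 ≤ s → |f s - K * Real.log s| ≤ C) :
    Tendsto (fun t => (1 / Real.log t) * ∫ s in t₀..t, f s / Real.log s / s) atTop (𝓝 K) := by
  have hinv : Tendsto (fun t : ℝ => (Real.log t)⁻¹) atTop (𝓝 0) :=
    tendsto_inv_atTop_zero.comp Real.tendsto_log_atTop
  have hb : Tendsto (fun t : ℝ => |K * Real.log t₀| * (Real.log t)⁻¹ +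
      (C * (Real.log (Real.log t) / Real.log t) - C * Real.log (Real.log t₀) * (Real.log t)⁻¹))
      atTop (𝓝 0) := by
    simpa using (hinv.const_mul _).add
      ((tendsto_log_log_div_log.const_mul C).sub (hinv.const_mul (C * Real.log (Real.log t₀))))
  rw [tendsto_iff_norm_sub_tendsto_zero]
  refine squeeze_zero' (Eventually.of_forall fun _ => norm_nonneg _) ?_ hb
  filter_upwards [eventually_ge_atTop t₀] with t ht
  have h1 : (1 : ℝ) < t := ((Real.one_lt_exp_iff.2 one_pos).trans ht₀).trans_le ht
  have hl := Real.log_pos h1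
  have h := abs_integral_div_log_sub_le hf ht₀ hC ht
  set J := ∫ s in t₀..t, f s / Real.log s / s
  have e : 1 / Real.log t * J - K =
      (J - K * (Real.log t - Real.log t₀) - K * Real.log t₀) * (Real.log t)⁻¹ := by
    field_simp
    ring
  rw [e, norm_mul, Real.norm_of_nonneg (inv_nonneg.2 hl.le), Real.norm_eq_abs]
  calc _ ≤ (C * (Real.log (Real.log t) - Real.log (Real.log t₀)) + |K * Real.log t₀|) *
        (Real.log t)⁻¹ := by
        refine mul_le_mul_of_nonneg_right ((abs_sub _ _).trans ?_) (inv_nonneg.2 hl.le)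
        gcongr
    _ = _ := by
        field_simp
        ring

/-- Needed because `toCb` keeps only functions that are continuous and bounded on `[t₀, ∞)`. -/
theorem continuousOn_cesaro (hf : MonotoneOn f (Set.Ici 1)) (ht₀ : Real.exp 1 < t₀) :
    ContinuousOn (fun t => (1 / Real.log t) * ∫ s in t₀..t, f s / Real.log s / s)
      (Set.Ici t₀) := by
  have h1 : (1 : ℝ) < t₀ := (Real.one_lt_exp_iff.2 one_pos).trans ht₀
  refine ContinuousOn.mul (continuousOn_const.div (Real.continuousOn_log.mono fun x hx => ?_)
    fun x hx => (Real.log_pos (h1.trans_le hx)).ne') ?_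
  · have : t₀ ≤ x := hx
    simp only [Set.mem_compl_iff, Set.mem_singleton_iff]
    linarith
  · intro t ht
    have ht' : t₀ ≤ t + 1 := by have : t₀ ≤ t := ht; linarith
    have h := intervalIntegral.continuousOn_primitive_interval'
      (intervalIntegrable_div_log hf ht₀ ht') Set.left_mem_uIcc
    rw [Set.uIcc_of_le ht'] at h
    refine (h t ⟨ht, by linarith⟩).mono_of_mem_nhdsWithin ?_
    have : Set.Iio (t + 1) ∈ 𝓝[Set.Ici t₀] t := mem_nhdsWithin_of_mem_nhds (Iio_mem_nhds (by linarith))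
    filter_upwards [this, self_mem_nhdsWithin] with x hx hx2
    exact ⟨hx2, hx.le⟩

/-- The function differs from the constant `K` by an element of `C₀`, on which every state of the
quotient vanishes. This is why the result does not depend on `ω`. -/
theorem state_of_tendsto {t₀ : ℝ} (ω : DixmierState t₀) {F : ℝ → ℝ}
    (hF : ContinuousOn F (Set.Ici t₀)) (hlim : Tendsto F atTop (𝓝 K)) :
    ω.toFun (toCb t₀ F) = K := by
  have hcont : Continuous fun x : Set.Ici t₀ => ((F x : ℝ) : ℂ) :=
    continuous_ofReal.comp (continuousOn_iff_continuous_domRestrict.1 hF)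
  have hbdd : ∃ B, ∀ x : Set.Ici t₀, ‖((F x : ℝ) : ℂ)‖ ≤ B := by
    have hev : ∀ᶠ t in atTop, |F t| ≤ |K| + 1 := by
      filter_upwards [hlim.abs.eventually (gt_mem_nhds (lt_add_one |K|))] with t ht using ht.le
    obtain ⟨T, hT⟩ := eventually_atTop.1 hev
    obtain ⟨B, hB⟩ := (isCompact_Icc (a := t₀) (b := T)).exists_bound_of_continuousOn
      (hF.mono Set.Icc_subset_Ici_self)
    refine ⟨max B (|K| + 1), fun x => ?_⟩
    rw [Complex.norm_real]
    rcases le_total (x : ℝ) T with h | h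
    · exact (hB x ⟨x.2, h⟩).trans (le_max_left _ _)
    · exact (hT x h).trans (le_max_right _ _)
  obtain ⟨B, hB⟩ := hbdd
  -- This rules out the default value `0` of `toCb`.
  have hex : ∃ g : Set.Ici t₀ →ᵇ ℂ, ∀ x : Set.Ici t₀, g x = ((F x : ℝ) : ℂ) :=
    ⟨BoundedContinuousFunction.ofNormedAddCommGroup _ hcont B hB, fun _ => rfl⟩
  have hg : ∀ x : Set.Ici t₀, toCb t₀ F x = ((F x : ℝ) : ℂ) := by
    rw [toCb, dif_pos hex]
    exact hex.choose_spec
  have hz : ω.toFun (toCb t₀ F - (K : ℂ) • BoundedContinuousFunction.const _ 1) = 0 := by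
    refine ω.map_vanishing _ ?_
    have h1 : Tendsto (fun x : Set.Ici t₀ => F x) atTop (𝓝 K) :=
      tendsto_comp_val_Ici_atTop.2 hlim
    have h2 := ((continuous_ofReal.tendsto K).comp h1).sub_const (K : ℂ)
    rw [sub_self] at h2
    refine h2.congr fun x => ?_
    simp [hg]
  rw [map_sub, map_smul, ω.map_one, sub_eq_zero] at hz
  simpa using hz

end Asymptotics

/-! ### The functional `σ_s` and Dixmier traces of operators with harmonic eigenvalues. -/

section DixmierTrace

variable {E : Type*} [NormedAddCommGroup E] [InnerProductSpace ℂ E]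

theorem isCompactOperator_zero_clm : IsCompactOperator (0 : E →L[ℂ] E) := by
  simpa using (isCompactOperator_zero (M₁ := E) (M₂ := E))

theorem sigmaNorm_set_nonneg (T : E →L[ℂ] E) {s : ℝ} (hs : 0 ≤ s) :
    ∀ r ∈ {r : ℝ | ∃ R S : E →L[ℂ] E, IsCompactOperator R ∧ IsCompactOperator S ∧ R + S = T ∧
      Summable (singularValue R) ∧ r = (∑' n, singularValue R n) + s * ‖S‖}, 0 ≤ r := by
  rintro r ⟨R, S, -, -, -, -, rfl⟩
  exact add_nonneg (tsum_nonneg (singularValue_nonneg R)) (mul_nonneg hs (norm_nonneg S))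

theorem singularValue_zero {e : ℕ → E} (he : Orthonormal ℂ e) (n : ℕ) :
    singularValue (0 : E →L[ℂ] E) n = 0 := by
  refine singularValue_of_isTransfer he (c := fun _ => 0) (fun _ _ _ => le_rfl) (fun _ => le_rfl)
    (fun x => ?_) n
  simp

theorem sigmaNorm_le {T R S : E →L[ℂ] E} (hR : IsCompactOperator R) (hS : IsCompactOperator S)
    (h : R + S = T) (hsum : Summable (singularValue R)) {s : ℝ} (hs : 0 ≤ s) :
    sigmaNorm T s ≤ (∑' n, singularValue R n) + s * ‖S‖ :=
  csInf_le ⟨0, fun r hr => sigmaNorm_set_nonneg T hs r hr⟩ ⟨R, S, hR, hS, h, hsum, rfl⟩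

theorem le_sigmaNorm {e : ℕ → E} (he : Orthonormal ℂ e) {T : E →L[ℂ] E} (hT : IsCompactOperator T)
    {s b : ℝ} (h : ∀ R S : E →L[ℂ] E, IsCompactOperator R → IsCompactOperator S → R + S = T →
      Summable (singularValue R) → b ≤ (∑' n, singularValue R n) + s * ‖S‖) :
    b ≤ sigmaNorm T s := by
  refine le_csInf ⟨_, 0, T, isCompactOperator_zero_clm, hT, zero_add T, ?_, rfl⟩ ?_
  · exact (summable_zero : Summable fun _ : ℕ => (0 : ℝ)).congr fun n =>
      (singularValue_zero he n).symm
  · rintro r ⟨R, S, hR, hS, hRS, hsum, rfl⟩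
    exact h R S hR hS hRS hsum

theorem sigmaNorm_monotoneOn {e : ℕ → E} (he : Orthonormal ℂ e) {T : E →L[ℂ] E}
    (hT : IsCompactOperator T) : MonotoneOn (sigmaNorm T) (Set.Ici 1) := by
  intro s hs s' _ hss
  refine le_sigmaNorm he hT fun R S hR hS h hsum => ?_
  refine (sigmaNorm_le hR hS h hsum (zero_le_one.trans hs)).trans ?_
  gcongr

/-- For any decomposition `T = R + S`, summing `μ_n(R + S) ≤ μ_n(R) + ‖S‖` over `n < N` costs `N ‖S‖
≤ s ‖S‖`. -/
theorem sum_le_sigmaNorm {e : ℕ → E} (he : Orthonormal ℂ e) {T : E →L[ℂ] E}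
    (hT : IsCompactOperator T) {s : ℝ} {N : ℕ} (hN : (N : ℝ) ≤ s) :
    ∑ n ∈ Finset.range N, singularValue T n ≤ sigmaNorm T s := by
  refine le_sigmaNorm he hT fun R S _ _ h hsum => ?_
  subst h
  calc ∑ n ∈ Finset.range N, singularValue (R + S) n
      ≤ ∑ n ∈ Finset.range N, (singularValue R n + ‖S‖) :=
        Finset.sum_le_sum fun n _ => singularValue_add_le he R S n
    _ = ∑ n ∈ Finset.range N, singularValue R n + N * ‖S‖ := by
        simp [Finset.sum_add_distrib]
    _ ≤ _ := by
        gcongr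
        exact hsum.sum_le_tsum _ fun n _ => singularValue_nonneg R n

theorem singularValue_smul (z : ℂ) (T : E →L[ℂ] E) (hz : ‖z‖ = 1) (n : ℕ) :
    singularValue (z • T) n = singularValue T n := by
  have h : ∀ V : Submodule ℂ E, ‖(z • T) ∘L V.subtypeL‖ = ‖T ∘L V.subtypeL‖ := fun V => by
    refine ContinuousLinearMap.opNorm_ext _ _ fun x => ?_
    simp [norm_smul, hz]
  simp only [singularValue, h]

theorem dixmierTracePos_of_sigmaNorm {e : ℕ → E} (he : Orthonormal ℂ e) {T : E →L[ℂ] E}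
    (hT : IsCompactOperator T) {K C : ℝ} (hC : ∀ s, 1 ≤ s → |sigmaNorm T s - K * Real.log s| ≤ C)
    {t₀ : ℝ} (ht₀ : Real.exp 1 < t₀) (ω : DixmierState t₀) : dixmierTracePos ω T = K :=
  state_of_tendsto ω (continuousOn_cesaro (sigmaNorm_monotoneOn he hT) ht₀)
    (tendsto_cesaro (sigmaNorm_monotoneOn he hT) ht₀ hC)

variable [CompleteSpace E]

/-- The competitor is `R`, the first `N` diagonal terms, and `S`, the tail, of norm at most `c N`.
-/
theorem sigmaNorm_le_sum {e : ℕ → E} (he : Orthonormal ℂ e) {c : ℕ → ℝ} (hc : Antitone c)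
    (h0 : ∀ n, 0 ≤ c n) (hlim : Tendsto c atTop (𝓝 0)) {T : E →L[ℂ] E}
    (hT : IsTransfer e e (fun n => (c n : ℂ)) T) {s : ℝ} (hs : 0 ≤ s) (N : ℕ) :
    sigmaNorm T s ≤ ∑ n ∈ Finset.range N, c n + s * c N := by
  obtain ⟨hTc, hR⟩ := isCompactOperator_of_isTransfer he hc h0 hlim hT
  obtain ⟨R, hR, hRc, hRn⟩ := hR N
  have hsv : ∀ n, singularValue R n = if n < N then c n else 0 := by
    refine singularValue_of_isTransfer he (fun m n hmn => ?_) (fun n => ?_) hR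
    · split_ifs with h1 h2
      · exact hc hmn
      · omega
      · exact h0 _
      · rfl
    · split_ifs
      exacts [h0 n, le_rfl]
  have hs1 : HasSum (singularValue R) (∑ n ∈ Finset.range N, c n) := by
    have : HasSum (singularValue R) (∑ n ∈ Finset.range N, singularValue R n) :=
      hasSum_sum_of_ne_finset_zero fun n hn => by
        rw [hsv, if_neg (by simpa using hn)]
    convert this using 1
    refine Finset.sum_congr rfl fun n hn => ?_
    rw [hsv, if_pos (by simpa using hn)]
  have := sigmaNorm_le hRc (hTc.sub hRc) (add_sub_cancel R T) hs1.summable hs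
  rw [hs1.tsum_eq] at this
  refine this.trans ?_
  gcongr

/-- Eigenvalues `K / (n + a)`: the trace norm of the truncations and `σ_s` grow as `K log`. -/
theorem harmonic_asymptotics {e : ℕ → E} (he : Orthonormal ℂ e) {a K : ℝ} (ha : 0 < a)
    (hK : 0 ≤ K) {T : E →L[ℂ] E}
    (hT : IsTransfer e e (fun n : ℕ => ((K * (1 / (n + a)) : ℝ) : ℂ)) T) :
    IsCompactOperator T ∧ (∀ n, singularValue T n = K * (1 / (n + a))) ∧
    ∃ C, ∀ s, 1 ≤ s → |sigmaNorm T s - K * Real.log s| ≤ C := by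
  have hc : Antitone fun n : ℕ => K * (1 / ((n : ℝ) + a)) := by
    intro m n hmn
    have : (m : ℝ) ≤ n := by exact_mod_cast hmn
    simp only
    gcongr
  have h0 : ∀ n : ℕ, 0 ≤ K * (1 / ((n : ℝ) + a)) := fun n => by positivity
  have hlim : Tendsto (fun n : ℕ => K * (1 / ((n : ℝ) + a))) atTop (𝓝 0) := by
    have h1 : Tendsto (fun n : ℕ => (n : ℝ) + a) atTop atTop :=
      tendsto_atTop_add_const_right _ _ tendsto_natCast_atTop_atTop
    simpa using (tendsto_inv_atTop_zero.comp h1).const_mul K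
  have hcomp := (isCompactOperator_of_isTransfer he hc h0 hlim hT).1
  have hsv := singularValue_of_isTransfer he hc h0 hT
  set B := |Real.log a| + 1 / a + Real.log (1 + a)
  refine ⟨hcomp, hsv, K * B + K * 2 + K * Real.log 2, fun s hs => ?_⟩
  -- With this `N` the lower bound applies since `N ≤ s`, and `s < N + 1 ≤ 2 N` makes the tail term
  -- `s μ_N` at most `2 K`. The two bounds then differ from `K log s` by a constant.
  set N := ⌊s⌋₊
  have hN1 : 1 ≤ N := Nat.one_le_floor_iff s |>.2 hs
  have hN1' : (1 : ℝ) ≤ N := by exact_mod_cast hN1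
  have hNs : (N : ℝ) ≤ s := Nat.floor_le (by linarith)
  have hsN : s < N + 1 := Nat.lt_floor_add_one s
  have hlow := sum_le_sigmaNorm he hcomp hNs
  have hup := sigmaNorm_le_sum he hc h0 hlim hT (by linarith : 0 ≤ s) N
  have hB := abs_sum_inv_sub_log_le ha N hN1
  simp only [hsv] at hlow
  rw [← Finset.mul_sum] at hlow hup
  rw [abs_le] at hB
  have hl1 : Real.log N ≤ Real.log s := Real.log_le_log (by linarith) hNs
  have hl2 : Real.log s ≤ Real.log N + Real.log 2 := by
    rw [← Real.log_mul (by linarith) two_ne_zero]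
    exact Real.log_le_log (by linarith) (by linarith)
  have hsc : s * (K * (1 / (N + a))) ≤ K * 2 := by
    rw [show s * (K * (1 / (N + a))) = K * (s / (N + a)) by ring]
    gcongr
    rw [div_le_iff₀ (by positivity)]
    linarith
  have m1 := mul_le_mul_of_nonneg_left hB.1 hK
  have m2 := mul_le_mul_of_nonneg_left hB.2 hK
  have m3 := mul_le_mul_of_nonneg_left hl1 hK
  have m4 := mul_le_mul_of_nonneg_left hl2 hK
  have m5 : 0 ≤ K * Real.log 2 := mul_nonneg hK (Real.log_nonneg one_le_two)
  rw [abs_le]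
  constructor <;> linarith

theorem dixmierTracePos_zero {e : ℕ → E} (he : Orthonormal ℂ e) {t₀ : ℝ} (ht₀ : Real.exp 1 < t₀)
    (ω : DixmierState t₀) : dixmierTracePos ω (0 : E →L[ℂ] E) = 0 := by
  -- The zero operator is the harmonic case with `K = 0`.
  have hT : IsTransfer e e (fun n : ℕ => ((0 * (1 / (n + 1)) : ℝ) : ℂ)) (0 : E →L[ℂ] E) :=
    fun x => by simp
  obtain ⟨h1, -, C, hC⟩ := harmonic_asymptotics he one_pos le_rfl hT
  simpa using dixmierTracePos_of_sigmaNorm he h1 hC ht₀ ω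

/-- `T = -i B` with `B ≥ 0` having the eigenvalues `K / (n + a)`. -/
theorem dixmier_of_harmonic {e : ℕ → E} (he : Orthonormal ℂ e) {a K : ℝ} (ha : 0 < a)
    (hK : 0 ≤ K) {B : E →L[ℂ] E}
    (hB : IsTransfer e e (fun n : ℕ => ((K * (1 / (n + a)) : ℝ) : ℂ)) B) :
    IsDixmierMeasurable ((-I) • B) ∧ ∀ t₀ : ℝ, Real.exp 1 < t₀ → ∀ ω : DixmierState t₀,
      dixmierTrace ω ((-I) • B) = -I * K := by
  obtain ⟨hcomp, hsv, C, hC⟩ := harmonic_asymptotics he ha hK hB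
  have hgamma : Tendsto (gammaSeq ((-I) • B)) atTop (𝓝 K) := by
    have hinv : Tendsto (fun N : ℕ => (Real.log N)⁻¹) atTop (𝓝 0) :=
      (tendsto_inv_atTop_zero.comp Real.tendsto_log_atTop).comp tendsto_natCast_atTop_atTop
    have hb := hinv.const_mul (K * (|Real.log a| + 1 / a + Real.log (1 + a)))
    rw [mul_zero] at hb
    rw [tendsto_iff_norm_sub_tendsto_zero]
    refine squeeze_zero' (Eventually.of_forall fun _ => norm_nonneg _) ?_ hb
    filter_upwards [eventually_ge_atTop 2] with N hN
    have hN' : (1 : ℝ) < N := by exact_mod_cast hN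
    have hl := Real.log_pos hN'
    have h := abs_sum_inv_sub_log_le ha N (by omega)
    have e1 : gammaSeq ((-I) • B) N - K =
        K * (∑ n ∈ Finset.range N, 1 / (n + a) - Real.log N) * (Real.log N)⁻¹ := by
      simp only [gammaSeq, singularValue_smul (-I) B (by simp), hsv, ← Finset.mul_sum]
      field_simp
    rw [e1, norm_mul, norm_mul, Real.norm_of_nonneg hK, Real.norm_of_nonneg (inv_nonneg.2 hl.le),
      Real.norm_eq_abs]
    gcongr
  refine ⟨⟨⟨hcomp.smul (-I), ?_⟩, K, hgamma⟩, fun t₀ ht₀ ω => ?_⟩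
  · obtain ⟨M, hM⟩ := hgamma.bddAbove_range
    refine ⟨M, ?_⟩
    rintro r ⟨N, _, rfl⟩
    exact hM ⟨N, rfl⟩
  · have hpos : 0 ≤ B := by
      rw [ContinuousLinearMap.nonneg_iff_isPositive]
      exact hB.isPositive fun n => by
        rw [Complex.zero_le_real]
        positivity
    have hsa : IsSelfAdjoint B := IsSelfAdjoint.of_nonneg hpos
    -- Of the four positive pieces in `dixmierTrace` only the negative part of the imaginary part
    -- survives, and it equals `B`.
    have hre : (realPart ((-I) • B) : E →L[ℂ] E) = 0 := by
      rw [neg_smul, map_neg, realPart_I_smul, hsa.imaginaryPart]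
      simp
    have him : (imaginaryPart ((-I) • B) : E →L[ℂ] E) = -B := by
      rw [neg_smul, map_neg, imaginaryPart_I_smul, AddSubgroup.coe_neg, hsa.coe_realPart]
    rw [dixmierTrace, hre, him, CFC.posPart_zero, CFC.negPart_zero, CFC.posPart_neg,
      CFC.negPart_neg, (CFC.posPart_eq_self B).2 hpos,
      (CFC.negPart_eq_zero_iff B hsa).2 hpos, dixmierTracePos_zero he ht₀ ω,
      dixmierTracePos_of_sigmaNorm he hcomp hC ht₀ ω]
    ring

end DixmierTrace

/-! ### Gaussians as Schwartz functions, and determinacy by moments. -/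

section Gaussian

variable {V : Type*} [NormedAddCommGroup V] [InnerProductSpace ℝ V]

theorem exists_pow_mul_exp_neg_sq_le {c : ℝ} (hc : 0 < c) (n : ℕ) :
    ∃ C, ∀ r : ℝ, 0 ≤ r → (1 + r) ^ n * Real.exp (-c * r ^ 2) ≤ C := by
  -- From `(1 + r)^n ≤ n! e^{1 + r}` and `r - c r² ≤ 1 / (4 c)`, by completing the square.
  refine ⟨n.factorial * Real.exp (1 + 1 / (4 * c)), fun r hr => ?_⟩
  have h1 : (1 + r) ^ n ≤ n.factorial * Real.exp (1 + r) := by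
    have := Real.pow_div_factorial_le_exp (1 + r) (by linarith) n
    rw [div_le_iff₀ (by positivity)] at this
    linarith
  calc (1 + r) ^ n * Real.exp (-c * r ^ 2)
      ≤ n.factorial * Real.exp (1 + r) * Real.exp (-c * r ^ 2) := by gcongr
    _ = n.factorial * Real.exp (1 + r + -c * r ^ 2) := by rw [mul_assoc, ← Real.exp_add]
    _ ≤ _ := by
        refine mul_le_mul_of_nonneg_left (Real.exp_le_exp.2 ?_) (by positivity)
        have : 1 / (4 * c) - (r + -c * r ^ 2) = (2 * c * r - 1) ^ 2 / (4 * c) := by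
          field_simp
          ring
        have h2 : 0 ≤ (2 * c * r - 1) ^ 2 / (4 * c) := by positivity
        linarith

theorem contDiff_gaussian (c : ℝ) :
    ContDiff ℝ (⊤ : ℕ∞) (fun x : V => Real.exp (-c * ‖x‖ ^ 2)) :=
  Real.contDiff_exp.comp (contDiff_const.mul (contDiff_norm_sq ℝ))

theorem gaussian_decay {c : ℝ} (hc : 0 < c) (k n : ℕ) :
    ∃ C, ∀ x : V, ‖x‖ ^ k * ‖iteratedFDeriv ℝ n (fun x : V => Real.exp (-c * ‖x‖ ^ 2)) x‖ ≤ C := by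
  have htg : Function.HasTemperateGrowth (fun x : V => -c * ‖x‖ ^ 2) := by fun_prop
  obtain ⟨m, C, hC0, hC⟩ := htg.norm_iteratedFDeriv_le_uniform n
  obtain ⟨B, hB⟩ := exists_pow_mul_exp_neg_sq_le hc (k + m * n)
  refine ⟨n.factorial * (max C 1) ^ n * B, fun x => ?_⟩
  have h1 : (1 : ℝ) ≤ 1 + ‖x‖ := by linarith [norm_nonneg x]
  have h := norm_iteratedFDeriv_comp_le (𝕜 := ℝ) (g := Real.exp) (f := fun x : V => -c * ‖x‖ ^ 2)
    (n := n) (N := (⊤ : ℕ∞)) Real.contDiff_exp htg.1 (by exact_mod_cast le_top) x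
    (C := Real.exp (-c * ‖x‖ ^ 2)) (D := max C 1 * (1 + ‖x‖) ^ m) (fun i _ => by
      rw [norm_iteratedFDeriv_eq_norm_iteratedDeriv, iteratedDeriv_eq_iterate, Real.iter_deriv_exp,
        Real.norm_of_nonneg (Real.exp_pos _).le]) (fun i hi hin => by
      refine (hC i hin x).trans ?_
      -- The composition estimate wants the `i`-th derivative bounded by `D ^ i`. Taking `D ≥ 1`,
      -- hence the maximum with `1`, makes the uniform bound `D` sufficient for all `i ≥ 1`.
      have h2 : 1 ≤ max C 1 * (1 + ‖x‖) ^ m :=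
        one_le_mul_of_one_le_of_one_le (le_max_right _ _) (one_le_pow₀ h1)
      refine le_trans ?_ (le_self_pow₀ h2 (by omega))
      gcongr
      exact le_max_left _ _)
  calc ‖x‖ ^ k * ‖iteratedFDeriv ℝ n (fun x : V => Real.exp (-c * ‖x‖ ^ 2)) x‖
      ≤ (1 + ‖x‖) ^ k * (n.factorial * Real.exp (-c * ‖x‖ ^ 2) *
          (max C 1 * (1 + ‖x‖) ^ m) ^ n) := by
        gcongr
        · linarith
        · exact h
    _ = n.factorial * (max C 1) ^ n * ((1 + ‖x‖) ^ (k + m * n) * Real.exp (-c * ‖x‖ ^ 2)) := by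
        rw [mul_pow, ← pow_mul, pow_add]
        ring
    _ ≤ _ := by
        gcongr
        exact hB _ (norm_nonneg x)

/-- The Gaussian `exp (-c ‖x‖²)`, `c > 0` (zero for `c ≤ 0`). -/
def gaussian (V : Type*) [NormedAddCommGroup V] [InnerProductSpace ℝ V] (c : ℝ) : 𝓢(V, ℂ) :=
  if hc : 0 < c then
    SchwartzMap.postcompCLM (𝕜 := ℝ) Complex.ofRealCLM
      { toFun := fun x : V => Real.exp (-c * ‖x‖ ^ 2)
        smooth' := contDiff_gaussian c
        decay' := gaussian_decay hc }
  else 0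

theorem gaussian_apply {c : ℝ} (hc : 0 < c) (x : V) :
    gaussian V c x = (Real.exp (-c * ‖x‖ ^ 2) : ℝ) := by
  rw [gaussian, dif_pos hc, SchwartzMap.postcompCLM_apply]
  rfl

variable [FiniteDimensional ℝ V] [MeasurableSpace V] [BorelSpace V]

open scoped FourierTransform in
/-- A function with exponential moments is determined by its polynomial moments. -/
theorem ae_eq_zero_of_moments {g : V → ℂ}
    (hg : ∀ t : ℝ, Integrable (fun x => (Real.exp (t * ‖x‖) : ℂ) * g x))
    (h : ∀ (w : V) (n : ℕ), ∫ x, ((inner ℝ w x : ℝ) : ℂ) ^ n * g x = 0) : g =ᵐ[volume] 0 := by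
  have hgi : Integrable g := by simpa using hg 0
  have hF : ∀ w : V, 𝓕 g w = 0 := by
    intro w
    rw [Real.fourier_eq']
    -- The exponential in the Fourier integral is expanded in its power series. Each term is a
    -- multiple of a vanishing moment, and the sum is dominated by `e^{2π ‖w‖ ‖v‖} ‖g v‖`.
    have hs := hasSum_integral_of_dominated_convergence (μ := (volume : Measure V))
      (F := fun (n : ℕ) v => ((-2 * Real.pi * I : ℂ) ^ n / n.factorial) *
        (((inner ℝ w v : ℝ) : ℂ) ^ n * g v))
      (f := fun v => Complex.exp ((-2 * Real.pi * inner ℝ v w : ℝ) * I) • g v)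
      (fun n v => (2 * Real.pi * (‖w‖ * ‖v‖)) ^ n / n.factorial * ‖g v‖) ?_ ?_ ?_ ?_ ?_
    · have h0 : ∀ n : ℕ, ∫ v, ((-2 * Real.pi * I : ℂ) ^ n / n.factorial) *
          (((inner ℝ w v : ℝ) : ℂ) ^ n * g v) = 0 := fun n => by
        rw [integral_const_mul, h, mul_zero]
      simp only [h0] at hs
      exact (hs.unique hasSum_zero)
    · intro n
      refine AEStronglyMeasurable.const_mul (AEStronglyMeasurable.mul ?_ hgi.1) _
      exact Continuous.aestronglyMeasurable (by fun_prop)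
    · intro n
      refine Eventually.of_forall fun v => ?_
      rw [norm_mul, norm_mul, norm_div, norm_pow, norm_pow, ← mul_assoc]
      refine mul_le_mul_of_nonneg_right ?_ (norm_nonneg _)
      have h1 : ‖(-2 * Real.pi * I : ℂ)‖ = 2 * Real.pi := by
        simp [abs_of_pos Real.pi_pos]
      have h2 : ‖((n.factorial : ℕ) : ℂ)‖ = n.factorial := by simp
      have h3 : ‖((inner ℝ w v : ℝ) : ℂ)‖ ≤ ‖w‖ * ‖v‖ := by
        rw [Complex.norm_real]
        exact norm_inner_le_norm w v
      rw [h1, h2]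
      have := Real.pi_pos
      calc (2 * Real.pi) ^ n / n.factorial * ‖((inner ℝ w v : ℝ) : ℂ)‖ ^ n
          ≤ (2 * Real.pi) ^ n / n.factorial * (‖w‖ * ‖v‖) ^ n :=
            mul_le_mul_of_nonneg_left (pow_le_pow_left₀ (norm_nonneg _) h3 n) (by positivity)
        _ = _ := by
            rw [mul_pow (2 * Real.pi)]
            ring
    · refine Eventually.of_forall fun v => ?_
      exact (Real.summable_pow_div_factorial _).mul_right _
    · have := (hg (2 * Real.pi * ‖w‖)).norm
      refine this.congr (Eventually.of_forall fun v => ?_)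
      simp only
      rw [tsum_mul_right, norm_mul, Complex.norm_real, Real.norm_of_nonneg (Real.exp_pos _).le,
        Real.exp_eq_exp_ℝ, NormedSpace.exp_eq_tsum_div, mul_assoc]
    · refine Eventually.of_forall fun v => ?_
      have := (NormedSpace.expSeries_div_hasSum_exp
        (((-2 * Real.pi * inner ℝ v w : ℝ) : ℂ) * I)).mul_right (g v)
      rw [← Complex.exp_eq_exp_ℂ] at this
      simp only [smul_eq_mul]
      refine Eq.mp (congrArg (fun F => HasSum F _) (funext fun n => ?_)) this
      rw [real_inner_comm]
      push_cast
      ring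
  -- The Fourier transform is moved from `s` to `g`. Since every test function is the transform of a
  -- Schwartz function, `g` is orthogonal to all test functions.
  have hpair : ∀ s : 𝓢(V, ℂ), ∫ x, 𝓕 s x * g x = 0 := by
    intro s
    have := VectorFourier.integral_fourierIntegral_smul_eq_flip (μ := (volume : Measure V))
      (ν := (volume : Measure V)) (L := innerₗ V) (e := Real.fourierChar) (f := s) (g := g)
      Real.continuous_fourierChar continuous_inner (s.integrable) hgi
    rw [flip_innerₗ] at this
    have h2 : ∀ x, VectorFourier.fourierIntegral Real.fourierChar volume (innerₗ V) g x = 0 := hF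
    simp only [h2, smul_zero, integral_zero] at this
    exact this
  refine ae_eq_zero_of_integral_contDiff_smul_eq_zero hgi.locallyIntegrable fun φ hφ hφc => ?_
  have hφ2 : ContDiff ℝ (⊤ : ℕ∞) (fun x => (φ x : ℂ)) := Complex.ofRealCLM.contDiff.comp hφ
  have hφc2 : HasCompactSupport (fun x => (φ x : ℂ)) := hφc.comp_left (g := fun r : ℝ => (r : ℂ)) rfl
  have := hpair (𝓕⁻ (hφc2.toSchwartzMap hφ2))
  rw [FourierInvPair.fourier_fourierInv_eq] at this
  simpa using this

/-- `S` is a space of Schwartz functions which contains a Gaussian and is stable under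
multiplication by linear functions: nothing is orthogonal to it. -/
theorem ae_eq_zero_of_gaussian_moments {c : ℝ} (hc : 0 < c) {h : V → ℂ}
    (hint : ∀ f : 𝓢(V, ℂ), Integrable (fun x => starRingEnd ℂ (f x) * h x))
    (S : Submodule ℂ 𝓢(V, ℂ)) (hS : gaussian V c ∈ S)
    (hmul : ∀ w, ∀ f ∈ S, SchwartzMap.smulLeftCLM ℂ (fun x : V => ((inner ℝ w x : ℝ) : ℂ)) f ∈ S)
    (horth : ∀ f ∈ S, ∫ x, starRingEnd ℂ (f x) * h x = 0) : h =ᵐ[volume] 0 := by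
  have key : (fun x => starRingEnd ℂ (gaussian V c x) * h x) =ᵐ[volume] 0 := by
    refine ae_eq_zero_of_moments (fun t => ?_) (fun w n => ?_)
    -- Half of the Gaussian absorbs the exponential weight; the other half is itself a Schwartz
    -- function, to which `hint` applies.
    · obtain ⟨B, hB⟩ : ∃ B, ∀ x : V, Real.exp (t * ‖x‖) * Real.exp (-c * ‖x‖ ^ 2) ≤
          B * Real.exp (-(c / 2) * ‖x‖ ^ 2) := by
        refine ⟨Real.exp (t ^ 2 / (2 * c)), fun x => ?_⟩
        rw [← Real.exp_add, ← Real.exp_add, Real.exp_le_exp]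
        have : t ^ 2 / (2 * c) + -(c / 2) * ‖x‖ ^ 2 - (t * ‖x‖ + -c * ‖x‖ ^ 2) =
            (c * ‖x‖ - t) ^ 2 / (2 * c) := by
          field_simp
          ring
        have h2 : 0 ≤ (c * ‖x‖ - t) ^ 2 / (2 * c) := by positivity
        linarith
      refine ((hint (gaussian V (c / 2))).const_mul (B : ℂ)).mono ?_ ?_
      · exact ((by fun_prop : Continuous fun x : V => (Real.exp (t * ‖x‖) : ℂ))
          |>.aestronglyMeasurable).mul (hint (gaussian V c)).1
      · refine Eventually.of_forall fun x => ?_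
        rw [gaussian_apply hc, gaussian_apply (half_pos hc)]
        simp only [norm_mul, Complex.norm_real, RCLike.norm_conj, ← mul_assoc]
        refine mul_le_mul_of_nonneg_right ?_ (norm_nonneg _)
        rw [Real.norm_of_nonneg (Real.exp_pos _).le, Real.norm_of_nonneg (Real.exp_pos _).le,
          Real.norm_of_nonneg (Real.exp_pos _).le]
        exact (hB x).trans (mul_le_mul_of_nonneg_right (le_abs_self B) (Real.exp_pos _).le)
    · have htg : Function.HasTemperateGrowth (fun x : V => ((inner ℝ w x : ℝ) : ℂ)) := by fun_prop
      have hn : ∀ n : ℕ, ∃ f ∈ S, ∀ x, f x = ((inner ℝ w x : ℝ) : ℂ) ^ n * gaussian V c x := by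
        intro n
        induction n with
        | zero => exact ⟨_, hS, fun x => by simp⟩
        | succ n ih =>
          obtain ⟨f, hf, hfx⟩ := ih
          refine ⟨_, hmul w f hf, fun x => ?_⟩
          rw [SchwartzMap.smulLeftCLM_apply_apply htg, hfx, smul_eq_mul]
          ring
      obtain ⟨f, hf, hfx⟩ := hn n
      rw [← horth f hf]
      refine integral_congr_ae (Eventually.of_forall fun x => ?_)
      simp only [hfx, map_mul, map_pow, Complex.conj_ofReal]
      ring
  filter_upwards [key] with x hx
  rw [gaussian_apply hc] at hx
  simpa [Complex.exp_ne_zero] using hx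

end Gaussian

/-! ### Abstract ladder of a creation operator over a vacuum. -/

section Ladder

variable {W : Type*} [AddCommGroup W] [Module ℂ W]

/-- The normalized states `(n!)^{-1/2} c^n f` generated from `f` by a creation operator `c`. -/
def ladder (c : W →ₗ[ℂ] W) (f : W) : ℕ → W
  | 0 => f
  | n + 1 => ((√((n : ℝ) + 1))⁻¹ : ℂ) • c (ladder c f n)

@[simp] theorem ladder_zero (c : W →ₗ[ℂ] W) (f : W) : ladder c f 0 = f := rfl

theorem sqrt_succ_ne_zero (n : ℕ) : (√((n : ℝ) + 1) : ℂ) ≠ 0 := by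
  have : 0 < √((n : ℝ) + 1) := by positivity
  exact_mod_cast this.ne'

theorem sqrt_succ_mul_self (n : ℕ) : (√((n : ℝ) + 1) : ℂ) * √((n : ℝ) + 1) = n + 1 := by
  rw [← Complex.ofReal_mul, Real.mul_self_sqrt (by positivity)]
  push_cast
  rfl

theorem create_ladder (c : W →ₗ[ℂ] W) (f : W) (n : ℕ) :
    c (ladder c f n) = (√((n : ℝ) + 1) : ℂ) • ladder c f (n + 1) := by
  rw [ladder, smul_smul, mul_inv_cancel₀ (sqrt_succ_ne_zero n), one_smul]

variable {a c : W →ₗ[ℂ] W} {f : W}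

theorem number_ladder (hac : ∀ f, a (c f) = c (a f) + f) (hf : a f = 0) (n : ℕ) :
    c (a (ladder c f n)) = (n : ℂ) • ladder c f n := by
  induction n with
  | zero => simp [hf]
  | succ n ih =>
    rw [ladder, map_smul, map_smul, hac, ih, map_add, map_smul]
    push_cast
    module

theorem annihilate_ladder_succ (hac : ∀ f, a (c f) = c (a f) + f) (hf : a f = 0) (n : ℕ) :
    a (ladder c f (n + 1)) = (√((n : ℝ) + 1) : ℂ) • ladder c f n := by
  rw [ladder, map_smul, hac, number_ladder hac hf]
  have h : (√((n : ℝ) + 1) : ℂ)⁻¹ * ((n : ℂ) + 1) = (√((n : ℝ) + 1) : ℂ) := by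
    rw [← sqrt_succ_mul_self, ← mul_assoc, inv_mul_cancel₀ (sqrt_succ_ne_zero n), one_mul]
  calc _ = ((√((n : ℝ) + 1) : ℂ)⁻¹ * ((n : ℂ) + 1)) • ladder c f n := by module
    _ = _ := by rw [h]

/-- At `n = 0` the truncated index `0 - 1` is harmless because its coefficient is `√0`. -/
theorem annihilate_ladder (hac : ∀ f, a (c f) = c (a f) + f) (hf : a f = 0) (n : ℕ) :
    a (ladder c f n) = (√(n : ℝ) : ℂ) • ladder c f (n - 1) := by
  cases n with
  | zero => simp [hf]
  | succ n => simpa using annihilate_ladder_succ hac hf n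

variable {H : Type*} [NormedAddCommGroup H] [InnerProductSpace ℂ H] {ι : W →ₗ[ℂ] H}

/-- Each creation operator is moved to the other side as an annihilation operator. Two different
vacua are allowed so that the `G`-ladder states can serve as vacua of the `K`-ladder, which yields
orthonormality in both indices. -/
theorem inner_ladder (hac : ∀ f, a (c f) = c (a f) + f)
    (hadj : ∀ f g, inner ℂ (ι (c f)) (ι g) = inner ℂ (ι f) (ι (a g))) {g : W} (hf : a f = 0)
    (hg : a g = 0) (n m : ℕ) :
    inner ℂ (ι (ladder c f n)) (ι (ladder c g m)) = if n = m then inner ℂ (ι f) (ι g) else 0 := by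
  induction n generalizing m with
  | zero =>
    cases m with
    | zero => simp
    | succ m =>
      rw [ladder_zero, ladder, map_smul, inner_smul_right, ← inner_conj_symm, hadj, hf]
      simp
  | succ n ih =>
    rw [ladder, map_smul, inner_smul_left, hadj]
    cases m with
    | zero => simp [hg]
    | succ m =>
      rw [annihilate_ladder_succ hac hg, map_smul, inner_smul_right, ih]
      by_cases h : n = m
      · subst h
        have := sqrt_succ_ne_zero n
        simp only [if_true, map_inv₀, Complex.conj_ofReal]
        field_simp
      · rw [if_neg h, if_neg (by omega)]
        simp

end Ladder

/-! ### Commutation relations and symmetry of the momenta; ladder operators. -/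

section Algebra

theorem hasTemperateGrowth_coord (i : Fin 2) :
    Function.HasTemperateGrowth (fun x : Plane => ((x i : ℝ) : ℂ)) :=
  (Complex.ofRealCLM ∘L (EuclideanSpace.proj i : Plane →L[ℝ] ℝ)).hasTemperateGrowth

theorem coordMul_apply (i : Fin 2) (f : 𝓢(Plane, ℂ)) (x : Plane) :
    coordMul i f x = ((x i : ℝ) : ℂ) * f x :=
  SchwartzMap.smulLeftCLM_apply_apply (hasTemperateGrowth_coord i) f x

theorem partialD_apply (i : Fin 2) (f : 𝓢(Plane, ℂ)) (x : Plane) :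
    partialD i f x = fderiv ℝ f x (EuclideanSpace.single i (1 : ℝ)) := rfl

theorem hasFDerivAt_coord (i : Fin 2) (x : Plane) :
    HasFDerivAt (fun x : Plane => ((x i : ℝ) : ℂ))
      (Complex.ofRealCLM ∘L (EuclideanSpace.proj i : Plane →L[ℝ] ℝ)) x :=
  (Complex.ofRealCLM ∘L (EuclideanSpace.proj i : Plane →L[ℝ] ℝ)).hasFDerivAt

theorem partialD_coordMul (i j : Fin 2) (f : 𝓢(Plane, ℂ)) :
    partialD i (coordMul j f) = coordMul j (partialD i f) + if i = j then f else 0 := by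
  ext x
  have h : (coordMul j f : Plane → ℂ) = fun x => ((x j : ℝ) : ℂ) * f x :=
    funext (coordMul_apply j f)
  have hd : HasFDerivAt (fun x : Plane => ((x j : ℝ) : ℂ) * f x) _ x :=
    (hasFDerivAt_coord j x).mul (f.hasFDerivAt x)
  rw [partialD_apply, h, hd.fderiv, add_apply, add_apply, coordMul_apply, partialD_apply]
  by_cases hij : i = j
  · subst hij
    simp
  · simp [hij, Ne.symm hij]

theorem partialD_comm (i j : Fin 2) (f : 𝓢(Plane, ℂ)) :
    partialD i (partialD j f) = partialD j (partialD i f) := by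
  ext x
  have hd : ∀ j, (partialD j f : Plane → ℂ) =
      fun x => fderiv ℝ f x (EuclideanSpace.single j (1 : ℝ)) := fun j =>
    funext (partialD_apply j f)
  have hf : DifferentiableAt ℝ (fderiv ℝ f) x :=
    ((f.smooth 2).fderiv_right (m := 1) (by norm_num)).differentiable (by norm_num) x
  have hs : IsSymmSndFDerivAt ℝ f x :=
    (f.contDiffAt 2).isSymmSndFDerivAt (by simp)
  rw [partialD_apply, partialD_apply, hd, hd, fderiv_clm_apply hf (by fun_prop),
    fderiv_clm_apply hf (by fun_prop)]
  simpa using hs _ _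

theorem coordMul_comm (i j : Fin 2) (f : 𝓢(Plane, ℂ)) :
    coordMul i (coordMul j f) = coordMul j (coordMul i f) := by
  ext x
  simp only [coordMul_apply]
  ring

theorem inner_schwartzIncl (f g : 𝓢(Plane, ℂ)) :
    inner ℂ (schwartzIncl f) (schwartzIncl g) = ∫ x, inner ℂ (f x) (g x) :=
  SchwartzMap.inner_toL2_toL2_eq f g volume

theorem inner_coordMul (i : Fin 2) (f g : 𝓢(Plane, ℂ)) :
    inner ℂ (schwartzIncl (coordMul i f)) (schwartzIncl g) =
      inner ℂ (schwartzIncl f) (schwartzIncl (coordMul i g)) := by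
  rw [inner_schwartzIncl, inner_schwartzIncl]
  refine integral_congr_ae (Eventually.of_forall fun x => ?_)
  simp only [coordMul_apply, RCLike.inner_apply, map_mul, Complex.conj_ofReal]
  ring

theorem inner_partialD (i : Fin 2) (f g : 𝓢(Plane, ℂ)) :
    inner ℂ (schwartzIncl (partialD i f)) (schwartzIncl g) =
      -inner ℂ (schwartzIncl f) (schwartzIncl (partialD i g)) := by
  rw [inner_schwartzIncl, inner_schwartzIncl]
  have h := SchwartzMap.integral_bilinear_lineDerivOp_right_eq_neg_left (μ := volume) f g
    ((ContinuousLinearMap.mul ℝ ℂ) ∘L Complex.conjCLE.toContinuousLinearMap)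
    (EuclideanSpace.single i (1 : ℝ))
  have e : ∀ u v : ℂ, ((ContinuousLinearMap.mul ℝ ℂ) ∘L Complex.conjCLE.toContinuousLinearMap) u v
      = inner ℂ u v := fun u v => by simp [RCLike.inner_apply, mul_comm]
  simp only [e] at h
  rw [← neg_eq_iff_eq_neg] at h
  exact h.symm

variable {ℓ : ℝ}

theorem K₁_apply (ℓ : ℝ) (f : 𝓢(Plane, ℂ)) : K₁ ℓ f =
    (-I * (ℓ : ℂ)) • partialD 0 f - (1 / (2 * (ℓ : ℂ))) • coordMul 1 f := rfl

theorem K₂_apply (ℓ : ℝ) (f : 𝓢(Plane, ℂ)) : K₂ ℓ f =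
    (-I * (ℓ : ℂ)) • partialD 1 f + (1 / (2 * (ℓ : ℂ))) • coordMul 0 f := rfl

theorem G₁_apply (ℓ : ℝ) (f : 𝓢(Plane, ℂ)) : G₁ ℓ f =
    (-I * (ℓ : ℂ)) • partialD 1 f - (1 / (2 * (ℓ : ℂ))) • coordMul 0 f := rfl

theorem G₂_apply (ℓ : ℝ) (f : 𝓢(Plane, ℂ)) : G₂ ℓ f =
    (-I * (ℓ : ℂ)) • partialD 0 f + (1 / (2 * (ℓ : ℂ))) • coordMul 1 f := rfl

theorem K₁_K₂ (hℓ : 0 < ℓ) (f : 𝓢(Plane, ℂ)) : K₁ ℓ (K₂ ℓ f) = K₂ ℓ (K₁ ℓ f) - I • f := by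
  have hl : (ℓ : ℂ) ≠ 0 := by exact_mod_cast hℓ.ne'
  simp only [K₁_apply, K₂_apply, map_add, map_sub, map_smul, partialD_coordMul,
    partialD_comm 1 0, coordMul_comm 1 0]
  simp only [reduceIte]
  match_scalars <;> field_simp <;> ring

theorem G₁_G₂ (hℓ : 0 < ℓ) (f : 𝓢(Plane, ℂ)) : G₁ ℓ (G₂ ℓ f) = G₂ ℓ (G₁ ℓ f) - I • f := by
  have hl : (ℓ : ℂ) ≠ 0 := by exact_mod_cast hℓ.ne'
  simp only [G₁_apply, G₂_apply, map_add, map_sub, map_smul, partialD_coordMul,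
    partialD_comm 1 0, coordMul_comm 1 0]
  simp only [reduceIte]
  match_scalars <;> field_simp <;> ring

theorem K_G_comm (hℓ : 0 < ℓ) (f : 𝓢(Plane, ℂ)) : K₁ ℓ (G₁ ℓ f) = G₁ ℓ (K₁ ℓ f) ∧
    K₁ ℓ (G₂ ℓ f) = G₂ ℓ (K₁ ℓ f) ∧ K₂ ℓ (G₁ ℓ f) = G₁ ℓ (K₂ ℓ f) ∧
    K₂ ℓ (G₂ ℓ f) = G₂ ℓ (K₂ ℓ f) := by
  have hl : (ℓ : ℂ) ≠ 0 := by exact_mod_cast hℓ.ne'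
  refine ⟨?_, ?_, ?_, ?_⟩ <;>
  · simp only [G₁_apply, G₂_apply, K₁_apply, K₂_apply, map_add, map_sub, map_smul,
      partialD_coordMul, partialD_comm 1 0, coordMul_comm 1 0]
    simp only [reduceIte, Fin.isValue, zero_ne_one, one_ne_zero, add_zero]
    match_scalars <;> field_simp <;> ring

/-- The four momenta differ only in indices and in a real coefficient, so one computation covers
their symmetry. -/
theorem inner_kinetic {A : 𝓢(Plane, ℂ) →L[ℂ] 𝓢(Plane, ℂ)} {i j : Fin 2} {r : ℝ}
    (hA : ∀ f, A f = (-I * (ℓ : ℂ)) • partialD i f + (r : ℂ) • coordMul j f)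
    (f g : 𝓢(Plane, ℂ)) : inner ℂ (schwartzIncl (A f)) (schwartzIncl g) =
      inner ℂ (schwartzIncl f) (schwartzIncl (A g)) := by
  simp only [hA, map_add, map_smul, inner_add_left, inner_add_right, inner_smul_left,
    inner_smul_right, inner_partialD, inner_coordMul, map_mul, map_neg, Complex.conj_I,
    Complex.conj_ofReal]
  ring

theorem inner_K₁ (f g : 𝓢(Plane, ℂ)) : inner ℂ (schwartzIncl (K₁ ℓ f)) (schwartzIncl g) =
    inner ℂ (schwartzIncl f) (schwartzIncl (K₁ ℓ g)) :=
  inner_kinetic (ℓ := ℓ) (i := 0) (j := 1) (r := -(1 / (2 * ℓ))) (fun f => by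
    rw [K₁_apply, sub_eq_add_neg, ← neg_smul]; simp)
    f g

theorem inner_K₂ (f g : 𝓢(Plane, ℂ)) : inner ℂ (schwartzIncl (K₂ ℓ f)) (schwartzIncl g) =
    inner ℂ (schwartzIncl f) (schwartzIncl (K₂ ℓ g)) :=
  inner_kinetic (ℓ := ℓ) (i := 1) (j := 0) (r := 1 / (2 * ℓ)) (fun f => by
    rw [K₂_apply]; simp) f g

theorem inner_G₁ (f g : 𝓢(Plane, ℂ)) : inner ℂ (schwartzIncl (G₁ ℓ f)) (schwartzIncl g) =
    inner ℂ (schwartzIncl f) (schwartzIncl (G₁ ℓ g)) :=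
  inner_kinetic (ℓ := ℓ) (i := 1) (j := 0) (r := -(1 / (2 * ℓ))) (fun f => by
    rw [G₁_apply, sub_eq_add_neg, ← neg_smul]; simp)
    f g

theorem inner_G₂ (f g : 𝓢(Plane, ℂ)) : inner ℂ (schwartzIncl (G₂ ℓ f)) (schwartzIncl g) =
    inner ℂ (schwartzIncl f) (schwartzIncl (G₂ ℓ g)) :=
  inner_kinetic (ℓ := ℓ) (i := 0) (j := 1) (r := 1 / (2 * ℓ)) (fun f => by
    rw [G₂_apply]; simp) f g

/-- `(P - i R) / √2`. -/
def lowering (P R : 𝓢(Plane, ℂ) →L[ℂ] 𝓢(Plane, ℂ)) : 𝓢(Plane, ℂ) →ₗ[ℂ] 𝓢(Plane, ℂ) :=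
  ((√2 : ℝ) : ℂ)⁻¹ • (P.toLinearMap - I • R.toLinearMap)

/-- `(P + i R) / √2`. -/
def raising (P R : 𝓢(Plane, ℂ) →L[ℂ] 𝓢(Plane, ℂ)) : 𝓢(Plane, ℂ) →ₗ[ℂ] 𝓢(Plane, ℂ) :=
  ((√2 : ℝ) : ℂ)⁻¹ • (P.toLinearMap + I • R.toLinearMap)

variable {P R P' R' : 𝓢(Plane, ℂ) →L[ℂ] 𝓢(Plane, ℂ)}

theorem lowering_apply (f : 𝓢(Plane, ℂ)) :
    lowering P R f = ((√2 : ℝ) : ℂ)⁻¹ • (P f - I • R f) := rfl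

theorem raising_apply (f : 𝓢(Plane, ℂ)) :
    raising P R f = ((√2 : ℝ) : ℂ)⁻¹ • (P f + I • R f) := rfl

theorem inv_sqrt_two_mul_self : ((√2 : ℝ) : ℂ)⁻¹ * ((√2 : ℝ) : ℂ)⁻¹ = 1 / 2 := by
  rw [← mul_inv, ← Complex.ofReal_mul, Real.mul_self_sqrt zero_le_two]
  norm_num

/-- The cross terms form `-i [P, R] = -1`, the zero-point energy. This ties the number operator to
`P² + R²`, hence to `H_B` and `Q_B`. -/
theorem raising_lowering (h : ∀ f, P (R f) = R (P f) - I • f) (f : 𝓢(Plane, ℂ)) :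
    raising P R (lowering P R f) = (1 / 2 : ℂ) • (P (P f) + R (R f) - f) := by
  simp only [lowering_apply, raising_apply, map_smul, map_sub, h]
  calc _ = (((√2 : ℝ) : ℂ)⁻¹ * ((√2 : ℝ) : ℂ)⁻¹) • (P (P f) - (I * I) • R (R f) + (I * I) • f) := by
        module
    _ = _ := by
        rw [inv_sqrt_two_mul_self, I_mul_I]
        module

theorem lowering_raising (h : ∀ f, P (R f) = R (P f) - I • f) (f : 𝓢(Plane, ℂ)) :
    lowering P R (raising P R f) = raising P R (lowering P R f) + f := by
  rw [raising_lowering h]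
  simp only [lowering_apply, raising_apply, map_smul, map_add, h]
  calc _ = (((√2 : ℝ) : ℂ)⁻¹ * ((√2 : ℝ) : ℂ)⁻¹) • (P (P f) - (I * I) • R (R f) - (I * I) • f) := by
        module
    _ = _ := by
        rw [inv_sqrt_two_mul_self, I_mul_I]
        module

theorem inner_raising (hP : ∀ f g, inner ℂ (schwartzIncl (P f)) (schwartzIncl g) =
      inner ℂ (schwartzIncl f) (schwartzIncl (P g)))
    (hR : ∀ f g, inner ℂ (schwartzIncl (R f)) (schwartzIncl g) =
      inner ℂ (schwartzIncl f) (schwartzIncl (R g))) (f g : 𝓢(Plane, ℂ)) :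
    inner ℂ (schwartzIncl (raising P R f)) (schwartzIncl g) =
      inner ℂ (schwartzIncl f) (schwartzIncl (lowering P R g)) := by
  simp only [raising_apply, lowering_apply, map_smul, map_add, map_sub, inner_smul_left,
    inner_smul_right, inner_add_left, inner_sub_right, hP, hR, Complex.conj_I, map_inv₀,
    Complex.conj_ofReal]
  ring

theorem lowering_comm (h : ∀ f, P (P' f) = P' (P f) ∧ P (R' f) = R' (P f) ∧ R (P' f) = P' (R f) ∧
      R (R' f) = R' (R f)) (f : 𝓢(Plane, ℂ)) :
    lowering P R (raising P' R' f) = raising P' R' (lowering P R f) := by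
  simp only [lowering_apply, raising_apply, map_smul, map_add, map_sub, (h f).1, (h f).2.1,
    (h f).2.2.1, (h f).2.2.2]
  module

theorem lowering_raising_comm (h : ∀ f, P (P' f) = P' (P f) ∧ P (R' f) = R' (P f) ∧
      R (P' f) = P' (R f) ∧ R (R' f) = R' (R f)) (f : 𝓢(Plane, ℂ)) :
    lowering P' R' (raising P R f) = raising P R (lowering P' R' f) := by
  simp only [lowering_apply, raising_apply, map_smul, map_add, map_sub, (h f).1, (h f).2.1,
    (h f).2.2.1, (h f).2.2.2]
  module

theorem raising_comm (h : ∀ f, P (P' f) = P' (P f) ∧ P (R' f) = R' (P f) ∧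
      R (P' f) = P' (R f) ∧ R (R' f) = R' (R f)) (f : 𝓢(Plane, ℂ)) :
    raising P' R' (raising P R f) = raising P R (raising P' R' f) := by
  simp only [raising_apply, map_smul, map_add, (h f).1, (h f).2.1,
    (h f).2.2.1, (h f).2.2.2]
  module

end Algebra

/-! ### The joint eigenbasis of Schwartz functions. -/

section Basis

variable {ℓ : ℝ}

/-- The lowering operator of the Landau levels. -/
abbrev lowerK (ℓ : ℝ) := lowering (K₁ ℓ) (K₂ ℓ)
/-- The raising operator of the Landau levels. -/
abbrev raiseK (ℓ : ℝ) := raising (K₁ ℓ) (K₂ ℓ)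
/-- The lowering operator inside the Landau levels. -/
abbrev lowerG (ℓ : ℝ) := lowering (G₁ ℓ) (G₂ ℓ)
/-- The raising operator inside the Landau levels. -/
abbrev raiseG (ℓ : ℝ) := raising (G₁ ℓ) (G₂ ℓ)

/-- The normalized ground state. -/
def groundState (ℓ : ℝ) : 𝓢(Plane, ℂ) :=
  ((‖schwartzIncl (gaussian Plane (1 / (4 * ℓ ^ 2)))‖⁻¹ : ℝ) : ℂ) • gaussian Plane (1 / (4 * ℓ ^ 2))

/-- The joint eigenfunctions of the Landau Hamiltonian and of the harmonic oscillator. -/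
def landauFun (ℓ : ℝ) (p : ℕ × ℕ) : 𝓢(Plane, ℂ) :=
  ladder (raiseK ℓ) (ladder (raiseG ℓ) (groundState ℓ) p.2) p.1

theorem gaussian_ne_zero {V : Type*} [NormedAddCommGroup V] [InnerProductSpace ℝ V] {c : ℝ}
    (hc : 0 < c) : gaussian V c ≠ 0 := by
  intro h
  have := gaussian_apply hc (0 : V)
  rw [h] at this
  simp at this

theorem partialD_gaussian {c : ℝ} (hc : 0 < c) (i : Fin 2) :
    partialD i (gaussian Plane c) = (-2 * c : ℂ) • coordMul i (gaussian Plane c) := by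
  ext x
  rw [partialD_apply, smul_apply, coordMul_apply, gaussian_apply hc]
  have h1 : (gaussian Plane c : Plane → ℂ) = fun x => ((Real.exp (-c * ‖x‖ ^ 2) : ℝ) : ℂ) :=
    funext (gaussian_apply hc)
  have h2 : HasFDerivAt (fun x : Plane => Real.exp (-c * ‖x‖ ^ 2))
      (Real.exp (-c * ‖x‖ ^ 2) • (-c) • ((2 : ℕ) • innerSL ℝ x)) x :=
    (((hasStrictFDerivAt_norm_sq x).hasFDerivAt).const_mul (-c)).exp
  have h3 := (Complex.ofRealCLM.hasFDerivAt).comp x h2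
  rw [h1]
  erw [h3.fderiv]
  simp [EuclideanSpace.inner_single_right]
  ring

theorem four_sq_pos (hℓ : 0 < ℓ) : 0 < 1 / (4 * ℓ ^ 2) := by positivity

/-- For the exponent `1 / (4 ℓ²)` the operator `ℓ ∂_i` acts on the Gaussian as `-x_i / (2 ℓ)`, which
exactly cancels the coordinate terms. -/
theorem lowerK_groundState (hℓ : 0 < ℓ) : lowerK ℓ (groundState ℓ) = 0 := by
  have hl : (ℓ : ℂ) ≠ 0 := by exact_mod_cast hℓ.ne'
  simp only [groundState, map_smul, lowering_apply, K₁_apply, K₂_apply,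
    partialD_gaussian (four_sq_pos hℓ)]
  convert smul_zero _
  convert smul_zero _
  push_cast
  match_scalars <;> field_simp <;> ring_nf <;> simp

theorem lowerG_groundState (hℓ : 0 < ℓ) : lowerG ℓ (groundState ℓ) = 0 := by
  have hl : (ℓ : ℂ) ≠ 0 := by exact_mod_cast hℓ.ne'
  simp only [groundState, map_smul, lowering_apply, G₁_apply, G₂_apply,
    partialD_gaussian (four_sq_pos hℓ)]
  convert smul_zero _
  convert smul_zero _
  push_cast
  match_scalars <;> field_simp <;> ring_nf <;> simp

theorem lowerK_raiseG_ladder (hℓ : 0 < ℓ) (m : ℕ) :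
    lowerK ℓ (ladder (raiseG ℓ) (groundState ℓ) m) = 0 := by
  induction m with
  | zero => exact lowerK_groundState hℓ
  | succ m ih => rw [ladder, map_smul, lowering_comm (K_G_comm hℓ), ih, map_zero, smul_zero]

theorem raiseG_ladder_comm (hℓ : 0 < ℓ) (f : 𝓢(Plane, ℂ)) (n : ℕ) :
    raiseG ℓ (ladder (raiseK ℓ) f n) = ladder (raiseK ℓ) (raiseG ℓ f) n := by
  induction n with
  | zero => rfl
  | succ n ih => rw [ladder, map_smul, raising_comm (K_G_comm hℓ), ih, ladder]

theorem lowerG_ladder_comm (hℓ : 0 < ℓ) (f : 𝓢(Plane, ℂ)) (n : ℕ) :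
    lowerG ℓ (ladder (raiseK ℓ) f n) = ladder (raiseK ℓ) (lowerG ℓ f) n := by
  induction n with
  | zero => rfl
  | succ n ih => rw [ladder, map_smul, lowering_raising_comm (K_G_comm hℓ), ih, ladder]

theorem ladder_smul {W : Type*} [AddCommGroup W] [Module ℂ W] (c : W →ₗ[ℂ] W) (r : ℂ) (f : W)
    (n : ℕ) : ladder c (r • f) n = r • ladder c f n := by
  induction n with
  | zero => rfl
  | succ n ih => rw [ladder, ladder, ih, map_smul, smul_comm]

theorem raiseK_landauFun (p : ℕ × ℕ) :
    raiseK ℓ (landauFun ℓ p) = (√((p.1 : ℝ) + 1) : ℂ) • landauFun ℓ (p.1 + 1, p.2) :=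
  create_ladder _ _ _

theorem lowerK_landauFun (hℓ : 0 < ℓ) (p : ℕ × ℕ) :
    lowerK ℓ (landauFun ℓ p) = (√(p.1 : ℝ) : ℂ) • landauFun ℓ (p.1 - 1, p.2) :=
  annihilate_ladder (lowering_raising (K₁_K₂ hℓ)) (lowerK_raiseG_ladder hℓ _) _

theorem raiseG_landauFun (hℓ : 0 < ℓ) (p : ℕ × ℕ) :
    raiseG ℓ (landauFun ℓ p) = (√((p.2 : ℝ) + 1) : ℂ) • landauFun ℓ (p.1, p.2 + 1) := by
  rw [landauFun, raiseG_ladder_comm hℓ, create_ladder, ladder_smul]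
  rfl

theorem lowerG_landauFun (hℓ : 0 < ℓ) (p : ℕ × ℕ) :
    lowerG ℓ (landauFun ℓ p) = (√(p.2 : ℝ) : ℂ) • landauFun ℓ (p.1, p.2 - 1) := by
  rw [landauFun, lowerG_ladder_comm hℓ, annihilate_ladder (lowering_raising (G₁_G₂ hℓ))
    (lowerG_groundState hℓ), ladder_smul]
  rfl

theorem orthonormal_landauFun (hℓ : 0 < ℓ) :
    Orthonormal ℂ (fun p => schwartzIncl (landauFun ℓ p)) := by
  rw [orthonormal_iff_ite]
  rintro ⟨n, m⟩ ⟨n', m'⟩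
  have h0 : inner ℂ (schwartzIncl (groundState ℓ)) (schwartzIncl (groundState ℓ)) = (1 : ℂ) := by
    have hn : ‖schwartzIncl (gaussian Plane (1 / (4 * ℓ ^ 2)))‖ ≠ 0 := by
      rw [norm_ne_zero_iff, Ne, map_eq_zero_iff _ schwartzIncl_injective]
      exact gaussian_ne_zero (four_sq_pos hℓ)
    rw [inner_self_eq_norm_sq_to_K, groundState, map_smul, norm_smul, Complex.norm_real, norm_inv,
      norm_norm, inv_mul_cancel₀ hn]
    simp
  rw [landauFun, landauFun, inner_ladder (lowering_raising (K₁_K₂ hℓ)) (inner_raising inner_K₁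
    inner_K₂) (lowerK_raiseG_ladder hℓ _) (lowerK_raiseG_ladder hℓ _),
    inner_ladder (lowering_raising (G₁_G₂ hℓ)) (inner_raising inner_G₁ inner_G₂)
    (lowerG_groundState hℓ) (lowerG_groundState hℓ), h0]
  simp only [Prod.mk.injEq]
  split_ifs <;> simp_all

/-- This is `x₁ = ℓ (K₂ - G₁)` written with ladder operators. It serves twice: for the stability of
the span under coordinates, hence completeness, and for the commutators with `Π_j`. -/
theorem coordMul_zero_eq (hℓ : 0 < ℓ) (f : 𝓢(Plane, ℂ)) :
    coordMul 0 f = ((ℓ : ℂ) * ((√2 : ℝ) : ℂ)⁻¹) •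
      (I • (lowerK ℓ f - raiseK ℓ f) - (lowerG ℓ f + raiseG ℓ f)) := by
  have hl : (ℓ : ℂ) ≠ 0 := by exact_mod_cast hℓ.ne'
  have h : coordMul 0 f = (ℓ : ℂ) • (K₂ ℓ f - G₁ ℓ f) := by
    rw [K₂_apply, G₁_apply]
    match_scalars <;> field_simp <;> ring
  rw [h]
  simp only [lowering_apply, raising_apply]
  -- The scalars `1` and `-1` are spelled as `2 * (√2)⁻²` and `I * I` so that the final identity is
  -- purely linear.
  calc _ = ((ℓ : ℂ) * (2 * (1 / 2))) • (- (-1 : ℂ) • K₂ ℓ f - G₁ ℓ f) := by module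
    _ = ((ℓ : ℂ) * (2 * (((√2 : ℝ) : ℂ)⁻¹ * ((√2 : ℝ) : ℂ)⁻¹))) •
        (- (I * I) • K₂ ℓ f - G₁ ℓ f) := by rw [inv_sqrt_two_mul_self, I_mul_I]
    _ = _ := by module

theorem coordMul_one_eq (hℓ : 0 < ℓ) (f : 𝓢(Plane, ℂ)) :
    coordMul 1 f = ((ℓ : ℂ) * ((√2 : ℝ) : ℂ)⁻¹) •
      (I • (lowerG ℓ f - raiseG ℓ f) - (lowerK ℓ f + raiseK ℓ f)) := by
  have hl : (ℓ : ℂ) ≠ 0 := by exact_mod_cast hℓ.ne'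
  have h : coordMul 1 f = (ℓ : ℂ) • (G₂ ℓ f - K₁ ℓ f) := by
    rw [G₂_apply, K₁_apply]
    match_scalars <;> field_simp <;> ring
  rw [h]
  simp only [lowering_apply, raising_apply]
  calc _ = ((ℓ : ℂ) * (2 * (1 / 2))) • (- (-1 : ℂ) • G₂ ℓ f - K₁ ℓ f) := by module
    _ = ((ℓ : ℂ) * (2 * (((√2 : ℝ) : ℂ)⁻¹ * ((√2 : ℝ) : ℂ)⁻¹))) •
        (- (I * I) • G₂ ℓ f - K₁ ℓ f) := by rw [inv_sqrt_two_mul_self, I_mul_I]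
    _ = _ := by module

theorem coordMul_mem_span (hℓ : 0 < ℓ) (i : Fin 2) {f : 𝓢(Plane, ℂ)}
    (hf : f ∈ Submodule.span ℂ (Set.range (landauFun ℓ))) :
    coordMul i f ∈ Submodule.span ℂ (Set.range (landauFun ℓ)) := by
  set S := Submodule.span ℂ (Set.range (landauFun ℓ))
  have hb : ∀ p, landauFun ℓ p ∈ S := fun p => Submodule.subset_span ⟨p, rfl⟩
  have hle : S ≤ S.comap (coordMul i).toLinearMap := by
    refine Submodule.span_le.2 ?_
    rintro _ ⟨p, rfl⟩
    change coordMul i (landauFun ℓ p) ∈ S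
    fin_cases i
    · change coordMul 0 (landauFun ℓ p) ∈ S
      rw [coordMul_zero_eq hℓ, raiseK_landauFun, lowerK_landauFun hℓ, raiseG_landauFun hℓ,
        lowerG_landauFun hℓ]
      exact S.smul_mem _ (S.sub_mem (S.smul_mem _ (S.sub_mem (S.smul_mem _ (hb _))
        (S.smul_mem _ (hb _)))) (S.add_mem (S.smul_mem _ (hb _)) (S.smul_mem _ (hb _))))
    · change coordMul 1 (landauFun ℓ p) ∈ S
      rw [coordMul_one_eq hℓ, raiseK_landauFun, lowerK_landauFun hℓ, raiseG_landauFun hℓ,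
        lowerG_landauFun hℓ]
      exact S.smul_mem _ (S.sub_mem (S.smul_mem _ (S.sub_mem (S.smul_mem _ (hb _))
        (S.smul_mem _ (hb _)))) (S.add_mem (S.smul_mem _ (hb _)) (S.smul_mem _ (hb _))))
  exact hle hf

/-- A function orthogonal to all `landauFun` vanishes. -/
theorem ae_eq_zero_of_landauFun (hℓ : 0 < ℓ) {h : Plane → ℂ}
    (hint : ∀ f : 𝓢(Plane, ℂ), Integrable (fun x => starRingEnd ℂ (f x) * h x))
    (horth : ∀ p, ∫ x, starRingEnd ℂ (landauFun ℓ p x) * h x = 0) : h =ᵐ[volume] 0 := by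
  refine ae_eq_zero_of_gaussian_moments (four_sq_pos hℓ) hint
    (Submodule.span ℂ (Set.range (landauFun ℓ))) ?_ (fun w f hf => ?_) (fun f hf => ?_)
  · have h0 : groundState ℓ ∈ Submodule.span ℂ (Set.range (landauFun ℓ)) :=
      Submodule.subset_span ⟨(0, 0), rfl⟩
    have hn : (((‖schwartzIncl (gaussian Plane (1 / (4 * ℓ ^ 2)))‖⁻¹ : ℝ)) : ℂ) ≠ 0 := by
      rw [Complex.ofReal_ne_zero]
      refine inv_ne_zero ?_
      rw [norm_ne_zero_iff, Ne, map_eq_zero_iff _ schwartzIncl_injective]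
      exact gaussian_ne_zero (four_sq_pos hℓ)
    rw [groundState] at h0
    exact (Submodule.smul_mem_iff _ hn).1 h0
  · have e : SchwartzMap.smulLeftCLM ℂ (fun x : Plane => ((inner ℝ w x : ℝ) : ℂ)) f =
        (w 0 : ℂ) • coordMul 0 f + (w 1 : ℂ) • coordMul 1 f := by
      ext x
      rw [SchwartzMap.smulLeftCLM_apply_apply (by fun_prop), add_apply,
        smul_apply, smul_apply, coordMul_apply, coordMul_apply]
      simp [PiLp.inner_apply, Fin.sum_univ_two]
      ring
    rw [e]
    exact Submodule.add_mem _ (Submodule.smul_mem _ _ (coordMul_mem_span hℓ 0 hf))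
      (Submodule.smul_mem _ _ (coordMul_mem_span hℓ 1 hf))
  · induction hf using Submodule.span_induction with
    | mem f hf =>
      obtain ⟨p, rfl⟩ := hf
      exact horth p
    | zero => simp
    | add f g _ _ hf hg =>
      simp only [add_apply, map_add, add_mul]
      rw [integral_add (hint f) (hint g), hf, hg, add_zero]
    | smul r f _ hf =>
      simp only [smul_apply, smul_eq_mul, map_mul, mul_assoc]
      rw [integral_const_mul, hf, mul_zero]

theorem integrable_conj_schwartz_mul (f : 𝓢(Plane, ℂ)) (φ : L2) :
    Integrable (fun x => starRingEnd ℂ (f x) * φ x) := by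
  have := L2.integrable_inner (𝕜 := ℂ) (schwartzIncl f) φ
  refine this.congr ?_
  filter_upwards [f.coeFn_toLp 2 (volume : Measure Plane)] with x hx
  have hx' : (schwartzIncl f : L2) x = f x := hx
  rw [hx', RCLike.inner_apply, mul_comm]

theorem inner_schwartzIncl_left (f : 𝓢(Plane, ℂ)) (φ : L2) :
    inner ℂ (schwartzIncl f) φ = ∫ x, starRingEnd ℂ (f x) * φ x := by
  rw [L2.inner_def]
  refine integral_congr_ae ?_
  filter_upwards [f.coeFn_toLp 2 (volume : Measure Plane)] with x hx
  have hx' : (schwartzIncl f : L2) x = f x := hx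
  simp only [hx', RCLike.inner_apply, mul_comm]

/-- The Hilbert basis of joint eigenfunctions. -/
def landauBasis (hℓ : 0 < ℓ) : HilbertBasis (ℕ × ℕ) ℂ L2 :=
  HilbertBasis.mkOfOrthogonalEqBot (orthonormal_landauFun hℓ) (by
    rw [Submodule.eq_bot_iff]
    intro φ hφ
    refine Lp.ext (((ae_eq_zero_of_landauFun hℓ (fun f => integrable_conj_schwartz_mul f φ)
      fun p => ?_).trans (Lp.coeFn_zero ℂ 2 volume).symm))
    rw [← inner_schwartzIncl_left]
    exact (Submodule.mem_orthogonal _ _).1 hφ _ (Submodule.subset_span ⟨p, rfl⟩))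

theorem landauBasis_apply (hℓ : 0 < ℓ) (p : ℕ × ℕ) :
    landauBasis hℓ p = schwartzIncl (landauFun ℓ p) := by
  rw [landauBasis, HilbertBasis.coe_mkOfOrthogonalEqBot]

end Basis

/-! ### Closures, the Landau projections and the resolvent in the eigenbasis. -/

section Closure

variable {ℓ : ℝ} {A : 𝓢(Plane, ℂ) →L[ℂ] 𝓢(Plane, ℂ)}

theorem mem_graph_schwartzOperator (x : L2 × L2) : x ∈ (schwartzOperator A).graph ↔
    ∃ f, schwartzIncl f = x.1 ∧ schwartzIncl (A f) = x.2 := by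
  have hval : ∀ (f : 𝓢(Plane, ℂ)) (h : schwartzIncl f ∈ (schwartzOperator A).domain),
      schwartzOperator A ⟨schwartzIncl f, h⟩ = schwartzIncl (A f) := by
    intro f h
    change schwartzIncl (A ((LinearEquiv.ofInjective schwartzIncl schwartzIncl_injective).symm
      ⟨schwartzIncl f, h⟩)) = schwartzIncl (A f)
    congr 2
    exact (LinearEquiv.ofInjective schwartzIncl schwartzIncl_injective).symm_apply_apply f
  rw [LinearPMap.mem_graph_iff]
  constructor
  · rintro ⟨⟨_, f, rfl⟩, h1, h2⟩
    exact ⟨f, h1, (hval f _).symm.trans h2⟩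
  · rintro ⟨f, h1, h2⟩
    exact ⟨⟨schwartzIncl f, f, rfl⟩, h1, (hval f _).trans h2⟩

theorem dense_schwartzOperator_domain : Dense ((schwartzOperator A).domain : Set L2) := by
  have h : DenseRange (SchwartzMap.toLpCLM ℝ ℂ 2 (volume : Measure Plane)) :=
    SchwartzMap.denseRange_toLpCLM (by norm_num)
  have e : ((schwartzOperator A).domain : Set L2) =
      Set.range (SchwartzMap.toLpCLM ℝ ℂ 2 (volume : Measure Plane)) := by
    ext x
    exact Iff.rfl
  rw [e]
  exact h

/-- A densely defined symmetric operator is contained in its adjoint, which is closed. -/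
theorem isClosable_schwartzOperator (hA : ∀ f g, inner ℂ (schwartzIncl (A f)) (schwartzIncl g) =
    inner ℂ (schwartzIncl f) (schwartzIncl (A g))) : (schwartzOperator A).IsClosable := by
  have hmem : ∀ x : (schwartzOperator A).domain, ∃ f, schwartzIncl f = x ∧
      schwartzIncl (A f) = schwartzOperator A x := fun x =>
    (mem_graph_schwartzOperator (A := A) ((x : L2), schwartzOperator A x)).1
      (LinearPMap.mem_graph _ x)
  have h : (schwartzOperator A).IsFormalAdjoint (schwartzOperator A) := by
    intro x y
    obtain ⟨f, hf, hf'⟩ := hmem x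
    obtain ⟨g, hg, hg'⟩ := hmem y
    rw [← hf, ← hf', ← hg, ← hg', hA]
  exact (LinearPMap.adjoint_isClosed dense_schwartzOperator_domain).isClosable.leIsClosable
    (h.le_adjoint dense_schwartzOperator_domain)

/-- The closure of a symmetric operator which is diagonal in the basis of Schwartz functions. -/
theorem mem_graph_closure (hℓ : 0 < ℓ)
    (hA : ∀ f g, inner ℂ (schwartzIncl (A f)) (schwartzIncl g) =
      inner ℂ (schwartzIncl f) (schwartzIncl (A g))) {c : ℕ × ℕ → ℝ}
    (hc : ∀ p, A (landauFun ℓ p) = (c p : ℂ) • landauFun ℓ p) (x : L2 × L2) :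
    x ∈ (schwartzOperator A).closure.graph ↔
      ∀ p, inner ℂ (landauBasis hℓ p) x.2 = c p * inner ℂ (landauBasis hℓ p) x.1 := by
  rw [← (isClosable_schwartzOperator hA).graph_closure_eq_closure_graph]
  constructor
  · intro hx p
    have hcl : IsClosed {x : L2 × L2 |
        inner ℂ (landauBasis hℓ p) x.2 = c p * inner ℂ (landauBasis hℓ p) x.1} :=
      isClosed_eq (by fun_prop) (by fun_prop)
    have hsub : ((schwartzOperator A).graph : Set (L2 × L2)) ⊆ {x : L2 × L2 |
        inner ℂ (landauBasis hℓ p) x.2 = c p * inner ℂ (landauBasis hℓ p) x.1} := by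
      intro y hy
      obtain ⟨f, h1, h2⟩ := (mem_graph_schwartzOperator y).1 hy
      rw [Set.mem_ofPred_eq, ← h1, ← h2, landauBasis_apply, ← hA, hc, map_smul, inner_smul_left,
        Complex.conj_ofReal]
    exact closure_minimal hsub hcl hx
  · intro hx
    have h1 := (landauBasis hℓ).hasSum_repr x.1
    have h2 := (landauBasis hℓ).hasSum_repr x.2
    -- By the coefficient relation, the partial sums of the two expansions are pairs `(f, A f)` with
    -- `f` a finite combination of eigenfunctions. So the point is a limit of graph points, and
    -- essential self-adjointness needs no separate argument.
    have h3 : Tendsto (fun s : Finset (ℕ × ℕ) =>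
        (∑ p ∈ s, (landauBasis hℓ).repr x.1 p • landauBasis hℓ p,
          ∑ p ∈ s, (landauBasis hℓ).repr x.2 p • landauBasis hℓ p)) atTop (𝓝 (x.1, x.2)) :=
      Tendsto.prodMk_nhds h1 h2
    refine mem_closure_of_tendsto h3 (Eventually.of_forall fun s => ?_)
    refine (mem_graph_schwartzOperator _).2
      ⟨∑ p ∈ s, (landauBasis hℓ).repr x.1 p • landauFun ℓ p, ?_, ?_⟩
    · simp only [map_sum, map_smul, landauBasis_apply]
    · simp only [map_sum, map_smul, landauBasis_apply, hc]
      refine Finset.sum_congr rfl fun p _ => ?_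
      rw [(landauBasis hℓ).repr_apply_apply, (landauBasis hℓ).repr_apply_apply, hx p, smul_smul,
        mul_comm]

theorem clm_ext_landauBasis (hℓ : 0 < ℓ) {S T : L2 →L[ℂ] L2}
    (h : ∀ p, S (landauBasis hℓ p) = T (landauBasis hℓ p)) : S = T := by
  refine ContinuousLinearMap.ext_on (Submodule.dense_iff_topologicalClosure_eq_top.2
    (landauBasis hℓ).dense_span) ?_
  rintro _ ⟨p, rfl⟩
  exact h p

theorem ext_inner_landauBasis (hℓ : 0 < ℓ) {φ ψ : L2}
    (h : ∀ p, inner ℂ (landauBasis hℓ p) φ = inner ℂ (landauBasis hℓ p) ψ) : φ = ψ := by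
  refine (landauBasis hℓ).repr.injective (lp.ext (funext fun p => ?_))
  rw [(landauBasis hℓ).repr_apply_apply, (landauBasis hℓ).repr_apply_apply, h]

theorem raiseK_lowerK (hℓ : 0 < ℓ) (p : ℕ × ℕ) :
    raiseK ℓ (lowerK ℓ (landauFun ℓ p)) = (p.1 : ℂ) • landauFun ℓ p :=
  number_ladder (lowering_raising (K₁_K₂ hℓ)) (lowerK_raiseG_ladder hℓ _) _

theorem raiseG_lowerG (hℓ : 0 < ℓ) (p : ℕ × ℕ) :
    raiseG ℓ (lowerG ℓ (landauFun ℓ p)) = (p.2 : ℂ) • landauFun ℓ p := by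
  rw [landauFun, lowerG_ladder_comm hℓ, raiseG_ladder_comm hℓ,
    number_ladder (lowering_raising (G₁_G₂ hℓ)) (lowerG_groundState hℓ), ladder_smul]

theorem K_sq_landauFun (hℓ : 0 < ℓ) (p : ℕ × ℕ) :
    K₁ ℓ (K₁ ℓ (landauFun ℓ p)) + K₂ ℓ (K₂ ℓ (landauFun ℓ p)) =
      (2 * p.1 + 1 : ℂ) • landauFun ℓ p := by
  have h := raiseK_lowerK hℓ p
  rw [raising_lowering (K₁_K₂ hℓ)] at h
  have h2 := congrArg (fun f => (2 : ℂ) • f + landauFun ℓ p) h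
  calc _ = (2 : ℂ) • ((1 / 2 : ℂ) • (K₁ ℓ (K₁ ℓ (landauFun ℓ p)) + K₂ ℓ (K₂ ℓ (landauFun ℓ p)) -
        landauFun ℓ p)) + landauFun ℓ p := by module
    _ = _ := by
      rw [h2]
      module

theorem G_sq_landauFun (hℓ : 0 < ℓ) (p : ℕ × ℕ) :
    G₁ ℓ (G₁ ℓ (landauFun ℓ p)) + G₂ ℓ (G₂ ℓ (landauFun ℓ p)) =
      (2 * p.2 + 1 : ℂ) • landauFun ℓ p := by
  have h := raiseG_lowerG hℓ p
  rw [raising_lowering (G₁_G₂ hℓ)] at h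
  have h2 := congrArg (fun f => (2 : ℂ) • f + landauFun ℓ p) h
  calc _ = (2 : ℂ) • ((1 / 2 : ℂ) • (G₁ ℓ (G₁ ℓ (landauFun ℓ p)) + G₂ ℓ (G₂ ℓ (landauFun ℓ p)) -
        landauFun ℓ p)) + landauFun ℓ p := by module
    _ = _ := by
      rw [h2]
      module

theorem mem_graph_landauHamiltonian (ε : ℝ) (hℓ : 0 < ℓ) (x : L2 × L2) :
    x ∈ (landauHamiltonian ε ℓ).graph ↔ ∀ p, inner ℂ (landauBasis hℓ p) x.2 =
      ((landauLevel ε p.1 : ℝ) : ℂ) * inner ℂ (landauBasis hℓ p) x.1 := by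
  refine mem_graph_closure hℓ (c := fun p => landauLevel ε p.1) (fun f g => ?_) (fun p => ?_) x
  · simp only [smul_apply, add_apply, ContinuousLinearMap.comp_apply, map_smul, map_add,
      inner_smul_left, inner_smul_right, inner_add_left, inner_add_right, inner_K₁, inner_K₂,
      Complex.conj_ofReal]
  · simp only [smul_apply, add_apply, ContinuousLinearMap.comp_apply]
    rw [K_sq_landauFun hℓ, smul_smul, landauLevel]
    push_cast
    congr 1
    ring

theorem mem_graph_oscillator (hℓ : 0 < ℓ) (x : L2 × L2) :
    x ∈ (oscillator ℓ).graph ↔ ∀ p, inner ℂ (landauBasis hℓ p) x.2 =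
      ((p.1 + p.2 + 1 : ℝ) : ℂ) * inner ℂ (landauBasis hℓ p) x.1 := by
  refine mem_graph_closure hℓ (c := fun p => p.1 + p.2 + 1) (fun f g => ?_) (fun p => ?_) x
  · have h2 : starRingEnd ℂ (1 / 2) = 1 / 2 := by
      rw [map_div₀, map_one, map_ofNat]
    simp only [smul_apply, add_apply, ContinuousLinearMap.comp_apply, map_smul, map_add,
      inner_smul_left, inner_smul_right, inner_add_left, inner_add_right, inner_K₁, inner_K₂,
      inner_G₁, inner_G₂, h2]
  · simp only [smul_apply, add_apply, ContinuousLinearMap.comp_apply]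
    rw [K_sq_landauFun hℓ, add_assoc, G_sq_landauFun hℓ]
    push_cast
    module

/-- The levels are pairwise distinct because `ε ≠ 0`, so a coefficient off the level `j` must
vanish. -/
theorem mem_eigenspace_iff {ε : ℝ} (hε : 0 < ε) (hℓ : 0 < ℓ) (j : ℕ) (ψ : L2) :
    ψ ∈ eigenspace (landauHamiltonian ε ℓ) (landauLevel ε j : ℂ) ↔
      ∀ p : ℕ × ℕ, p.1 ≠ j → inner ℂ (landauBasis hℓ p) ψ = 0 := by
  change (ψ, (landauLevel ε j : ℂ) • ψ) ∈ (landauHamiltonian ε ℓ).graph ↔ _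
  rw [mem_graph_landauHamiltonian ε hℓ]
  refine forall_congr' fun p => ?_
  simp only [inner_smul_right]
  rw [← sub_eq_zero, ← sub_mul, mul_eq_zero, ← Complex.ofReal_sub, Complex.ofReal_eq_zero,
    sub_eq_zero, landauLevel, landauLevel, mul_right_inj' hε.ne', add_left_inj, Nat.cast_inj,
    eq_comm, or_iff_not_imp_left]

theorem IsTransfer.inner_landauBasis (hℓ : 0 < ℓ) {c : ℕ × ℕ → ℂ} {T : L2 →L[ℂ] L2}
    (hT : IsTransfer (landauBasis hℓ) (landauBasis hℓ) c T) (p : ℕ × ℕ) (x : L2) :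
    inner ℂ (landauBasis hℓ p) (T x) = c p * inner ℂ (landauBasis hℓ p) x := by
  classical
  refine (hT.inner_right x (landauBasis hℓ p)).unique ?_
  convert hasSum_ite_eq p (c p * inner ℂ (landauBasis hℓ p) x) using 2 with k
  rw [orthonormal_iff_ite.1 (landauBasis hℓ).orthonormal]
  by_cases h : k = p
  · simp [h]
  · simp [h, Ne.symm h]

theorem isTransfer_landauProjection {ε : ℝ} (hε : 0 < ε) (hℓ : 0 < ℓ) (j : ℕ) :
    IsTransfer (landauBasis hℓ) (landauBasis hℓ) (fun p => if p.1 = j then 1 else 0)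
      (landauProjection ε ℓ j) := by
  obtain ⟨T, hT⟩ := exists_isTransfer (landauBasis hℓ).orthonormal (landauBasis hℓ).orthonormal
    (c := fun p : ℕ × ℕ => if p.1 = j then 1 else 0) (C := 1) (fun p => by split_ifs <;> simp)
  have h : landauProjection ε ℓ j = T := by
    ext1 x
    refine Submodule.eq_starProjection_of_mem_of_inner_eq_zero
      (K := (eigenspace (landauHamiltonian ε ℓ) (landauLevel ε j : ℂ)).topologicalClosure) ?_ ?_
    · refine Submodule.le_topologicalClosure _ ((mem_eigenspace_iff hε hℓ j _).2 fun p hp => ?_)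
      rw [hT.inner_landauBasis, if_neg hp, zero_mul]
    · have horth : x - T x ∈ (eigenspace (landauHamiltonian ε ℓ) (landauLevel ε j : ℂ))ᗮ := by
        rw [Submodule.mem_orthogonal]
        intro u hu
        refine ((landauBasis hℓ).hasSum_inner_mul_inner u (x - T x)).unique ?_
        convert hasSum_zero with p
        by_cases hp : p.1 = j
        · rw [inner_sub_right, hT.inner_landauBasis, if_pos hp, one_mul, sub_self, mul_zero]
        · rw [← inner_conj_symm, (mem_eigenspace_iff hε hℓ j u).1 hu p hp, map_zero, zero_mul]
      rw [← Submodule.orthogonal_closure] at horth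
      intro w hw
      rw [← inner_conj_symm, (Submodule.mem_orthogonal _ _).1 horth w hw, map_zero]
  rw [h]
  exact hT

theorem landauProjection_basis {ε : ℝ} (hε : 0 < ε) (hℓ : 0 < ℓ) (j : ℕ) (p : ℕ × ℕ) :
    landauProjection ε ℓ j (landauBasis hℓ p) = if p.1 = j then landauBasis hℓ p else 0 := by
  rw [(isTransfer_landauProjection hε hℓ j).apply_self (landauBasis hℓ).orthonormal]
  split_ifs <;> simp

theorem IsBoundedInverse.unique {T : L2 →ₗ.[ℂ] L2} {R R' : L2 →L[ℂ] L2}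
    (h : IsBoundedInverse T R) (h' : IsBoundedInverse T R') : R = R' := by
  ext1 ψ
  obtain ⟨hd, hψ⟩ := h.1 ψ
  have := h'.2 ⟨R ψ, hd⟩
  rw [hψ] at this
  exact this.symm

theorem isTransfer_oscillatorResolvent (hℓ : 0 < ℓ) {ξ : ℝ} (hξ : 0 ≤ ξ) :
    IsTransfer (landauBasis hℓ) (landauBasis hℓ)
      (fun p => ((1 / (p.1 + p.2 + 1 + 2 * ξ) : ℝ) : ℂ)) (oscillatorResolvent ℓ ξ) := by
  obtain ⟨R, hR⟩ := exists_isTransfer (landauBasis hℓ).orthonormal (landauBasis hℓ).orthonormal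
    (c := fun p : ℕ × ℕ => ((1 / (p.1 + p.2 + 1 + 2 * ξ) : ℝ) : ℂ)) (C := 1) (fun p => by
      rw [Complex.norm_real, Real.norm_of_nonneg (by positivity), div_le_one (by positivity)]
      have : (0 : ℝ) ≤ p.1 + p.2 := by positivity
      linarith)
  have hne : ∀ p : ℕ × ℕ, ((p.1 : ℂ) + p.2 + 1 + 2 * ξ) ≠ 0 := fun p => by
    have : (0 : ℝ) < p.1 + p.2 + 1 + 2 * ξ := by positivity
    exact_mod_cast this.ne'
  have hinv : IsBoundedInverse
      ((((2 * ξ : ℝ) : ℂ) • (LinearMap.id : L2 →ₗ[ℂ] L2)) +ᵥ oscillator ℓ) R := by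
    constructor
    · intro ψ
      have hg : (R ψ, ψ - ((2 * ξ : ℝ) : ℂ) • R ψ) ∈ (oscillator ℓ).graph := by
        rw [mem_graph_oscillator hℓ]
        intro p
        simp only [inner_sub_right, inner_smul_right]
        rw [hR.inner_landauBasis]
        have := hne p
        push_cast
        field_simp
        ring
      obtain ⟨y, hy1, hy2⟩ := (LinearPMap.mem_graph_iff _).1 hg
      simp only at hy1 hy2
      refine ⟨by rw [← hy1]; exact y.2, ?_⟩
      rw [LinearPMap.vadd_apply]
      have e : (⟨R ψ, by rw [← hy1]; exact y.2⟩ : (oscillator ℓ).domain) = y :=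
        Subtype.ext hy1.symm
      erw [e, hy2]
      simp [hy1]
    · intro φ
      have hg : ((φ : L2), oscillator ℓ φ) ∈ (oscillator ℓ).graph := LinearPMap.mem_graph _ _
      rw [mem_graph_oscillator hℓ] at hg
      refine ext_inner_landauBasis hℓ fun p => ?_
      rw [hR.inner_landauBasis, LinearPMap.vadd_apply, inner_add_right, hg p]
      simp only [LinearMap.smul_apply, LinearMap.id_apply, inner_smul_right]
      have := hne p
      push_cast
      field_simp
      ring
  have hex : ∃ R, IsBoundedInverse
      ((((2 * ξ : ℝ) : ℂ) • (LinearMap.id : L2 →ₗ[ℂ] L2)) +ᵥ oscillator ℓ) R := ⟨R, hinv⟩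
  have : oscillatorResolvent ℓ ξ = R := by
    rw [oscillatorResolvent, boundedInverse, dif_pos hex]
    exact hex.choose_spec.unique hinv
  rw [this]
  exact hR

end Closure

/-! ### The derivations of `Π_j`, the curvature operator and its Dixmier trace. -/

section Derivation

variable {ℓ : ℝ}

theorem landauProjection_inner {ε : ℝ} (j : ℕ) (x y : L2) :
    inner ℂ x (landauProjection ε ℓ j y) = inner ℂ (landauProjection ε ℓ j x) y :=
  (Submodule.inner_starProjection_left_eq_right _ x y).symm

theorem memLp_coord_schwartz (i : Fin 2) (f : 𝓢(Plane, ℂ)) :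
    schwartzIncl f ∈ positionDomain i := by
  refine ((coordMul i f).memLp 2 volume).ae_eq ?_
  filter_upwards [f.coeFn_toLp 2 (volume : Measure Plane)] with x hx
  have hx' : (schwartzIncl f : L2) x = f x := hx
  rw [coordMul_apply, hx']

theorem IsCommutatorDerivative.unique {i : Fin 2} {A D D' : L2 →L[ℂ] L2}
    (h : IsCommutatorDerivative (position i) A D) (h' : IsCommutatorDerivative (position i) A D') :
    D = D' := by
  have hd : DenseRange (SchwartzMap.toLpCLM ℝ ℂ 2 (volume : Measure Plane)) :=
    SchwartzMap.denseRange_toLpCLM (by norm_num)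
  refine ContinuousLinearMap.coeFn_injective
    (hd.equalizer D.continuous D'.continuous (funext fun f => ?_))
  obtain ⟨_, h1⟩ := h ⟨schwartzIncl f, memLp_coord_schwartz i f⟩
  obtain ⟨_, h2⟩ := h' ⟨schwartzIncl f, memLp_coord_schwartz i f⟩
  exact h1.trans h2.symm

theorem derivation_eq {i : Fin 2} {A D : L2 →L[ℂ] L2}
    (h : IsCommutatorDerivative (position i) A D) : derivation i A = D := by
  have hex : ∃ D, IsCommutatorDerivative (position i) A D := ⟨D, h⟩
  rw [derivation, dif_pos hex]
  exact hex.choose_spec.unique h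

theorem inner_schwartz_position (i : Fin 2) (f : 𝓢(Plane, ℂ)) (ψ : (position i).domain) :
    inner ℂ (schwartzIncl f) (position i ψ) = inner ℂ (schwartzIncl (coordMul i f)) (ψ : L2) := by
  rw [inner_schwartzIncl_left, inner_schwartzIncl_left]
  refine integral_congr_ae ?_
  filter_upwards [positionFun_coe i ψ] with x hx
  have hx' : (position i ψ : L2) x = ((x i : ℝ) : ℂ) * (ψ : L2) x := hx
  rw [hx', coordMul_apply, map_mul, Complex.conj_ofReal]
  ring

/-- It extends a commutator identity from the basis to the whole maximal domain of the position
operator. No approximation in graph norm is used: the operators are moved onto the basis functions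
by symmetry. The function `x_i (T ψ)` is not known to be square integrable beforehand, which is why
`ae_eq_zero_of_landauFun` asks only for integrability against Schwartz functions. -/
theorem isCommutatorDerivative_of_basis (hℓ : 0 < ℓ) {i : Fin 2} {T D : L2 →L[ℂ] L2}
    {c : ℕ × ℕ → ℝ} (hT : ∀ x y, inner ℂ x (T y) = inner ℂ (T x) y)
    (hD : ∀ x y, inner ℂ x (D y) = inner ℂ (D x) y)
    (hTc : ∀ p, T (landauBasis hℓ p) = (c p : ℂ) • landauBasis hℓ p)
    (hTD : ∀ p, T (schwartzIncl (coordMul i (landauFun ℓ p))) -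
      (c p : ℂ) • schwartzIncl (coordMul i (landauFun ℓ p)) = (-I) • D (landauBasis hℓ p)) :
    IsCommutatorDerivative (position i) T D := by
  intro ψ
  -- The value that `X T ψ` must have if `D = -i [X, T]`.
  set η : L2 := T (position i ψ) + I • D ψ with hη
  have hz : (fun x : Plane => ((x i : ℝ) : ℂ) * (T ψ) x - η x) =ᵐ[volume] 0 := by
    have hmul : ∀ (f : 𝓢(Plane, ℂ)) (x : Plane), starRingEnd ℂ (f x) *
        (((x i : ℝ) : ℂ) * (T ψ) x - η x) =
        starRingEnd ℂ (coordMul i f x) * (T ψ) x - starRingEnd ℂ (f x) * η x := by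
      intro f x
      rw [coordMul_apply, map_mul, Complex.conj_ofReal]
      ring
    refine ae_eq_zero_of_landauFun hℓ (fun f => ?_) (fun p => ?_)
    · simp only [hmul]
      exact (integrable_conj_schwartz_mul _ _).sub (integrable_conj_schwartz_mul _ _)
    · simp only [hmul]
      rw [integral_sub (integrable_conj_schwartz_mul _ _) (integrable_conj_schwartz_mul _ _),
        ← inner_schwartzIncl_left, ← inner_schwartzIncl_left, hη, inner_add_right,
        inner_smul_right, hT, ← landauBasis_apply hℓ, hT, hTc, hD, inner_smul_left,
        landauBasis_apply, inner_schwartz_position, ← landauBasis_apply hℓ]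
      have h := congrArg (fun v => inner ℂ v (ψ : L2)) (hTD p)
      simp only [inner_sub_left, inner_smul_left, map_neg, Complex.conj_I, neg_neg] at h
      rw [← sub_sub, h, sub_self]
  have hae : (fun x : Plane => ((x i : ℝ) : ℂ) * (T ψ) x) =ᵐ[volume] η := by
    filter_upwards [hz] with x hx
    exact sub_eq_zero.1 hx
  have hdom : T ψ ∈ (position i).domain := (Lp.memLp η).ae_eq hae.symm
  have hval : position i ⟨T ψ, hdom⟩ = η := Lp.ext ((positionFun_coe i ⟨T ψ, hdom⟩).trans hae)
  refine ⟨hdom, ?_⟩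
  rw [hval, hη, add_sub_cancel_left, smul_smul]
  simp

theorem orthonormal_row (hℓ : 0 < ℓ) (j : ℕ) :
    Orthonormal ℂ (fun m : ℕ => landauBasis hℓ (j, m)) :=
  (landauBasis hℓ).orthonormal.comp _ fun _ _ h => (Prod.mk.inj h).2

theorem exists_levelShift (hℓ : 0 < ℓ) (i j : ℕ) :
    ∃ T, IsTransfer (fun m => landauBasis hℓ (i, m)) (fun m => landauBasis hℓ (j, m))
      (fun _ => 1) T :=
  exists_isTransfer (orthonormal_row hℓ i) (orthonormal_row hℓ j) (C := 1) (fun _ => by simp)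

/-- The partial isometry from the level `i` to the level `j`. -/
def levelShift (hℓ : 0 < ℓ) (i j : ℕ) : L2 →L[ℂ] L2 := (exists_levelShift hℓ i j).choose

theorem isTransfer_levelShift (hℓ : 0 < ℓ) (i j : ℕ) :
    IsTransfer (fun m => landauBasis hℓ (i, m)) (fun m => landauBasis hℓ (j, m))
      (fun _ => 1) (levelShift hℓ i j) :=
  (exists_levelShift hℓ i j).choose_spec

theorem levelShift_basis (hℓ : 0 < ℓ) (i j n m : ℕ) :
    levelShift hℓ i j (landauBasis hℓ (n, m)) = if n = i then landauBasis hℓ (j, m) else 0 := by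
  have h := isTransfer_levelShift hℓ i j
  split_ifs with hn
  · subst hn
    rw [h.apply_self (orthonormal_row hℓ n) m, one_smul]
  · refine h.apply_eq_zero fun m' => ?_
    rw [orthonormal_iff_ite.1 (landauBasis hℓ).orthonormal, if_neg]
    simp [Ne.symm hn]

theorem levelShift_inner (hℓ : 0 < ℓ) (i j : ℕ) (x y : L2) :
    inner ℂ x (levelShift hℓ i j y) = inner ℂ (levelShift hℓ j i x) y := by
  have h1 := (isTransfer_levelShift hℓ i j).inner_right y x
  have h2 := (isTransfer_levelShift hℓ j i).inner_right x y
  have h3 := h2.star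
  simp only [← starRingEnd_apply, map_mul, map_one, inner_conj_symm] at h3
  refine h1.unique ?_
  convert h3 using 2 with m
  ring

/-- `α [a, Π_j] + β [a†, Π_j]`, with the ladder operators of the Landau levels. -/
def levelCommutator (hℓ : 0 < ℓ) (j : ℕ) (α β : ℂ) : L2 →L[ℂ] L2 :=
  α • ((√(j : ℝ) : ℂ) • levelShift hℓ j (j - 1) - (√((j : ℝ) + 1) : ℂ) • levelShift hℓ (j + 1) j) +
    β • ((√((j : ℝ) + 1) : ℂ) • levelShift hℓ j (j + 1) -
      (√(j : ℝ) : ℂ) • levelShift hℓ (j - 1) j)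

theorem levelCommutator_inner (hℓ : 0 < ℓ) (j : ℕ) {α β : ℂ} (h : β = -starRingEnd ℂ α) (x y : L2) :
    inner ℂ x (levelCommutator hℓ j α β y) = inner ℂ (levelCommutator hℓ j α β x) y := by
  subst h
  simp only [levelCommutator, add_apply, smul_apply, sub_apply, inner_add_left, inner_add_right,
    inner_smul_left, inner_smul_right, inner_sub_left, inner_sub_right, levelShift_inner, map_neg,
    Complex.conj_conj, Complex.conj_ofReal]
  ring

theorem levelCommutator_basis (hℓ : 0 < ℓ) (j : ℕ) (α β : ℂ) (n m : ℕ) :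
    levelCommutator hℓ j α β (landauBasis hℓ (n, m)) =
      (α * √(j : ℝ) * if n = j then 1 else 0) • landauBasis hℓ (j - 1, m) +
      (β * √((j : ℝ) + 1) * if n = j then 1 else 0) • landauBasis hℓ (j + 1, m) -
      (α * √((j : ℝ) + 1) * if n = j + 1 then 1 else 0) • landauBasis hℓ (j, m) -
      (β * √(j : ℝ) * if n = j - 1 then 1 else 0) • landauBasis hℓ (j, m) := by
  simp only [levelCommutator, add_apply, smul_apply, sub_apply, levelShift_basis]
  split_ifs <;> module

theorem lowerK_basis (hℓ : 0 < ℓ) (p : ℕ × ℕ) : schwartzIncl (lowerK ℓ (landauFun ℓ p)) =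
    (√(p.1 : ℝ) : ℂ) • landauBasis hℓ (p.1 - 1, p.2) := by
  rw [lowerK_landauFun hℓ, map_smul, landauBasis_apply]

theorem raiseK_basis (hℓ : 0 < ℓ) (p : ℕ × ℕ) : schwartzIncl (raiseK ℓ (landauFun ℓ p)) =
    (√((p.1 : ℝ) + 1) : ℂ) • landauBasis hℓ (p.1 + 1, p.2) := by
  rw [raiseK_landauFun, map_smul, landauBasis_apply]

theorem lowerG_basis (hℓ : 0 < ℓ) (p : ℕ × ℕ) : schwartzIncl (lowerG ℓ (landauFun ℓ p)) =
    (√(p.2 : ℝ) : ℂ) • landauBasis hℓ (p.1, p.2 - 1) := by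
  rw [lowerG_landauFun hℓ, map_smul, landauBasis_apply]

theorem raiseG_basis (hℓ : 0 < ℓ) (p : ℕ × ℕ) : schwartzIncl (raiseG ℓ (landauFun ℓ p)) =
    (√((p.2 : ℝ) + 1) : ℂ) • landauBasis hℓ (p.1, p.2 + 1) := by
  rw [raiseG_landauFun hℓ, map_smul, landauBasis_apply]

variable {ε : ℝ}

/-- The commutator of `Π_j` with the ladder operators, on the basis. -/
theorem levelCommutator_eq (hε : 0 < ε) (hℓ : 0 < ℓ) (j : ℕ) (α β : ℂ) (p : ℕ × ℕ) :
    levelCommutator hℓ j α β (landauBasis hℓ p) =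
      (if p.1 = j then (1 : ℂ) else 0) • (α • schwartzIncl (lowerK ℓ (landauFun ℓ p)) +
        β • schwartzIncl (raiseK ℓ (landauFun ℓ p))) -
      landauProjection ε ℓ j (α • schwartzIncl (lowerK ℓ (landauFun ℓ p)) +
        β • schwartzIncl (raiseK ℓ (landauFun ℓ p))) := by
  obtain ⟨n, m⟩ := p
  rw [levelCommutator_basis, lowerK_basis hℓ, raiseK_basis hℓ]
  simp only [map_add, map_smul, landauProjection_basis hε hℓ]
  -- Only the levels `j - 1`, `j` and `j + 1` give nonzero terms.
  rcases Nat.lt_trichotomy n j with h | h | h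
  · rcases Nat.lt_or_ge (n + 1) j with h2 | h2
    · rw [if_neg (by omega), if_neg (by omega), if_neg (by omega), if_neg (by omega),
        if_neg (by omega)]
      module
    · obtain rfl : j = n + 1 := by omega
      rw [if_neg (by omega), if_neg (by omega), if_pos (by omega), if_neg (by omega),
        if_pos (by omega)]
      push_cast
      module
  · subst h
    rw [if_pos rfl, if_neg (by omega : ¬ n = n + 1), if_neg (by omega : ¬ n + 1 = n)]
    cases n with
    | zero => simp
    | succ n =>
      rw [if_neg (by omega), if_neg (by omega)]
      module
  · rcases Nat.lt_or_ge (j + 1) n with h2 | h2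
    · rw [if_neg (by omega), if_neg (by omega), if_neg (by omega), if_neg (by omega),
        if_neg (by omega)]
      module
    · obtain rfl : n = j + 1 := by omega
      have e : j + 1 - 1 = j := rfl
      rw [if_neg (by omega), if_pos rfl, if_neg (by omega), e, if_pos rfl, if_neg (by omega)]
      push_cast
      module

/-- The `G`-part of a position preserves the levels and commutes with `Π_j`. The coefficients are
`-i` times those of `lowerK` and `raiseK` in `coordMul_zero_eq` and `coordMul_one_eq`. -/
theorem isCommutatorDerivative_landauProjection (hε : 0 < ε) (hℓ : 0 < ℓ) (j : ℕ) :
    IsCommutatorDerivative (position 0) (landauProjection ε ℓ j)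
      (levelCommutator hℓ j ((ℓ : ℂ) * ((√2 : ℝ) : ℂ)⁻¹) (-((ℓ : ℂ) * ((√2 : ℝ) : ℂ)⁻¹))) ∧
    IsCommutatorDerivative (position 1) (landauProjection ε ℓ j)
      (levelCommutator hℓ j (I * ((ℓ : ℂ) * ((√2 : ℝ) : ℂ)⁻¹))
        (I * ((ℓ : ℂ) * ((√2 : ℝ) : ℂ)⁻¹))) := by
  have hP : ∀ p, landauProjection ε ℓ j (landauBasis hℓ p) =
      (((if p.1 = j then 1 else 0 : ℝ)) : ℂ) • landauBasis hℓ p := fun p => by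
    rw [landauProjection_basis hε hℓ]
    split_ifs <;> simp
  have hGP : ∀ p, landauProjection ε ℓ j (schwartzIncl (lowerG ℓ (landauFun ℓ p))) =
      (if p.1 = j then (1 : ℂ) else 0) • schwartzIncl (lowerG ℓ (landauFun ℓ p)) ∧
      landauProjection ε ℓ j (schwartzIncl (raiseG ℓ (landauFun ℓ p))) =
      (if p.1 = j then (1 : ℂ) else 0) • schwartzIncl (raiseG ℓ (landauFun ℓ p)) := fun p => by
    rw [lowerG_basis hℓ, raiseG_basis hℓ, map_smul, map_smul, landauProjection_basis hε hℓ,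
      landauProjection_basis hε hℓ]
    split_ifs <;> simp
  have hcast : ∀ p : ℕ × ℕ, (((if p.1 = j then 1 else 0 : ℝ)) : ℂ) =
      if p.1 = j then (1 : ℂ) else 0 := fun p => by split_ifs <;> simp
  constructor
  · refine isCommutatorDerivative_of_basis hℓ (c := fun p => if p.1 = j then 1 else 0)
      (landauProjection_inner j) (levelCommutator_inner hℓ j (by simp)) hP fun p => ?_
    rw [levelCommutator_eq hε hℓ, coordMul_zero_eq hℓ, hcast]
    simp only [map_smul, map_add, map_sub, (hGP p).1, (hGP p).2]
    module
  · refine isCommutatorDerivative_of_basis hℓ (c := fun p => if p.1 = j then 1 else 0)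
      (landauProjection_inner j) (levelCommutator_inner hℓ j (by simp)) hP fun p => ?_
    rw [levelCommutator_eq hε hℓ, coordMul_one_eq hℓ, hcast]
    simp only [map_smul, map_add, map_sub, (hGP p).1, (hGP p).2]
    generalize (if p.1 = j then (1 : ℂ) else 0) = t
    match_scalars <;> ring_nf <;> simp [I_sq]

/-- Only the paths `j → j - 1 → j` and `j → j + 1 → j` survive, with weights `j` and `j + 1`. After
antisymmetrisation the difference of the weights is `1`, whatever `j` is. -/
theorem levelCommutator_mul (hε : 0 < ε) (hℓ : 0 < ℓ) (j : ℕ) (α β α' β' : ℂ) :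
    landauProjection ε ℓ j * (levelCommutator hℓ j α β * levelCommutator hℓ j α' β') =
      (-(β * α' * j + α * β' * (j + 1))) • landauProjection ε ℓ j := by
  refine clm_ext_landauBasis hℓ fun p => ?_
  obtain ⟨n, m⟩ := p
  have hs : (√(j : ℝ) : ℂ) * √(j : ℝ) = j := by
    rw [← Complex.ofReal_mul, Real.mul_self_sqrt (by positivity)]
    simp
  have hs' := sqrt_succ_mul_self j
  change landauProjection ε ℓ j (levelCommutator hℓ j α β (levelCommutator hℓ j α' β'
    (landauBasis hℓ (n, m)))) = (_ : ℂ) • landauProjection ε ℓ j (landauBasis hℓ (n, m))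
  by_cases h : n = j
  · subst h
    simp only [levelCommutator_basis, map_add, map_sub, map_smul, landauProjection_basis hε hℓ]
    cases n with
    | zero =>
      simp at hs' ⊢
      module
    | succ n =>
      simp only [if_true, Nat.add_sub_cancel, Nat.left_eq_add, Nat.add_eq_left, one_ne_zero, if_false]
      rw [← hs', ← hs]
      simp [show n ≠ n + 1 + 1 by omega, show n + 1 + 1 ≠ n by omega]
      module
  -- From outside the level `j`, the first factor leads into it and the second leads out of it, so
  -- that `Π_j` gives zero.
  · have hsub : levelCommutator hℓ j α' β' (landauBasis hℓ (n, m)) =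
        (-(α' * √((j : ℝ) + 1) * if n = j + 1 then 1 else 0) -
          (β' * √(j : ℝ) * if n = j - 1 then 1 else 0)) • landauBasis hℓ (j, m) := by
      rw [levelCommutator_basis, if_neg h]
      module
    rw [hsub, landauProjection_basis hε hℓ, if_neg h, smul_zero, map_smul, map_smul,
      levelCommutator_basis]
    cases j with
    | zero => simp [landauProjection_basis hε hℓ]
    | succ j => simp [landauProjection_basis hε hℓ]

theorem curvatureOperator_eq (hε : 0 < ε) (hℓ : 0 < ℓ) (j : ℕ) :
    curvatureOperator ε ℓ j = (-I * (ℓ : ℂ) ^ 2) • landauProjection ε ℓ j := by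
  obtain ⟨h0, h1⟩ := isCommutatorDerivative_landauProjection hε hℓ j
  rw [curvatureOperator, derivation_eq h0, derivation_eq h1, mul_sub, levelCommutator_mul hε hℓ,
    levelCommutator_mul hε hℓ, ← sub_smul]
  congr 1
  calc _ = -(2 * I * (ℓ : ℂ) ^ 2 * (((√2 : ℝ) : ℂ)⁻¹ * ((√2 : ℝ) : ℂ)⁻¹)) := by ring
    _ = _ := by
      rw [inv_sqrt_two_mul_self]
      ring

theorem resolvent_mul_curvature (hε : 0 < ε) (hℓ : 0 < ℓ) {ξ : ℝ} (hξ : 0 ≤ ξ) (j : ℕ) :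
    ∃ B : L2 →L[ℂ] L2, IsTransfer (fun m => landauBasis hℓ (j, m)) (fun m => landauBasis hℓ (j, m))
        (fun m : ℕ => ((ℓ ^ 2 * (1 / (m + (j + 1 + 2 * ξ))) : ℝ) : ℂ)) B ∧
      oscillatorResolvent ℓ ξ * curvatureOperator ε ℓ j = (-I) • B := by
  obtain ⟨B, hB⟩ := exists_isTransfer (orthonormal_row hℓ j) (orthonormal_row hℓ j)
    (c := fun m : ℕ => ((ℓ ^ 2 * (1 / (m + (j + 1 + 2 * ξ))) : ℝ) : ℂ)) (C := ℓ ^ 2) (fun m => by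
      rw [Complex.norm_real, Real.norm_of_nonneg (by positivity)]
      refine mul_le_of_le_one_right (by positivity) ?_
      rw [div_le_one (by positivity)]
      have : (0 : ℝ) ≤ m + j := by positivity
      linarith)
  refine ⟨B, hB, clm_ext_landauBasis hℓ fun p => ?_⟩
  obtain ⟨n, m⟩ := p
  rw [curvatureOperator_eq hε hℓ]
  change oscillatorResolvent ℓ ξ ((_ : ℂ) • landauProjection ε ℓ j (landauBasis hℓ (n, m))) = (_ : ℂ) • B _
  rw [map_smul, landauProjection_basis hε hℓ]
  by_cases h : n = j
  · subst h
    rw [if_pos rfl, (isTransfer_oscillatorResolvent hℓ hξ).apply_self (landauBasis hℓ).orthonormal,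
      hB.apply_self (orthonormal_row hℓ n), smul_smul, smul_smul]
    congr 1
    push_cast
    rw [show (m : ℂ) + (n + 1 + 2 * ξ) = n + m + 1 + 2 * ξ by ring]
    ring
  · rw [if_neg h, map_zero, smul_zero, hB.apply_eq_zero, smul_zero]
    intro m'
    rw [orthonormal_iff_ite.1 (landauBasis hℓ).orthonormal, if_neg]
    simp [Ne.symm h]

theorem dixmier_resolvent_curvature (hε : 0 < ε) (hℓ : 0 < ℓ) {ξ : ℝ} (hξ : 0 ≤ ξ) (j : ℕ) :
    IsDixmierMeasurable (oscillatorResolvent ℓ ξ * curvatureOperator ε ℓ j) ∧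
    ∀ t₀ : ℝ, Real.exp 1 < t₀ → ∀ ω : DixmierState t₀,
      dixmierTrace ω (oscillatorResolvent ℓ ξ * curvatureOperator ε ℓ j) = -I * (ℓ : ℂ) ^ 2 := by
  obtain ⟨B, hB, h⟩ := resolvent_mul_curvature hε hℓ hξ j
  have := dixmier_of_harmonic (orthonormal_row hℓ j) (a := j + 1 + 2 * ξ) (K := ℓ ^ 2)
    (by positivity) (by positivity) hB
  rw [h]
  exact_mod_cast this

end Derivation

/-! ### Hermite functions on the line, and the normalised planar ground state. -/

section Hermite

/-- Multiplication by the coordinate on Schwartz functions of one variable. -/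
def lineMul : 𝓢(ℝ, ℂ) →L[ℂ] 𝓢(ℝ, ℂ) := SchwartzMap.smulLeftCLM ℂ (fun t : ℝ => (t : ℂ))

/-- The derivative of Schwartz functions of one variable. -/
def lineD : 𝓢(ℝ, ℂ) →L[ℂ] 𝓢(ℝ, ℂ) := SchwartzMap.derivCLM ℂ ℂ

theorem lineMul_apply (f : 𝓢(ℝ, ℂ)) (t : ℝ) : lineMul f t = t * f t :=
  SchwartzMap.smulLeftCLM_apply_apply (Complex.ofRealCLM.hasTemperateGrowth) f t

theorem hasDerivAt_lineD (f : 𝓢(ℝ, ℂ)) (t : ℝ) : HasDerivAt f (lineD f t) t :=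
  (f.differentiable t).hasDerivAt

theorem lineD_lineMul (f : 𝓢(ℝ, ℂ)) : lineD (lineMul f) = lineMul (lineD f) + f := by
  ext t
  have h : (lineMul f : ℝ → ℂ) = fun t : ℝ => (t : ℂ) * f t := funext (lineMul_apply f)
  have hd := (Complex.ofRealCLM.hasDerivAt (x := t)).mul (hasDerivAt_lineD f t)
  rw [add_apply, lineMul_apply]
  refine ((hasDerivAt_lineD (lineMul f) t).unique ?_)
  rw [h]
  refine hd.congr_deriv ?_
  rw [Complex.ofRealCLM_apply, Complex.ofRealCLM_apply, Complex.ofReal_one]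
  ring

/-- The inclusion of the Schwartz space into `L²(ℝ)`. -/
def lineIncl : 𝓢(ℝ, ℂ) →ₗ[ℂ] Lp ℂ 2 (volume : Measure ℝ) :=
  (SchwartzMap.toLpCLM ℂ ℂ 2 (volume : Measure ℝ)).toLinearMap

theorem lineIncl_injective : Function.Injective lineIncl :=
  SchwartzMap.injective_toLp 2 (volume : Measure ℝ)

theorem inner_lineIncl (f g : 𝓢(ℝ, ℂ)) :
    inner ℂ (lineIncl f) (lineIncl g) = ∫ t, inner ℂ (f t) (g t) :=
  SchwartzMap.inner_toL2_toL2_eq f g volume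

theorem inner_lineIncl_left (f : 𝓢(ℝ, ℂ)) (φ : Lp ℂ 2 (volume : Measure ℝ)) :
    inner ℂ (lineIncl f) φ = ∫ t, starRingEnd ℂ (f t) * φ t := by
  rw [L2.inner_def]
  refine integral_congr_ae ?_
  filter_upwards [f.coeFn_toLp 2 (volume : Measure ℝ)] with t ht
  have ht' : (lineIncl f : Lp ℂ 2 (volume : Measure ℝ)) t = f t := ht
  simp only [ht', RCLike.inner_apply, mul_comm]

theorem integrable_conj_schwartz_mul_line (f : 𝓢(ℝ, ℂ)) (φ : Lp ℂ 2 (volume : Measure ℝ)) :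
    Integrable (fun t => starRingEnd ℂ (f t) * φ t) := by
  have := L2.integrable_inner (𝕜 := ℂ) (lineIncl f) φ
  refine this.congr ?_
  filter_upwards [f.coeFn_toLp 2 (volume : Measure ℝ)] with t ht
  have ht' : (lineIncl f : Lp ℂ 2 (volume : Measure ℝ)) t = f t := ht
  rw [ht', RCLike.inner_apply, mul_comm]

theorem inner_lineMul (f g : 𝓢(ℝ, ℂ)) :
    inner ℂ (lineIncl (lineMul f)) (lineIncl g) = inner ℂ (lineIncl f) (lineIncl (lineMul g)) := by
  rw [inner_lineIncl, inner_lineIncl]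
  refine integral_congr_ae (Eventually.of_forall fun x => ?_)
  simp only [lineMul_apply, RCLike.inner_apply, map_mul, Complex.conj_ofReal]
  ring

theorem inner_lineD (f g : 𝓢(ℝ, ℂ)) :
    inner ℂ (lineIncl (lineD f)) (lineIncl g) = -inner ℂ (lineIncl f) (lineIncl (lineD g)) := by
  rw [inner_lineIncl, inner_lineIncl]
  have h := SchwartzMap.integral_bilinear_lineDerivOp_right_eq_neg_left (μ := volume) f g
    ((ContinuousLinearMap.mul ℝ ℂ) ∘L Complex.conjCLE.toContinuousLinearMap) (1 : ℝ)
  have e : ∀ u v : ℂ, ((ContinuousLinearMap.mul ℝ ℂ) ∘L Complex.conjCLE.toContinuousLinearMap) u v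
      = inner ℂ u v := fun u v => by simp [RCLike.inner_apply, mul_comm]
  simp only [e] at h
  rw [← neg_eq_iff_eq_neg] at h
  exact h.symm

/-- The annihilation operator `(t + d/dt) / √2`. -/
def lineLower : 𝓢(ℝ, ℂ) →ₗ[ℂ] 𝓢(ℝ, ℂ) :=
  ((√2 : ℝ) : ℂ)⁻¹ • (lineMul.toLinearMap + lineD.toLinearMap)

/-- The creation operator `(t - d/dt) / √2`. -/
def lineRaise : 𝓢(ℝ, ℂ) →ₗ[ℂ] 𝓢(ℝ, ℂ) :=
  ((√2 : ℝ) : ℂ)⁻¹ • (lineMul.toLinearMap - lineD.toLinearMap)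

theorem lineLower_apply (f : 𝓢(ℝ, ℂ)) :
    lineLower f = ((√2 : ℝ) : ℂ)⁻¹ • (lineMul f + lineD f) := rfl

theorem lineRaise_apply (f : 𝓢(ℝ, ℂ)) :
    lineRaise f = ((√2 : ℝ) : ℂ)⁻¹ • (lineMul f - lineD f) := rfl

theorem lineLower_lineRaise (f : 𝓢(ℝ, ℂ)) :
    lineLower (lineRaise f) = lineRaise (lineLower f) + f := by
  simp only [lineLower_apply, lineRaise_apply, map_smul, map_add, map_sub, lineD_lineMul]
  rw [← sub_eq_iff_eq_add']
  calc _ = (((√2 : ℝ) : ℂ)⁻¹ * ((√2 : ℝ) : ℂ)⁻¹ * 2) • f := by module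
    _ = f := by
        rw [inv_sqrt_two_mul_self]
        module

theorem inner_lineRaise (f g : 𝓢(ℝ, ℂ)) :
    inner ℂ (lineIncl (lineRaise f)) (lineIncl g) =
      inner ℂ (lineIncl f) (lineIncl (lineLower g)) := by
  simp only [lineRaise_apply, lineLower_apply, map_smul, map_add, map_sub, inner_smul_left,
    inner_smul_right, inner_add_right, inner_sub_left, inner_lineMul, inner_lineD, map_inv₀,
    Complex.conj_ofReal]
  ring

theorem lineD_gaussian {c : ℝ} (hc : 0 < c) :
    lineD (gaussian ℝ c) = (-2 * c : ℂ) • lineMul (gaussian ℝ c) := by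
  ext t
  have h1 : (gaussian ℝ c : ℝ → ℂ) = fun t => ((Real.exp (-c * t ^ 2) : ℝ) : ℂ) := by
    funext t
    rw [gaussian_apply hc, Real.norm_eq_abs, sq_abs]
  have h2 : HasDerivAt (fun t : ℝ => Real.exp (-c * t ^ 2)) (Real.exp (-c * t ^ 2) * (-c * (2 * t))) t := by
    simpa using ((hasDerivAt_pow 2 t).const_mul (-c)).exp
  refine (hasDerivAt_lineD _ t).unique ?_
  rw [smul_apply, lineMul_apply, h1]
  refine h2.ofReal_comp.congr_deriv ?_
  push_cast
  rw [smul_eq_mul]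
  ring

/-- The normalizing constant of the ground state. -/
def lineGroundConst : ℝ := ‖lineIncl (gaussian ℝ (1 / 2))‖⁻¹

/-- The Hermite functions. -/
def hermiteFun (n : ℕ) : 𝓢(ℝ, ℂ) :=
  ladder lineRaise ((lineGroundConst : ℂ) • gaussian ℝ (1 / 2)) n

theorem lineLower_hermiteFun_zero : lineLower (hermiteFun 0) = 0 := by
  simp only [hermiteFun, ladder_zero, map_smul, lineLower_apply, lineD_gaussian one_half_pos]
  convert smul_zero _
  convert smul_zero _
  push_cast
  module

theorem lineRaise_hermiteFun (n : ℕ) :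
    lineRaise (hermiteFun n) = (√((n : ℝ) + 1) : ℂ) • hermiteFun (n + 1) :=
  create_ladder _ _ _

theorem lineLower_hermiteFun (n : ℕ) :
    lineLower (hermiteFun n) = (√(n : ℝ) : ℂ) • hermiteFun (n - 1) :=
  annihilate_ladder lineLower_lineRaise lineLower_hermiteFun_zero _

theorem sqrt_two_inv_smul (f : 𝓢(ℝ, ℂ)) :
    f = ((√2 : ℝ) : ℂ)⁻¹ • ((√2 : ℝ) : ℂ)⁻¹ • (2 : ℂ) • f := by
  rw [smul_smul, smul_smul, inv_sqrt_two_mul_self]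
  norm_num

theorem lineMul_eq (f : 𝓢(ℝ, ℂ)) :
    lineMul f = ((√2 : ℝ) : ℂ)⁻¹ • (lineLower f + lineRaise f) := by
  conv_lhs => rw [sqrt_two_inv_smul (lineMul f)]
  rw [lineLower_apply, lineRaise_apply]
  module

theorem lineD_eq (f : 𝓢(ℝ, ℂ)) :
    lineD f = ((√2 : ℝ) : ℂ)⁻¹ • (lineLower f - lineRaise f) := by
  conv_lhs => rw [sqrt_two_inv_smul (lineD f)]
  rw [lineLower_apply, lineRaise_apply]
  module

theorem norm_sq_lineGaussian : ‖lineIncl (gaussian ℝ (1 / 2))‖ ^ 2 = √Real.pi := by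
  have h := inner_lineIncl (gaussian ℝ (1 / 2)) (gaussian ℝ (1 / 2))
  rw [inner_self_eq_norm_sq_to_K] at h
  have h2 : ∀ t : ℝ, inner ℂ (gaussian ℝ (1 / 2) t) (gaussian ℝ (1 / 2) t) =
      ((Real.exp (-1 * t ^ 2) : ℝ) : ℂ) := fun t => by
    rw [gaussian_apply one_half_pos, RCLike.inner_apply, Complex.conj_ofReal, ← Complex.ofReal_mul,
      ← Real.exp_add, Real.norm_eq_abs, sq_abs]
    ring_nf
  simp only [h2] at h
  rw [integral_complex_ofReal, integral_gaussian, div_one] at h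
  exact Complex.ofReal_injective ((Complex.ofReal_pow _ _).trans h)

theorem lineGroundConst_sq : lineGroundConst ^ 2 = (√Real.pi)⁻¹ := by
  rw [lineGroundConst, inv_pow, norm_sq_lineGaussian]

theorem orthonormal_hermiteFun : Orthonormal ℂ (fun n => lineIncl (hermiteFun n)) := by
  rw [orthonormal_iff_ite]
  intro n m
  have h0 : lineLower ((lineGroundConst : ℂ) • gaussian ℝ (1 / 2)) = 0 := lineLower_hermiteFun_zero
  rw [hermiteFun, hermiteFun, inner_ladder lineLower_lineRaise inner_lineRaise h0 h0, map_smul, inner_smul_left, inner_smul_right,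
    inner_self_eq_norm_sq_to_K, Complex.conj_ofReal]
  have hpi : (√Real.pi) ≠ 0 := by positivity
  have : (lineGroundConst : ℂ) * (lineGroundConst *
      ((‖lineIncl (gaussian ℝ (1 / 2))‖ : ℝ) : ℂ) ^ 2) = 1 := by
    rw [← mul_assoc, ← sq, ← Complex.ofReal_pow, ← Complex.ofReal_pow, ← Complex.ofReal_mul,
      lineGroundConst_sq, norm_sq_lineGaussian, inv_mul_cancel₀ hpi, Complex.ofReal_one]
  split_ifs
  · exact this
  · rfl

theorem lineMul_mem_span {f : 𝓢(ℝ, ℂ)} (hf : f ∈ Submodule.span ℂ (Set.range hermiteFun)) :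
    lineMul f ∈ Submodule.span ℂ (Set.range hermiteFun) := by
  set S := Submodule.span ℂ (Set.range hermiteFun)
  have hb : ∀ n, hermiteFun n ∈ S := fun n => Submodule.subset_span ⟨n, rfl⟩
  have hle : S ≤ S.comap lineMul.toLinearMap := by
    refine Submodule.span_le.2 ?_
    rintro _ ⟨n, rfl⟩
    change lineMul (hermiteFun n) ∈ S
    rw [lineMul_eq, lineLower_hermiteFun, lineRaise_hermiteFun]
    exact S.smul_mem _ (S.add_mem (S.smul_mem _ (hb _)) (S.smul_mem _ (hb _)))
  exact hle hf

theorem ae_eq_zero_of_hermiteFun {h : ℝ → ℂ}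
    (hint : ∀ f : 𝓢(ℝ, ℂ), Integrable (fun t => starRingEnd ℂ (f t) * h t))
    (horth : ∀ n, ∫ t, starRingEnd ℂ (hermiteFun n t) * h t = 0) : h =ᵐ[volume] 0 := by
  refine ae_eq_zero_of_gaussian_moments one_half_pos hint
    (Submodule.span ℂ (Set.range hermiteFun)) ?_ (fun w f hf => ?_) (fun f hf => ?_)
  · have h0 : hermiteFun 0 ∈ Submodule.span ℂ (Set.range hermiteFun) :=
      Submodule.subset_span ⟨0, rfl⟩
    have hn : (lineGroundConst : ℂ) ≠ 0 := by
      rw [Complex.ofReal_ne_zero, lineGroundConst]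
      refine inv_ne_zero ?_
      rw [norm_ne_zero_iff, Ne, map_eq_zero_iff _ lineIncl_injective]
      exact gaussian_ne_zero one_half_pos
    exact (Submodule.smul_mem_iff _ hn).1 h0
  · have e : SchwartzMap.smulLeftCLM ℂ (fun t : ℝ => ((inner ℝ w t : ℝ) : ℂ)) f =
        (w : ℂ) • lineMul f := by
      ext t
      rw [SchwartzMap.smulLeftCLM_apply_apply (by fun_prop), smul_apply, lineMul_apply]
      simp
      ring
    rw [e]
    exact Submodule.smul_mem _ _ (lineMul_mem_span hf)
  · induction hf using Submodule.span_induction with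
    | mem f hf =>
      obtain ⟨p, rfl⟩ := hf
      exact horth p
    | zero => simp
    | add f g _ _ hf hg =>
      simp only [add_apply, map_add, add_mul]
      rw [integral_add (hint f) (hint g), hf, hg, add_zero]
    | smul r f _ hf =>
      simp only [smul_apply, smul_eq_mul, map_mul, mul_assoc]
      rw [integral_const_mul, hf, mul_zero]

/-- The Hilbert basis of Hermite functions. -/
def hermiteBasis : HilbertBasis ℕ ℂ (Lp ℂ 2 (volume : Measure ℝ)) :=
  HilbertBasis.mkOfOrthogonalEqBot orthonormal_hermiteFun (by
    rw [Submodule.eq_bot_iff]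
    intro φ hφ
    refine Lp.ext (((ae_eq_zero_of_hermiteFun (fun f => integrable_conj_schwartz_mul_line f φ)
      fun p => ?_).trans (Lp.coeFn_zero ℂ 2 volume).symm))
    rw [← inner_lineIncl_left]
    exact (Submodule.mem_orthogonal _ _).1 hφ _ (Submodule.subset_span ⟨p, rfl⟩))

theorem hermiteBasis_apply (n : ℕ) : hermiteBasis n = lineIncl (hermiteFun n) := by
  rw [hermiteBasis, HilbertBasis.coe_mkOfOrthogonalEqBot]

theorem hermiteFun_zero_apply (t : ℝ) :
    hermiteFun 0 t = lineGroundConst * ((Real.exp (-(t ^ 2 / 2)) : ℝ) : ℂ) := by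
  rw [hermiteFun, ladder_zero, smul_apply, gaussian_apply one_half_pos, Real.norm_eq_abs, sq_abs,
    smul_eq_mul]
  ring_nf

theorem norm_sq_gaussianPlane {ℓ : ℝ} (hℓ : 0 < ℓ) :
    ‖schwartzIncl (gaussian Plane (1 / (4 * ℓ ^ 2)))‖ ^ 2 = 2 * Real.pi * ℓ ^ 2 := by
  have h := inner_schwartzIncl (gaussian Plane (1 / (4 * ℓ ^ 2))) (gaussian Plane (1 / (4 * ℓ ^ 2)))
  rw [inner_self_eq_norm_sq_to_K] at h
  have h2 : ∀ x : Plane, inner ℂ (gaussian Plane (1 / (4 * ℓ ^ 2)) x)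
      (gaussian Plane (1 / (4 * ℓ ^ 2)) x) =
      ((Real.exp (-(1 / (2 * ℓ ^ 2)) * ‖x‖ ^ 2) : ℝ) : ℂ) := fun x => by
    rw [gaussian_apply (four_sq_pos hℓ), RCLike.inner_apply, Complex.conj_ofReal,
      ← Complex.ofReal_mul, ← Real.exp_add]
    ring_nf
  simp only [h2] at h
  rw [integral_complex_ofReal, GaussianFourier.integral_rexp_neg_mul_sq_norm (by positivity)] at h
  have h3 : ‖schwartzIncl (gaussian Plane (1 / (4 * ℓ ^ 2)))‖ ^ 2 =
    (Real.pi / (1 / (2 * ℓ ^ 2))) ^ (((Module.finrank ℝ Plane : ℕ) : ℝ) / 2) :=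
    Complex.ofReal_injective ((Complex.ofReal_pow _ _).trans h)
  rw [h3, finrank_euclideanSpace_fin]
  norm_num
  field_simp

/-- The explicit constant is needed because the integral representation must reproduce the ground
state exactly, and this constant later becomes the prefactor `1 / (2π ℓ²)` of the kernel of `Π_j`.
-/
theorem groundState_apply {ℓ : ℝ} (hℓ : 0 < ℓ) (x : Plane) :
    groundState ℓ x = (((√(2 * Real.pi) * ℓ)⁻¹ *
      Real.exp (-((x 0 / ℓ) ^ 2 + (x 1 / ℓ) ^ 2) / 4) : ℝ) : ℂ) := by
  have h : ‖schwartzIncl (gaussian Plane (1 / (4 * ℓ ^ 2)))‖ = √(2 * Real.pi) * ℓ := by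
    rw [← Real.sqrt_sq (norm_nonneg _), norm_sq_gaussianPlane hℓ, Real.sqrt_mul (by positivity),
      Real.sqrt_sq hℓ.le]
  rw [groundState, smul_apply, gaussian_apply (four_sq_pos hℓ), h, smul_eq_mul, ← Complex.ofReal_mul,
    EuclideanSpace.norm_sq_eq, Fin.sum_univ_two]
  simp only [Real.norm_eq_abs, sq_abs]
  congr 3
  field_simp

end Hermite

/-! ### Landau functions as Fourier–Wigner transforms of pairs of Hermite functions. -/

section Superposition

theorem schwartz_decay (f : 𝓢(ℝ, ℂ)) (k : ℕ) : ∃ C, ∀ t, |t| ^ k * ‖f t‖ ≤ C := by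
  obtain ⟨C, -, hC⟩ := f.decay k 0
  refine ⟨C, fun t => ?_⟩
  have := hC t
  rwa [norm_iteratedFDeriv_zero, Real.norm_eq_abs] at this

theorem schwartz_bounded (f : 𝓢(ℝ, ℂ)) : ∃ C, ∀ t, ‖f t‖ ≤ C := by
  obtain ⟨C, hC⟩ := schwartz_decay f 0
  exact ⟨C, fun t => by simpa using hC t⟩

theorem integrable_schwartz_mul (f : 𝓢(ℝ, ℂ)) {g : ℝ → ℂ} (hg : Continuous g) {C : ℝ}
    (hC : ∀ t, ‖g t‖ ≤ C) : Integrable (fun t => f t * g t) :=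
  f.integrable.mul_bdd hg.aestronglyMeasurable (Eventually.of_forall hC)

/-- The Fourier–Wigner type transform `∫ f(s) e^{isv} h(u + s) ds`. -/
def wigner (f h : 𝓢(ℝ, ℂ)) (u v : ℝ) : ℂ := ∫ s : ℝ, f s * (exp (I * ((s * v : ℝ) : ℂ)) * h (u + s))

theorem norm_exp_I_mul (r : ℝ) : ‖exp (I * (r : ℂ))‖ = 1 := by
  rw [mul_comm, Complex.norm_exp_ofReal_mul_I]

variable (f h : 𝓢(ℝ, ℂ))

theorem integrable_wigner (u v : ℝ) :
    Integrable (fun s : ℝ => f s * (exp (I * ((s * v : ℝ) : ℂ)) * h (u + s))) := by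
  obtain ⟨C, hC⟩ := schwartz_bounded h
  have hh : Continuous h := h.continuous
  refine integrable_schwartz_mul f (by fun_prop) (C := C) fun s => ?_
  rw [norm_mul, norm_exp_I_mul, one_mul]
  exact hC _

theorem hasDerivAt_wigner_left (u v : ℝ) :
    HasDerivAt (fun u => wigner f h u v) (wigner f (lineD h) u v) u := by
  obtain ⟨C, hC⟩ := schwartz_bounded (lineD h)
  refine (hasDerivAt_integral_of_dominated_loc_of_deriv_le (bound := fun s => ‖f s‖ * C)
    (F' := fun u s => f s * (exp (I * ((s * v : ℝ) : ℂ)) * lineD h (u + s)))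
    (s := Set.univ) Filter.univ_mem
    (Eventually.of_forall fun u => (integrable_wigner f h u v).1) (integrable_wigner f h u v)
    (integrable_wigner f (lineD h) u v).1 (Eventually.of_forall fun s u' _ => ?_)
    (f.integrable.norm.mul_const C) (Eventually.of_forall fun s u' _ => ?_)).2
  · rw [norm_mul, norm_mul, norm_exp_I_mul, one_mul]
    exact mul_le_mul_of_nonneg_left (hC _) (norm_nonneg _)
  · exact (((hasDerivAt_lineD h (u' + s)).comp_add_const u' s).const_mul _).const_mul _

theorem hasDerivAt_wigner_right (u v : ℝ) :
    HasDerivAt (fun v => wigner f h u v) (I * wigner (lineMul f) h u v) v := by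
  obtain ⟨C, hC⟩ := schwartz_bounded h
  have e : I * wigner (lineMul f) h u v =
      ∫ s : ℝ, f s * (I * s * exp (I * ((s * v : ℝ) : ℂ)) * h (u + s)) := by
    rw [wigner, ← integral_const_mul]
    refine integral_congr_ae (Eventually.of_forall fun s => ?_)
    simp only [lineMul_apply]
    ring
  rw [e]
  refine (hasDerivAt_integral_of_dominated_loc_of_deriv_le (bound := fun s => ‖lineMul f s‖ * C)
    (F' := fun v s => f s * (I * s * exp (I * ((s * v : ℝ) : ℂ)) * h (u + s)))
    (s := Set.univ) Filter.univ_mem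
    (Eventually.of_forall fun v => (integrable_wigner f h u v).1) (integrable_wigner f h u v)
    ?_ (Eventually.of_forall fun s v' _ => ?_)
    ((lineMul f).integrable.norm.mul_const C) (Eventually.of_forall fun s v' _ => ?_)).2
  · have hf : Continuous f := f.continuous
    have hh : Continuous h := h.continuous
    exact (by fun_prop : Continuous fun s : ℝ =>
      f s * (I * s * exp (I * ((s * v : ℝ) : ℂ)) * h (u + s))).aestronglyMeasurable
  · rw [lineMul_apply, norm_mul, norm_mul, norm_mul, norm_mul, norm_mul, norm_exp_I_mul, mul_one,
      Complex.norm_I, one_mul]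
    calc _ = ‖(s : ℂ)‖ * ‖f s‖ * ‖h (u + s)‖ := by ring
      _ ≤ _ := mul_le_mul_of_nonneg_left (hC _) (by positivity)
  · have h1 : HasDerivAt (fun v : ℝ => I * ((s * v : ℝ) : ℂ)) (I * s) v' := by
      have := (((hasDerivAt_id v').const_mul s).ofReal_comp).const_mul I
      simpa using this
    have := ((h1.cexp.mul_const (h (u + s))).const_mul (f s))
    refine this.congr_deriv ?_
    ring

/-- Write `u = (u + s) - s` under the integral. -/
theorem mul_left_wigner (u v : ℝ) :
    u * wigner f h u v = wigner f (lineMul h) u v - wigner (lineMul f) h u v := by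
  rw [wigner, wigner, wigner, ← integral_sub (integrable_wigner _ _ _ _)
    (integrable_wigner _ _ _ _), ← integral_const_mul]
  refine integral_congr_ae (Eventually.of_forall fun s => ?_)
  simp only [lineMul_apply]
  push_cast
  ring

/-- Write `v e^{isv}` as `-i` times the `s`-derivative of `e^{isv}` and integrate by parts. -/
theorem mul_right_wigner (u v : ℝ) :
    v * wigner f h u v = I * (wigner (lineD f) h u v + wigner f (lineD h) u v) := by
  have h1 : ∀ s : ℝ, HasDerivAt (fun s => f s * h (u + s))
      (lineD f s * h (u + s) + f s * lineD h (u + s)) s := fun s =>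
    (hasDerivAt_lineD f s).mul ((hasDerivAt_lineD h (u + s)).comp_const_add u s)
  have h2 : ∀ s : ℝ, HasDerivAt (fun s : ℝ => exp (I * ((s * v : ℝ) : ℂ)))
      (exp (I * ((s * v : ℝ) : ℂ)) * (I * v)) s := fun s => by
    have := ((((hasDerivAt_id s).mul_const v).ofReal_comp).const_mul I).cexp
    simpa using this
  have i1 := integrable_wigner f h u v
  have i2 := (integrable_wigner (lineD f) h u v)
  have i3 := (integrable_wigner f (lineD h) u v)
  have := integral_mul_deriv_eq_deriv_mul_of_integrable (fun s _ => h1 s) (fun s _ => h2 s)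
    ((i1.const_mul (I * v)).congr (Eventually.of_forall fun s => by
      simp only [Pi.mul_apply]; ring))
    ((i2.add i3).congr (Eventually.of_forall fun s => by
      simp only [Pi.mul_apply, Pi.add_apply]; ring))
    (i1.congr (Eventually.of_forall fun s => by simp only [Pi.mul_apply]; ring))
  have e1 : (I * v) * wigner f h u v =
      ∫ s, f s * h (u + s) * (exp (I * ((s * v : ℝ) : ℂ)) * (I * v)) := by
    rw [wigner, ← integral_const_mul]
    refine integral_congr_ae (Eventually.of_forall fun s => ?_)
    ring
  have e2 : wigner (lineD f) h u v + wigner f (lineD h) u v =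
      ∫ s, (lineD f s * h (u + s) + f s * lineD h (u + s)) * exp (I * ((s * v : ℝ) : ℂ)) := by
    rw [wigner, wigner, ← integral_add i2 i3]
    refine integral_congr_ae (Eventually.of_forall fun s => ?_)
    ring
  rw [← e1, ← e2] at this
  linear_combination -I * this + (v * wigner f h u v) * I_mul_I

theorem wigner_add_left (g : 𝓢(ℝ, ℂ)) (u v : ℝ) :
    wigner (f + g) h u v = wigner f h u v + wigner g h u v := by
  rw [wigner, wigner, wigner, ← integral_add (integrable_wigner _ _ _ _)
    (integrable_wigner _ _ _ _)]
  simp only [add_apply, add_mul]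

theorem wigner_add_right (g : 𝓢(ℝ, ℂ)) (u v : ℝ) :
    wigner f (h + g) u v = wigner f h u v + wigner f g u v := by
  rw [wigner, wigner, wigner, ← integral_add (integrable_wigner _ _ _ _)
    (integrable_wigner _ _ _ _)]
  simp only [add_apply, mul_add]

theorem wigner_smul_left (c : ℂ) (u v : ℝ) : wigner (c • f) h u v = c * wigner f h u v := by
  rw [wigner, wigner, ← integral_const_mul]
  simp only [smul_apply, smul_eq_mul, mul_assoc]

theorem wigner_smul_right (c : ℂ) (u v : ℝ) : wigner f (c • h) u v = c * wigner f h u v := by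
  rw [wigner, wigner, ← integral_const_mul]
  refine integral_congr_ae (Eventually.of_forall fun s => ?_)
  simp only [smul_apply, smul_eq_mul]
  ring

/-- The wave function `e^{iuv/2} ∫ f(s) e^{isv} h(u + s) ds` with `(u, v) = x / ℓ`. -/
def superposition (ℓ : ℝ) (x : Plane) : ℂ :=
  exp (I * ((x 0 / ℓ * (x 1 / ℓ) / 2 : ℝ) : ℂ)) * wigner f h (x 0 / ℓ) (x 1 / ℓ)

variable {f h} {ℓ : ℝ} {c : ℂ} {φ : 𝓢(Plane, ℂ)}

theorem partialD_zero_superposition (hφ : ∀ x, φ x = c * superposition f h ℓ x) (x : Plane) :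
    partialD 0 φ x = (ℓ : ℂ)⁻¹ * (I * ((x 1 : ℂ) / ℓ / 2) * φ x +
      c * superposition f (lineD h) ℓ x) := by
  have h1 := (φ.hasFDerivAt x).hasLineDerivAt (EuclideanSpace.single 0 (1 : ℝ))
  rw [partialD_apply]
  refine HasDerivAt.unique h1 ?_
  have e : ∀ t : ℝ, φ (x + t • EuclideanSpace.single 0 (1 : ℝ)) =
      c * (exp (I * (((x 0 + t) / ℓ * (x 1 / ℓ) / 2 : ℝ) : ℂ)) *
        wigner f h ((x 0 + t) / ℓ) (x 1 / ℓ)) := fun t => by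
    rw [hφ]
    simp [superposition]
  simp only [e]
  have d1 : HasDerivAt (fun t : ℝ => (x 0 + t) / ℓ) (1 / ℓ) 0 :=
    ((hasDerivAt_id (0 : ℝ)).const_add (x 0)).div_const ℓ
  have d2 := (((d1.mul_const (x 1 / ℓ)).div_const 2).ofReal_comp.const_mul I).cexp
  have d3 := (hasDerivAt_wigner_left f h ((x 0 + 0) / ℓ) (x 1 / ℓ)).scomp (0 : ℝ) d1
  refine ((d2.mul d3).const_mul c).congr_deriv ?_
  simp only [add_zero, Function.comp_apply, Complex.real_smul, hφ, superposition]
  push_cast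
  ring

theorem partialD_one_superposition (hφ : ∀ x, φ x = c * superposition f h ℓ x) (x : Plane) :
    partialD 1 φ x = (ℓ : ℂ)⁻¹ * (I * ((x 0 : ℂ) / ℓ / 2) * φ x +
      c * (I * superposition (lineMul f) h ℓ x)) := by
  have h1 := (φ.hasFDerivAt x).hasLineDerivAt (EuclideanSpace.single 1 (1 : ℝ))
  rw [partialD_apply]
  refine HasDerivAt.unique h1 ?_
  have e : ∀ t : ℝ, φ (x + t • EuclideanSpace.single 1 (1 : ℝ)) =
      c * (exp (I * ((x 0 / ℓ * ((x 1 + t) / ℓ) / 2 : ℝ) : ℂ)) *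
        wigner f h (x 0 / ℓ) ((x 1 + t) / ℓ)) := fun t => by
    rw [hφ]
    simp [superposition]
  simp only [e]
  have d1 : HasDerivAt (fun t : ℝ => (x 1 + t) / ℓ) (1 / ℓ) 0 :=
    ((hasDerivAt_id (0 : ℝ)).const_add (x 1)).div_const ℓ
  have d2 := (((d1.const_mul (x 0 / ℓ)).div_const 2).ofReal_comp.const_mul I).cexp
  have d3 := (hasDerivAt_wigner_right f h (x 0 / ℓ) ((x 1 + 0) / ℓ)).scomp (0 : ℝ) d1
  refine ((d2.mul d3).const_mul c).congr_deriv ?_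
  simp only [add_zero, Function.comp_apply, Complex.real_smul, hφ, superposition]
  push_cast
  ring

theorem mul_left_superposition (x : Plane) : (x 0 : ℂ) / ℓ * superposition f h ℓ x =
    superposition f (lineMul h) ℓ x - superposition (lineMul f) h ℓ x := by
  have hu := mul_left_wigner f h (x 0 / ℓ) (x 1 / ℓ)
  rw [Complex.ofReal_div] at hu
  simp only [superposition]
  linear_combination exp (I * ((x 0 / ℓ * (x 1 / ℓ) / 2 : ℝ) : ℂ)) * hu

theorem mul_right_superposition (x : Plane) : (x 1 : ℂ) / ℓ * superposition f h ℓ x =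
    I * (superposition (lineD f) h ℓ x + superposition f (lineD h) ℓ x) := by
  have hu := mul_right_wigner f h (x 0 / ℓ) (x 1 / ℓ)
  rw [Complex.ofReal_div] at hu
  simp only [superposition]
  linear_combination exp (I * ((x 0 / ℓ * (x 1 / ℓ) / 2 : ℝ) : ℂ)) * hu

/-- The transform separates the two oscillators: `raiseK` acts on the factor `h` alone and `raiseG`
on `f` alone, each as the creation operator of the line. -/
theorem raiseK_superposition (hℓ : 0 < ℓ) (hφ : ∀ x, φ x = c * superposition f h ℓ x) (x : Plane) :
    raiseK ℓ φ x = c * I * superposition f (lineRaise h) ℓ x := by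
  have hl : (ℓ : ℂ) * (ℓ : ℂ)⁻¹ = 1 := mul_inv_cancel₀ (by exact_mod_cast hℓ.ne')
  have e : superposition f (lineRaise h) ℓ x = ((√2 : ℝ) : ℂ)⁻¹ *
      (superposition f (lineMul h) ℓ x - superposition f (lineD h) ℓ x) := by
    rw [lineRaise_apply, show lineMul h - lineD h = lineMul h + (-1 : ℂ) • lineD h by module]
    simp only [superposition, wigner_smul_right, wigner_add_right]
    ring
  have h1 := mul_left_superposition (f := f) (h := h) (ℓ := ℓ) x
  rw [raising_apply, K₁_apply, K₂_apply, e]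
  simp only [smul_apply, add_apply, sub_apply, smul_eq_mul, partialD_zero_superposition hφ,
    partialD_one_superposition hφ, coordMul_apply, hφ]
  rw [one_div, mul_inv]
  set A := superposition f h ℓ x
  set B := superposition f (lineMul h) ℓ x
  set B' := superposition (lineMul f) h ℓ x
  set D := superposition f (lineD h) ℓ x
  set r := (ℓ : ℂ)⁻¹
  rw [div_eq_mul_inv] at h1
  simp only [div_eq_mul_inv]
  linear_combination (((√2 : ℝ) : ℂ)⁻¹) * (c * I * h1 +
    (-I * (I * (x 1 * r * 2⁻¹) * (c * A) + c * D) +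
      I * -I * (I * (x 0 * r * 2⁻¹) * (c * A) + c * (I * B'))) * hl +
    (-(x 1 * r * 2⁻¹) * c * A - I * (x 0 * r * 2⁻¹) * c * A - I * c * B') * I_mul_I)

theorem raiseG_superposition (hℓ : 0 < ℓ) (hφ : ∀ x, φ x = c * superposition f h ℓ x) (x : Plane) :
    raiseG ℓ φ x = c * superposition (lineRaise f) h ℓ x := by
  have hl : (ℓ : ℂ) * (ℓ : ℂ)⁻¹ = 1 := mul_inv_cancel₀ (by exact_mod_cast hℓ.ne')
  have e : superposition (lineRaise f) h ℓ x = ((√2 : ℝ) : ℂ)⁻¹ *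
      (superposition (lineMul f) h ℓ x - superposition (lineD f) h ℓ x) := by
    rw [lineRaise_apply, show lineMul f - lineD f = lineMul f + (-1 : ℂ) • lineD f by module]
    simp only [superposition, wigner_smul_left, wigner_add_left]
    ring
  have h1 := mul_right_superposition (f := f) (h := h) (ℓ := ℓ) x
  rw [raising_apply, G₁_apply, G₂_apply, e]
  simp only [smul_apply, add_apply, sub_apply, smul_eq_mul, partialD_zero_superposition hφ,
    partialD_one_superposition hφ, coordMul_apply, hφ]
  rw [one_div, mul_inv]
  set A := superposition f h ℓ x
  set B := superposition f (lineD h) ℓ x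
  set B' := superposition (lineMul f) h ℓ x
  set D := superposition (lineD f) h ℓ x
  set r := (ℓ : ℂ)⁻¹
  rw [div_eq_mul_inv] at h1
  simp only [div_eq_mul_inv]
  linear_combination (((√2 : ℝ) : ℂ)⁻¹) * (c * I * h1 +
    (-I * (I * (x 0 * r * 2⁻¹) * (c * A) + c * (I * B')) +
      I * -I * (I * (x 1 * r * 2⁻¹) * (c * A) + c * B)) * hl +
    (-(x 0 * r * 2⁻¹) * c * A - c * B' + c * D - I * (x 1 * r * 2⁻¹) * c * A) * I_mul_I)

theorem superposition_smul_left (a : ℂ) (x : Plane) :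
    superposition (a • f) h ℓ x = a * superposition f h ℓ x := by
  rw [superposition, wigner_smul_left, superposition]
  ring

theorem superposition_smul_right (a : ℂ) (x : Plane) :
    superposition f (a • h) ℓ x = a * superposition f h ℓ x := by
  rw [superposition, wigner_smul_right, superposition]
  ring

/-- A Gaussian integral; its factor `√π` cancels the square of `lineGroundConst`. -/
theorem wigner_ground (u v : ℝ) : wigner (hermiteFun 0) (hermiteFun 0) u v =
    exp (-(u : ℂ) ^ 2 / 2 + (-u + I * v) ^ 2 / 4) := by
  have hpi : ((√Real.pi : ℝ) : ℂ) ≠ 0 := by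
    have : √Real.pi ≠ 0 := by positivity
    exact_mod_cast this
  have h1 := integral_cexp_quadratic (b := -1) (by simp) (-(u : ℂ) + I * v) (-(u : ℂ) ^ 2 / 2)
  have h2 : ((Real.pi : ℂ) / - -1) ^ (1 / 2 : ℂ) = ((√Real.pi : ℝ) : ℂ) := by
    rw [neg_neg, div_one, Real.sqrt_eq_rpow, Complex.ofReal_cpow Real.pi_pos.le]
    norm_num
  rw [h2] at h1
  have h3 : wigner (hermiteFun 0) (hermiteFun 0) u v = (((√Real.pi)⁻¹ : ℝ) : ℂ) *
      ∫ s : ℝ, exp (-1 * (s : ℂ) ^ 2 + (-(u : ℂ) + I * v) * s + -(u : ℂ) ^ 2 / 2) := by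
    rw [wigner, ← integral_const_mul, ← lineGroundConst_sq]
    refine integral_congr_ae (Eventually.of_forall fun s => ?_)
    have e : exp (-1 * (s : ℂ) ^ 2 + (-(u : ℂ) + I * v) * s + -(u : ℂ) ^ 2 / 2) =
        ((Real.exp (-(s ^ 2 / 2)) : ℝ) : ℂ) * exp (I * ((s * v : ℝ) : ℂ)) *
          ((Real.exp (-((u + s) ^ 2 / 2)) : ℝ) : ℂ) := by
      rw [Complex.ofReal_exp, Complex.ofReal_exp, ← Complex.exp_add, ← Complex.exp_add]
      congr 1
      push_cast
      ring
    simp only [hermiteFun_zero_apply, e]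
    push_cast
    ring
  rw [h3, h1, ← mul_assoc, Complex.ofReal_inv, inv_mul_cancel₀ hpi, one_mul]
  congr 1
  ring

theorem groundState_eq_superposition (hℓ : 0 < ℓ) (x : Plane) : groundState ℓ x =
    ((√(2 * Real.pi) * ℓ)⁻¹ : ℝ) * superposition (hermiteFun 0) (hermiteFun 0) ℓ x := by
  rw [groundState_apply hℓ, superposition, wigner_ground, ← Complex.exp_add, Complex.ofReal_mul,
    Complex.ofReal_exp]
  congr 2
  push_cast
  linear_combination (-(((x 1 : ℂ) / ℓ) ^ 2) / 4) * I_sq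

/-- Induction on `m` in the lowest level, then on `n`. The power of `I` collects the factor `I` of
`raiseK_superposition`. -/
theorem landauFun_eq_superposition (hℓ : 0 < ℓ) (n m : ℕ) (x : Plane) : landauFun ℓ (n, m) x =
    (((√(2 * Real.pi) * ℓ)⁻¹ : ℝ) * I ^ n) * superposition (hermiteFun m) (hermiteFun n) ℓ x := by
  have hr : ∀ n : ℕ, (√((n : ℝ) + 1) : ℂ)⁻¹ * √((n : ℝ) + 1) = 1 := fun n =>
    inv_mul_cancel₀ (sqrt_succ_ne_zero n)
  induction n generalizing x with
  | zero =>
    rw [pow_zero, mul_one]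
    change ladder (raiseG ℓ) (groundState ℓ) m x = _
    induction m generalizing x with
    | zero => exact groundState_eq_superposition hℓ x
    | succ m ih =>
      rw [ladder, smul_apply, raiseG_superposition hℓ ih, lineRaise_hermiteFun,
        superposition_smul_left, smul_eq_mul]
      linear_combination ((((√(2 * Real.pi) * ℓ)⁻¹ : ℝ) : ℂ) *
        superposition (hermiteFun (m + 1)) (hermiteFun 0) ℓ x) * hr m
  | succ n ih =>
    change ladder (raiseK ℓ) (landauFun ℓ (0, m)) (n + 1) x = _
    rw [ladder, smul_apply]
    change _ • raiseK ℓ (landauFun ℓ (n, m)) x = _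
    rw [raiseK_superposition hℓ ih, lineRaise_hermiteFun, superposition_smul_right, smul_eq_mul]
    linear_combination ((((√(2 * Real.pi) * ℓ)⁻¹ : ℝ) : ℂ) * I ^ (n + 1) *
        superposition (hermiteFun m) (hermiteFun (n + 1)) ℓ x) * hr n

end Superposition

/-! ### Generalised eigenfunctions and the matrix elements of `Π_j`. -/

section Coefficient

variable {ℓ : ℝ}

/-- The generalized eigenfunctions `e^{i uv/2} e^{i s v} h_j(u + s)`, `(u, v) = x / ℓ`, of the
Landau Hamiltonian. -/
def planarWave (ℓ : ℝ) (j : ℕ) (s : ℝ) (x : Plane) : ℂ :=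
  exp (I * ((x 0 / ℓ * (x 1 / ℓ) / 2 + s * (x 1 / ℓ) : ℝ) : ℂ)) * hermiteFun j (x 0 / ℓ + s)

/-- The coefficients `∫ conj(g_{j,s}) φ` of a function with respect to `planarWave`. -/
def waveCoeff (ℓ : ℝ) (j : ℕ) (φ : Plane → ℂ) (s : ℝ) : ℂ :=
  ∫ x, starRingEnd ℂ (planarWave ℓ j s x) * φ x

theorem superposition_hermiteFun (ℓ : ℝ) (n m : ℕ) (x : Plane) :
    superposition (hermiteFun m) (hermiteFun n) ℓ x =
      ∫ s : ℝ, hermiteFun m s * planarWave ℓ n s x := by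
  rw [superposition, wigner, ← integral_const_mul]
  refine integral_congr_ae (Eventually.of_forall fun s => ?_)
  simp only [planarWave]
  rw [Complex.ofReal_add, mul_add, Complex.exp_add]
  ring

/-- Continuous functions on the line with quadratic decay. -/
def decaying : Submodule ℂ (ℝ → ℂ) where
  carrier := {f | Continuous f ∧ ∃ C, ∀ t, ‖f t‖ ≤ C / (1 + t ^ 2)}
  add_mem' := by
    rintro f g ⟨hf, C, hC⟩ ⟨hg, D, hD⟩
    refine ⟨hf.add hg, C + D, fun t => ?_⟩
    rw [add_div]
    exact (norm_add_le _ _).trans (add_le_add (hC t) (hD t))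
  zero_mem' := ⟨continuous_const, 0, fun t => by simp⟩
  smul_mem' := by
    rintro c f ⟨hf, C, hC⟩
    refine ⟨hf.const_smul c, ‖c‖ * C, fun t => ?_⟩
    rw [Pi.smul_apply, norm_smul, mul_div_assoc]
    exact mul_le_mul_of_nonneg_left (hC t) (norm_nonneg _)

theorem schwartz_mem_decaying (f : 𝓢(ℝ, ℂ)) : (f : ℝ → ℂ) ∈ decaying := by
  obtain ⟨C, hC⟩ := schwartz_decay f 0
  obtain ⟨D, hD⟩ := schwartz_decay f 2
  refine ⟨f.continuous, C + D, fun t => ?_⟩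
  rw [le_div_iff₀ (by positivity)]
  have h1 := hC t
  have h2 := hD t
  rw [sq_abs] at h2
  linarith

theorem integrable_of_decay {f : ℝ → ℂ} (hf : Continuous f) {C : ℝ}
    (hC : ∀ t, ‖f t‖ ≤ C / (1 + t ^ 2)) : Integrable f := by
  refine (integrable_inv_one_add_sq.const_mul C).mono' hf.aestronglyMeasurable
    (Eventually.of_forall fun t => ?_)
  rw [← div_eq_mul_inv]
  exact hC t

theorem bounded_of_decay {f : ℝ → ℂ} {C : ℝ} (hC : ∀ t, ‖f t‖ ≤ C / (1 + t ^ 2)) (t : ℝ) :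
    ‖f t‖ ≤ C := by
  have h0 : 0 ≤ C := by
    have := (norm_nonneg _).trans (hC 0)
    simpa using this
  exact (hC t).trans (div_le_self h0 (by nlinarith [sq_nonneg t]))

theorem decaying_memLp {f : ℝ → ℂ} (hf : f ∈ decaying) : MemLp f 2 volume := by
  obtain ⟨hf, C, hC⟩ := hf
  rw [memLp_two_iff_integrable_sq_norm hf.aestronglyMeasurable]
  have h := (integrable_of_decay hf hC).norm.mul_bdd (c := C) hf.norm.aestronglyMeasurable
    (Eventually.of_forall fun t => by rw [norm_norm]; exact bounded_of_decay hC t)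
  exact h.congr (Eventually.of_forall fun t => by simp only [sq])

theorem continuous_planarWave (ℓ : ℝ) (j : ℕ) :
    Continuous (fun p : ℝ × Plane => planarWave ℓ j p.1 p.2) := by
  have hh : Continuous (hermiteFun j) := (hermiteFun j).continuous
  unfold planarWave
  fun_prop

theorem norm_planarWave (ℓ : ℝ) (j : ℕ) (s : ℝ) (x : Plane) :
    ‖planarWave ℓ j s x‖ = ‖hermiteFun j (x 0 / ℓ + s)‖ := by
  rw [planarWave, norm_mul, norm_exp_I_mul, one_mul]

/-- Quadratic decay is enough for square integrability and for absolute convergence of the Zak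
series. On the support of `φ` the shift `x 0 / ℓ` is bounded by `A`, and such a shift costs at most
a factor `2 (1 + A²)`. -/
theorem waveCoeff_mem_decaying (ℓ : ℝ) (j : ℕ) {φ : Plane → ℂ} (hφ : Continuous φ)
    (hc : HasCompactSupport φ) : waveCoeff ℓ j φ ∈ decaying := by
  have hint : Integrable φ := hφ.integrable_of_hasCompactSupport hc
  obtain ⟨-, C, hC⟩ := schwartz_mem_decaying (hermiteFun j)
  have hC0 : 0 ≤ C := (norm_nonneg _).trans (bounded_of_decay hC 0)
  refine ⟨?_, ?_⟩
  · refine continuous_of_dominated (bound := fun x => C * ‖φ x‖) (fun s => ?_) (fun s => ?_)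
      (hint.norm.const_mul C) ?_
    · have := continuous_planarWave ℓ j
      exact (by fun_prop : Continuous fun x =>
        starRingEnd ℂ (planarWave ℓ j s x) * φ x).aestronglyMeasurable
    · refine Eventually.of_forall fun x => ?_
      rw [norm_mul, RCLike.norm_conj, norm_planarWave]
      exact mul_le_mul_of_nonneg_right (bounded_of_decay hC _) (norm_nonneg _)
    · refine Eventually.of_forall fun x => ?_
      have := continuous_planarWave ℓ j
      fun_prop
  · obtain ⟨R, hR⟩ := hc.isCompact.isBounded.exists_norm_le
    set A := R / |ℓ|
    have hb : ∀ s x, ‖starRingEnd ℂ (planarWave ℓ j s x) * φ x‖ ≤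
        (2 * C * (1 + A ^ 2)) / (1 + s ^ 2) * ‖φ x‖ := fun s x => by
      by_cases hx : φ x = 0
      · simp [hx]
      have h1 : ‖x‖ ≤ R := hR x (subset_tsupport _ hx)
      have h2 : |x 0 / ℓ| ≤ A := by
        rw [abs_div, ← Real.norm_eq_abs]
        exact div_le_div_of_nonneg_right ((PiLp.norm_apply_le x 0).trans h1) (abs_nonneg _)
      have h3 : (x 0 / ℓ) ^ 2 ≤ A ^ 2 := sq_le_sq' (by linarith [neg_abs_le (x 0 / ℓ)])
        ((le_abs_self _).trans h2)
      rw [norm_mul, RCLike.norm_conj, norm_planarWave]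
      refine mul_le_mul_of_nonneg_right ((hC _).trans ?_) (norm_nonneg _)
      rw [div_le_div_iff₀ (by positivity) (by positivity)]
      have h4 : 1 + s ^ 2 ≤ 2 * (1 + A ^ 2) * (1 + (x 0 / ℓ + s) ^ 2) := by
        nlinarith [sq_nonneg (x 0 / ℓ + s + x 0 / ℓ), sq_nonneg (x 0 / ℓ + s), sq_nonneg A,
          mul_nonneg (sq_nonneg A) (sq_nonneg (x 0 / ℓ + s))]
      calc C * (1 + s ^ 2) ≤ C * (2 * (1 + A ^ 2) * (1 + (x 0 / ℓ + s) ^ 2)) :=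
            mul_le_mul_of_nonneg_left h4 hC0
        _ = _ := by ring
    refine ⟨(2 * C * (1 + A ^ 2)) * ∫ x, ‖φ x‖, fun s => ?_⟩
    refine (norm_integral_le_of_norm_le (hint.norm.const_mul _)
      (Eventually.of_forall (hb s))).trans (le_of_eq ?_)
    rw [integral_const_mul]
    ring

/-- Fubini in the integral representation. Up to a constant, the coefficients of `φ` in the level
`n` are the Hermite coefficients of one function on the line, so the sum over `m` becomes Parseval's
identity in `L²(ℝ)`. -/
theorem inner_landauFun_eq (hℓ : 0 < ℓ) (n m : ℕ) {φ : Plane → ℂ} (hφ : Continuous φ)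
    (hc : HasCompactSupport φ) :
    ∫ x, starRingEnd ℂ (landauFun ℓ (n, m) x) * φ x =
      (((√(2 * Real.pi) * ℓ)⁻¹ : ℝ) * (-I) ^ n) *
        ∫ s, starRingEnd ℂ (hermiteFun m s) * waveCoeff ℓ n φ s := by
  have hint : Integrable φ := hφ.integrable_of_hasCompactSupport hc
  obtain ⟨C, hC⟩ := schwartz_bounded (hermiteFun n)
  have hw := continuous_planarWave ℓ n
  have hh : Continuous (hermiteFun m) := (hermiteFun m).continuous
  have e1 : ∀ x, starRingEnd ℂ (landauFun ℓ (n, m) x) * φ x =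
      (((√(2 * Real.pi) * ℓ)⁻¹ : ℝ) * (-I) ^ n) *
        ∫ s, starRingEnd ℂ (hermiteFun m s) * (starRingEnd ℂ (planarWave ℓ n s x) * φ x) := fun x => by
    rw [landauFun_eq_superposition hℓ, superposition_hermiteFun, map_mul, map_mul, map_pow,
      Complex.conj_I, Complex.conj_ofReal, ← integral_conj, mul_assoc, ← integral_mul_const]
    simp only [map_mul, mul_assoc]
  simp only [e1]
  rw [integral_const_mul, integral_integral_swap]
  · simp only [integral_const_mul, waveCoeff]
  · have hp : Integrable (fun p : Plane × ℝ => φ p.1 * hermiteFun m p.2)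
      ((volume : Measure Plane).prod volume) := hint.mul_prod (hermiteFun m).integrable
    refine (hp.norm.mul_const C).mono' ?_ (Eventually.of_forall fun p => ?_)
    · refine Continuous.aestronglyMeasurable ?_
      unfold Function.uncurry
      fun_prop
    · simp only [Function.uncurry, norm_mul, RCLike.norm_conj, norm_planarWave]
      calc _ = ‖φ p.1‖ * ‖hermiteFun m p.2‖ * ‖hermiteFun n (p.1 0 / ℓ + p.2)‖ := by ring
        _ ≤ _ := mul_le_mul_of_nonneg_left (hC _) (by positivity)

theorem toL2_of_memLp {μ : Measure Plane} {f : Plane → ℂ} (hf : MemLp f 2 μ) :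
    toL2 μ f = hf.toLp f := by
  rw [toL2, dif_pos hf]

theorem toL2_coeFn {μ : Measure Plane} {f : Plane → ℂ} (hf : MemLp f 2 μ) : toL2 μ f =ᵐ[μ] f := by
  rw [toL2_of_memLp hf]
  exact hf.coeFn_toLp

theorem inner_landauBasis_toL2 (hℓ : 0 < ℓ) (p : ℕ × ℕ) {φ : Plane → ℂ} (hφ : MemLp φ 2 volume) :
    inner ℂ (landauBasis hℓ p) (toL2 volume φ) =
      ∫ x, starRingEnd ℂ (landauFun ℓ p x) * φ x := by
  rw [landauBasis_apply, inner_schwartzIncl_left]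
  refine integral_congr_ae ?_
  filter_upwards [toL2_coeFn hφ] with x hx
  rw [hx]

/-- The matrix elements of the Landau projections. -/
theorem inner_landauProjection_toL2 {ε : ℝ} (hε : 0 < ε) (hℓ : 0 < ℓ) (j : ℕ) {φ ψ : Plane → ℂ}
    (hφ : Continuous φ) (hφc : HasCompactSupport φ) (hψ : Continuous ψ)
    (hψc : HasCompactSupport ψ) :
    inner ℂ (toL2 volume φ) (landauProjection ε ℓ j (toL2 volume ψ)) =
      ((2 * Real.pi * ℓ ^ 2 : ℝ) : ℂ)⁻¹ *
        ∫ s, starRingEnd ℂ (waveCoeff ℓ j φ s) * waveCoeff ℓ j ψ s := by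
  have hc : ∀ {χ : Plane → ℂ} (h1 : Continuous χ) (h2 : HasCompactSupport χ), ∀ m,
      inner ℂ (landauBasis hℓ (j, m)) (toL2 volume χ) =
        (((√(2 * Real.pi) * ℓ)⁻¹ : ℝ) * (-I) ^ j) * inner ℂ (hermiteBasis m)
          ((decaying_memLp (waveCoeff_mem_decaying ℓ j h1 h2)).toLp (waveCoeff ℓ j χ)) := by
    intro χ h1 h2 m
    rw [inner_landauBasis_toL2 hℓ _ (h1.memLp_of_hasCompactSupport h2), inner_landauFun_eq hℓ j m h1 h2,
      hermiteBasis_apply, inner_lineIncl_left]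
    congr 1
    refine integral_congr_ae ?_
    filter_upwards [(decaying_memLp (waveCoeff_mem_decaying ℓ j h1 h2)).coeFn_toLp] with s hs
    rw [hs]
  set Fφ := (decaying_memLp (waveCoeff_mem_decaying ℓ j hφ hφc)).toLp (waveCoeff ℓ j φ) with hF
  set Fψ := (decaying_memLp (waveCoeff_mem_decaying ℓ j hψ hψc)).toLp (waveCoeff ℓ j ψ) with hG
  have h1 : inner ℂ Fφ Fψ = ∫ s, starRingEnd ℂ (waveCoeff ℓ j φ s) * waveCoeff ℓ j ψ s := by
    rw [L2.inner_def]
    refine integral_congr_ae ?_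
    filter_upwards [(decaying_memLp (waveCoeff_mem_decaying ℓ j hφ hφc)).coeFn_toLp,
      (decaying_memLp (waveCoeff_mem_decaying ℓ j hψ hψc)).coeFn_toLp] with s h1 h2
    rw [RCLike.inner_apply, h1, h2, mul_comm]
  have h2 := (hermiteBasis.hasSum_inner_mul_inner Fφ Fψ).mul_left ((2 * Real.pi * ℓ ^ 2 : ℝ) : ℂ)⁻¹
  rw [← h1]
  refine HasSum.unique ?_ h2
  have h3 := (isTransfer_landauProjection hε hℓ j).inner_right (toL2 volume ψ) (toL2 volume φ)
  have hinj : Function.Injective (fun m : ℕ => ((j, m) : ℕ × ℕ)) := fun m m' h => by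
    simpa using h
  -- Only the indices `(j, m)` contribute, so the sum over pairs becomes a sum over `m`.
  rw [← hinj.hasSum_iff] at h3
  · refine (congrArg (HasSum · _) (funext fun m => ?_)).mp h3
    have hr : ((√(2 * Real.pi) * ℓ)⁻¹ : ℝ) * ((√(2 * Real.pi) * ℓ)⁻¹ : ℝ) =
        (2 * Real.pi * ℓ ^ 2)⁻¹ := by
      rw [← mul_inv, mul_mul_mul_comm, Real.mul_self_sqrt (by positivity), sq]
    have hI : (I : ℂ) ^ j * (-I) ^ j = 1 := by
      rw [← mul_pow, mul_neg, I_mul_I, neg_neg, one_pow]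
    change (if j = j then (1 : ℂ) else 0) * _ * _ = _
    rw [if_pos rfl, one_mul, ← inner_conj_symm (toL2 volume φ), hc hφ hφc, hc hψ hψc, map_mul, inner_conj_symm, map_mul,
      map_pow, map_neg, Complex.conj_I, neg_neg, Complex.conj_ofReal, ← Complex.ofReal_inv, ← hr,
      Complex.ofReal_mul]
    linear_combination ((((√(2 * Real.pi) * ℓ)⁻¹ : ℝ) : ℂ) * (((√(2 * Real.pi) * ℓ)⁻¹ : ℝ) : ℂ) *
      inner ℂ Fφ (hermiteBasis m) * inner ℂ (hermiteBasis m) Fψ) * hI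
  · rintro ⟨n, m⟩ hp
    have : n ≠ j := fun h => hp ⟨m, by rw [h]⟩
    simp [this]

end Coefficient

/-! ### The Zak transform and its Plancherel formula. -/

section Zak

/-- The period `√(2π)`. -/
def side : ℝ := √(2 * Real.pi)

theorem side_pos : 0 < side := Real.sqrt_pos.2 (by positivity)

theorem side_mul_self : side * side = 2 * Real.pi := Real.mul_self_sqrt (by positivity)

theorem one_le_side_sq : 1 ≤ side ^ 2 := by
  rw [sq, side_mul_self]
  linarith [Real.pi_gt_three]

/-- The character `e^{i q n t}`, `q = √(2π)`. -/
def character (n : ℤ) (t : ℝ) : ℂ := exp (I * ((side * n * t : ℝ) : ℂ))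

theorem norm_character (n : ℤ) (t : ℝ) : ‖character n t‖ = 1 := norm_exp_I_mul _

theorem continuous_character (n : ℤ) : Continuous (character n) := by
  unfold character
  fun_prop

theorem conj_character (n : ℤ) (t : ℝ) : starRingEnd ℂ (character n t) = character (-n) t := by
  rw [character, character, ← Complex.exp_conj, map_mul, Complex.conj_I, Complex.conj_ofReal]
  push_cast
  ring_nf

theorem character_add (n m : ℤ) (t : ℝ) : character (n + m) t = character n t * character m t := by
  rw [character, character, character, ← Complex.exp_add]
  push_cast
  ring_nf

theorem character_add_right (n : ℤ) (s t : ℝ) :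
    character n (s + t) = character n s * character n t := by
  rw [character, character, character, ← Complex.exp_add]
  push_cast
  ring_nf

/-- Since `side² = 2π`, the same number is the period and the frequency. -/
theorem character_side (n m : ℤ) : character n (side * m) = 1 := by
  rw [character, show side * n * (side * m) = (side * side) * (n * m) by ring, side_mul_self,
    ← Complex.exp_int_mul_two_pi_mul_I (n * m)]
  push_cast
  ring_nf

theorem integral_character (n : ℤ) :
    ∫ t in (0 : ℝ)..side, character n t = if n = 0 then (side : ℂ) else 0 := by
  split_ifs with h
  · subst h
    simp [character]
  · have h1 : (I * (side * n) : ℂ) ≠ 0 := by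
      refine mul_ne_zero I_ne_zero (mul_ne_zero ?_ (by exact_mod_cast h))
      exact_mod_cast side_pos.ne'
    have h2 : ∀ t : ℝ, character n t = exp ((I * (side * n) : ℂ) * t) := fun t => by
      rw [character]
      push_cast
      ring_nf
    have h3 := character_side n 1
    rw [h2] at h3
    simp only [h2]
    rw [integral_exp_mul_complex h1]
    push_cast at h3
    rw [mul_one] at h3
    rw [h3]
    simp

theorem summable_inv_one_add_side_sq : Summable (fun n : ℤ => 1 / (1 + (side * n) ^ 2 : ℝ)) := by
  -- At `n = 0` the comparison term is `1 / 0 = 0`, so the bound is only claimed outside a finite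
  -- set.
  refine Summable.of_norm_bounded_eventually (g := fun n : ℤ => 1 / (n : ℝ) ^ 2)
    (Real.summable_one_div_int_pow.2 one_lt_two) ?_
  refine (Set.finite_singleton (0 : ℤ)).subset fun n hn => ?_
  by_contra h0
  refine hn ?_
  have h1 : (0 : ℝ) < (n : ℝ) ^ 2 := by
    have : (n : ℝ) ≠ 0 := by exact_mod_cast h0
    positivity
  change ‖1 / (1 + (side * n) ^ 2 : ℝ)‖ ≤ 1 / (n : ℝ) ^ 2
  rw [Real.norm_of_nonneg (by positivity)]
  refine one_div_le_one_div_of_le h1 ?_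
  rw [mul_pow]
  nlinarith [one_le_side_sq]

/-- Peetre's inequality `1 + t² ≤ 2 (1 + a²) (1 + (a + t)²)`. -/
theorem decay_translate {f : ℝ → ℂ} {C : ℝ} (hC : ∀ t, ‖f t‖ ≤ C / (1 + t ^ 2)) {A a : ℝ}
    (ha : |a| ≤ A) (t : ℝ) : ‖f (a + t)‖ ≤ 2 * C * (1 + A ^ 2) / (1 + t ^ 2) := by
  have hC0 : 0 ≤ C := (norm_nonneg _).trans (bounded_of_decay hC 0)
  have h3 : a ^ 2 ≤ A ^ 2 := sq_le_sq' (by linarith [neg_abs_le a]) ((le_abs_self _).trans ha)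
  refine (hC _).trans ?_
  rw [div_le_div_iff₀ (by positivity) (by positivity)]
  have h4 : 1 + t ^ 2 ≤ 2 * (1 + A ^ 2) * (1 + (a + t) ^ 2) := by
    nlinarith [sq_nonneg (a + t + a), sq_nonneg (a + t), sq_nonneg A,
      mul_nonneg (sq_nonneg A) (sq_nonneg (a + t))]
  calc C * (1 + t ^ 2) ≤ C * (2 * (1 + A ^ 2) * (1 + (a + t) ^ 2)) :=
        mul_le_mul_of_nonneg_left h4 hC0
    _ = _ := by ring

/-- The Zak transform `∑ n, f(s + q n) e^{i q n t}`. -/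
def zak (f : ℝ → ℂ) (s t : ℝ) : ℂ := ∑' n : ℤ, f (s + side * n) * character n t

theorem exists_translate_bound {f : ℝ → ℂ} (hf : f ∈ decaying) (A : ℝ) :
    ∃ b : ℤ → ℝ, Summable b ∧ ∀ (n : ℤ) (s : ℝ), |s| ≤ A → ‖f (s + side * n)‖ ≤ b n := by
  obtain ⟨-, C, hC⟩ := hf
  refine ⟨fun n => 2 * C * (1 + A ^ 2) * (1 / (1 + (side * n) ^ 2)),
    summable_inv_one_add_side_sq.mul_left _, fun n s hs => ?_⟩
  beta_reduce
  rw [mul_one_div]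
  exact decay_translate hC hs _

variable {f g : ℝ → ℂ}

theorem summable_translate (hf : f ∈ decaying) (s : ℝ) :
    Summable (fun n : ℤ => ‖f (s + side * n)‖) := by
  obtain ⟨b, hb, h⟩ := exists_translate_bound hf |s|
  exact Summable.of_nonneg_of_le (fun n => norm_nonneg _) (fun n => h n s le_rfl) hb

theorem summable_zak (hf : f ∈ decaying) (s t : ℝ) :
    Summable (fun n : ℤ => f (s + side * n) * character n t) := by
  refine Summable.of_norm ((summable_translate hf s).congr fun n => ?_)
  rw [norm_mul, norm_character, mul_one]

theorem continuous_zak (hf : f ∈ decaying) : Continuous (fun p : ℝ × ℝ => zak f p.1 p.2) := by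
  rw [continuous_iff_continuousAt]
  intro p
  obtain ⟨b, hb, h⟩ := exists_translate_bound hf (|p.1| + 1)
  have hc : Continuous f := hf.1
  have ho : ContinuousOn (fun p : ℝ × ℝ => zak f p.1 p.2) {p' | |p'.1| < |p.1| + 1} := by
    refine continuousOn_tsum (u := b) (fun n => ?_) hb fun n p' hp' => ?_
    · have := continuous_character n
      exact Continuous.continuousOn (by fun_prop)
    · rw [norm_mul, norm_character, mul_one]
      exact h n _ hp'.le
  refine ho.continuousAt (IsOpen.mem_nhds ?_ ?_)
  · exact isOpen_lt (by fun_prop) continuous_const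
  · change |p.1| < |p.1| + 1
    linarith

theorem zak_add (hf : f ∈ decaying) (hg : g ∈ decaying) (s t : ℝ) :
    zak (f + g) s t = zak f s t + zak g s t := by
  rw [zak, zak, zak, ← (summable_zak hf s t).tsum_add (summable_zak hg s t)]
  simp only [Pi.add_apply, add_mul]

theorem zak_smul (c : ℂ) (f : ℝ → ℂ) (s t : ℝ) : zak (c • f) s t = c * zak f s t := by
  rw [zak, zak, ← tsum_mul_left]
  simp only [Pi.smul_apply, smul_eq_mul, mul_assoc]

theorem zak_add_side (f : ℝ → ℂ) (s t : ℝ) (m n : ℤ) :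
    zak f (s + side * m) (t + side * n) = character (-m) t * zak f s t := by
  rw [zak, zak, ← tsum_mul_left, ← (Equiv.subRight m).tsum_eq]
  refine tsum_congr fun k => ?_
  rw [Equiv.subRight_apply, character_add_right, character_side, mul_one, sub_eq_add_neg,
    character_add]
  push_cast
  ring_nf

/-- Parseval for absolutely convergent Fourier series: one series is expanded at a time, and
dominated convergence exchanges sum and integral. -/
theorem integral_conj_fourier_mul {a b : ℤ → ℂ} (ha : Summable fun n => ‖a n‖)
    (hb : Summable fun n => ‖b n‖) :
    ∫ t in (0 : ℝ)..side, starRingEnd ℂ (∑' n, a n * character n t) * ∑' n, b n * character n t =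
      side * ∑' n, starRingEnd ℂ (a n) * b n := by
  have hs : ∀ {c : ℤ → ℂ}, (Summable fun n => ‖c n‖) → ∀ t,
      Summable fun n => c n * character n t := fun hc t =>
    Summable.of_norm (hc.congr fun n => by rw [norm_mul, norm_character, mul_one])
  have hbd : ∀ t, ‖∑' n, b n * character n t‖ ≤ ∑' n, ‖b n‖ := fun t => by
    refine (norm_tsum_le_tsum_norm ((hs hb t).norm)).trans (le_of_eq ?_)
    simp only [norm_mul, norm_character, mul_one]
  have hbc : Continuous fun t => ∑' n, b n * character n t := by
    refine continuous_tsum (fun n => (continuous_character n).const_mul _) hb fun n t => ?_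
    rw [norm_mul, norm_character, mul_one]
  have h1 : ∀ n, ∫ t in (0 : ℝ)..side, character (-n) t * ∑' m, b m * character m t =
      side * b n := fun n => by
    have h := intervalIntegral.hasSum_integral_of_dominated_convergence (a := 0) (b := side)
      (μ := volume) (F := fun m t => character (-n) t * (b m * character m t))
      (f := fun t => character (-n) t * ∑' m, b m * character m t)
      (fun m _ => ‖b m‖) (fun m => ?_) (fun m => ?_) (Eventually.of_forall fun t _ => hb)
      intervalIntegrable_const (Eventually.of_forall fun t _ => (hs hb t).hasSum.mul_left _)
    · have h2 : ∀ m, ∫ t in (0 : ℝ)..side, character (-n) t * (b m * character m t) =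
          if m = n then side * b n else 0 := fun m => by
        have : ∀ t, character (-n) t * (b m * character m t) = b m * character (-n + m) t :=
          fun t => by
            rw [character_add]
            ring
        simp only [this]
        rw [intervalIntegral.integral_const_mul, integral_character]
        by_cases hm : m = n
        · subst hm
          simp [mul_comm]
        · rw [if_neg hm, if_neg (by omega), mul_zero]
      simp only [h2] at h
      exact h.unique (hasSum_ite_eq n _)
    · exact ((continuous_character _).mul
        ((continuous_character m).const_mul _)).aestronglyMeasurable
    · refine Eventually.of_forall fun t _ => ?_
      rw [norm_mul, norm_mul, norm_character, norm_character, one_mul, mul_one]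
  have h := intervalIntegral.hasSum_integral_of_dominated_convergence (a := 0) (b := side)
    (μ := volume)
    (F := fun n t => starRingEnd ℂ (a n * character n t) * ∑' m, b m * character m t)
    (f := fun t => starRingEnd ℂ (∑' n, a n * character n t) * ∑' m, b m * character m t)
    (fun n _ => ‖a n‖ * ∑' m, ‖b m‖) (fun n => ?_) (fun n => ?_)
    (Eventually.of_forall fun t _ => ha.mul_right _)
    intervalIntegrable_const (Eventually.of_forall fun t _ =>
      ((Complex.hasSum_conj'.2 (by simpa using (hs ha t).hasSum))).mul_right _)
  · rw [← h.tsum_eq, ← tsum_mul_left]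
    refine tsum_congr fun n => ?_
    have : ∀ t, starRingEnd ℂ (a n * character n t) * ∑' m, b m * character m t =
        starRingEnd ℂ (a n) * (character (-n) t * ∑' m, b m * character m t) := fun t => by
      rw [map_mul, conj_character, mul_assoc]
    simp only [this]
    rw [intervalIntegral.integral_const_mul, h1]
    ring
  · exact ((Complex.continuous_conj.comp ((continuous_character n).const_mul _)).mul
      hbc).aestronglyMeasurable
  · refine Eventually.of_forall fun t _ => ?_
    rw [norm_mul, RCLike.norm_conj, norm_mul, norm_character, mul_one]
    exact mul_le_mul_of_nonneg_left (hbd t) (norm_nonneg _)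

theorem hasSum_integral_translate {F : ℝ → ℂ} (hF : Integrable F) :
    HasSum (fun n : ℤ => ∫ s in (0 : ℝ)..side, F (s + side * n)) (∫ s, F s) := by
  have h := ((hF.comp_mul_left' side_pos.ne').hasSum_intervalIntegral_comp_add_int).mul_left
    (side : ℂ)
  rw [Measure.integral_comp_mul_left] at h
  have hq : (side : ℂ) ≠ 0 := by exact_mod_cast side_pos.ne'
  have e : (side : ℂ) * |side⁻¹| • ∫ s, F s = ∫ s, F s := by
    rw [abs_of_pos (inv_pos.2 side_pos), Complex.real_smul, Complex.ofReal_inv, ← mul_assoc,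
      mul_inv_cancel₀ hq, one_mul]
  rw [e] at h
  refine (congrArg (HasSum · _) (funext fun n => ?_)).mp h
  have h1 := intervalIntegral.integral_comp_mul_add (a := 0) (b := 1) F side_pos.ne' (side * n)
  simp only [mul_add, h1, Complex.real_smul, Complex.ofReal_inv, mul_zero, zero_add, mul_one]
  rw [← mul_assoc, mul_inv_cancel₀ hq, one_mul, intervalIntegral.integral_comp_add_right, zero_add]

/-- Parseval in `t` leaves a sum over translates, and integrating that sum over one period in `s`
gives the integral over the line. -/
theorem integral_conj_zak_mul (hf : f ∈ decaying) (hg : g ∈ decaying) :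
    ∫ s in (0 : ℝ)..side, ∫ t in (0 : ℝ)..side, starRingEnd ℂ (zak f s t) * zak g s t =
      side * ∫ s, starRingEnd ℂ (f s) * g s := by
  have h1 : ∀ s, ∫ t in (0 : ℝ)..side, starRingEnd ℂ (zak f s t) * zak g s t =
      side * ∑' n : ℤ, starRingEnd ℂ (f (s + side * n)) * g (s + side * n) := fun s =>
    integral_conj_fourier_mul (summable_translate hf s) (summable_translate hg s)
  simp only [h1]
  rw [intervalIntegral.integral_const_mul]
  congr 1
  have hfc : Continuous f := hf.1
  have hgc : Continuous g := hg.1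
  obtain ⟨D, hD⟩ := hg.2
  have hgb : ∀ t, ‖g t‖ ≤ D := bounded_of_decay hD
  obtain ⟨b, hb, hfb⟩ := exists_translate_bound hf side
  have hint : Integrable fun s => starRingEnd ℂ (f s) * g s := by
    obtain ⟨C, hC⟩ := hf.2
    refine Integrable.mul_bdd (c := D) ?_ hgc.aestronglyMeasurable (Eventually.of_forall hgb)
    exact (integrable_of_decay (C := C) (Complex.continuous_conj.comp hfc) fun t => by
      rw [RCLike.norm_conj]
      exact hC t)
  have hbound : ∀ s ∈ Set.uIoc 0 side, ∀ n : ℤ,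
      ‖starRingEnd ℂ (f (s + side * n)) * g (s + side * n)‖ ≤ b n * D := fun s hs n => by
    rw [Set.uIoc_of_le side_pos.le] at hs
    rw [norm_mul, RCLike.norm_conj]
    have h2 := hfb n s (by rw [abs_of_pos hs.1]; exact hs.2)
    exact mul_le_mul h2 (hgb _) (norm_nonneg _) ((norm_nonneg _).trans h2)
  refine HasSum.unique (intervalIntegral.hasSum_integral_of_dominated_convergence
    (F := fun (n : ℤ) s => starRingEnd ℂ (f (s + side * n)) * g (s + side * n))
    (fun n _ => b n * D) (fun n => ?_) (fun n => Eventually.of_forall fun s hs => hbound s hs n)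
    (Eventually.of_forall fun s _ => hb.mul_right _) intervalIntegrable_const
    (Eventually.of_forall fun s hs => ?_)) (hasSum_integral_translate hint)
  · exact Continuous.aestronglyMeasurable (by fun_prop)
  · exact (Summable.of_norm_bounded (hb.mul_right D) (hbound s hs)).hasSum

end Zak

/-! ### Integrals over squares as iterated integrals. -/

section Square

theorem isCompact_square (a : ℝ) : IsCompact {y : Plane | ∀ i, y i ∈ Set.Icc 0 a} := by
  have h : {y : Plane | ∀ i, y i ∈ Set.Icc 0 a} =
      (PiLp.homeomorph 2 (fun _ : Fin 2 => ℝ)) ⁻¹' Set.univ.pi fun _ => Set.Icc 0 a := by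
    ext y
    simp only [Set.mem_ofPred_eq, Set.mem_preimage, Set.mem_univ_pi]
    rfl
  rw [h]
  exact (Homeomorph.isCompact_preimage _).2 (isCompact_univ_pi fun _ => isCompact_Icc)

theorem setIntegral_square {F : ℝ → ℝ → ℂ} (hF : Continuous fun p : ℝ × ℝ => F p.1 p.2) {a : ℝ}
    (ha : 0 ≤ a) : ∫ x in {y : Plane | ∀ i, y i ∈ Set.Icc 0 a}, F (x 0) (x 1) =
      ∫ s in (0 : ℝ)..a, ∫ t in (0 : ℝ)..a, F s t := by
  have hp : MeasurePreserving (fun x : Plane => (x 0, x 1)) volume volume :=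
    (volume_preserving_finTwoArrow ℝ).comp (PiLp.volume_preserving_ofLp (Fin 2))
  have he : MeasurableEmbedding (fun x : Plane => (x 0, x 1)) :=
    ((MeasurableEquiv.toLp 2 (Fin 2 → ℝ)).symm.trans
      MeasurableEquiv.finTwoArrow).measurableEmbedding
  have h := hp.setIntegral_preimage_emb he (fun p : ℝ × ℝ => F p.1 p.2)
    (Set.Icc 0 a ×ˢ Set.Icc 0 a)
  have hs : {y : Plane | ∀ i, y i ∈ Set.Icc 0 a} =
      (fun x : Plane => (x 0, x 1)) ⁻¹' (Set.Icc 0 a ×ˢ Set.Icc 0 a) := by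
    ext y
    simp only [Set.mem_ofPred_eq, Fin.forall_fin_two, Set.mem_preimage, Set.mem_prod]
  rw [hs, h, Measure.volume_eq_prod, setIntegral_prod _
    (hF.continuousOn.integrableOn_compact (isCompact_Icc.prod isCompact_Icc)),
    integral_Icc_eq_integral_Ioc, intervalIntegral.integral_of_le ha]
  refine integral_congr_ae (Eventually.of_forall fun s => ?_)
  simp only
  rw [integral_Icc_eq_integral_Ioc, intervalIntegral.integral_of_le ha]

theorem setIntegral_square_div {F : ℝ → ℝ → ℂ} (hF : Continuous fun p : ℝ × ℝ => F p.1 p.2)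
    {a r : ℝ} (ha : 0 ≤ a) (hr : 0 < r) :
    ∫ x in {y : Plane | ∀ i, y i ∈ Set.Icc 0 (a * r)}, F (x 0 / r) (x 1 / r) =
      (r : ℂ) ^ 2 * ∫ s in (0 : ℝ)..a, ∫ t in (0 : ℝ)..a, F s t := by
  have h := setIntegral_square (F := fun s t => F (s / r) (t / r)) (by fun_prop)
    (mul_nonneg ha hr.le)
  rw [h]
  have h1 : ∀ s, ∫ t in (0 : ℝ)..a * r, F (s / r) (t / r) = r * ∫ t in (0 : ℝ)..a, F (s / r) t :=
    fun s => by
      rw [intervalIntegral.integral_comp_div (fun t => F (s / r) t) hr.ne', zero_div,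
        mul_div_cancel_right₀ _ hr.ne', Complex.real_smul]
  simp only [h1]
  rw [intervalIntegral.integral_const_mul, intervalIntegral.integral_comp_div
    (fun s => ∫ t in (0 : ℝ)..a, F s t) hr.ne', zero_div, mul_div_cancel_right₀ _ hr.ne',
    Complex.real_smul]
  ring

end Square

/-! ### The Zak transform as an isometry into the fiber `L²(Y_B)`. -/

section FiberMap

variable {ℓ : ℝ} {f g : ℝ → ℂ}

theorem isCompact_unitCell (ℓ : ℝ) : IsCompact (unitCell ℓ) := isCompact_square _

theorem isCompact_brillouinCell (ℓ : ℝ) : IsCompact (brillouinCell ℓ) := isCompact_square _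

instance (ℓ : ℝ) : IsFiniteMeasure ((volume : Measure Plane).restrict (unitCell ℓ)) :=
  ⟨by
    rw [Measure.restrict_apply_univ]
    exact (isCompact_unitCell ℓ).measure_lt_top⟩

theorem memLp_unitCell {F : Plane → ℂ} (hF : Continuous F) :
    MemLp F 2 ((volume : Measure Plane).restrict (unitCell ℓ)) := by
  obtain ⟨C, hC⟩ := (isCompact_unitCell ℓ).exists_bound_of_continuousOn hF.continuousOn
  exact MemLp.of_bound hF.aestronglyMeasurable C
    ((ae_restrict_iff' (isCompact_unitCell ℓ).measurableSet).2 (Eventually.of_forall hC))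

theorem inner_toL2 {μ : Measure Plane} {F G : Plane → ℂ} (hF : MemLp F 2 μ) (hG : MemLp G 2 μ) :
    inner ℂ (toL2 μ F) (toL2 μ G) = ∫ y, starRingEnd ℂ (F y) * G y ∂μ := by
  rw [L2.inner_def]
  refine integral_congr_ae ?_
  filter_upwards [toL2_coeFn hF, toL2_coeFn hG] with y h1 h2
  rw [RCLike.inner_apply, h1, h2, mul_comm]

theorem toL2_congr {μ : Measure Plane} {F G : Plane → ℂ} (hG : MemLp G 2 μ) (h : F =ᵐ[μ] G) :
    toL2 μ F = toL2 μ G := by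
  refine Lp.ext ?_
  exact ((toL2_coeFn (hG.ae_eq h.symm)).trans h).trans (toL2_coeFn hG).symm

/-- The quasi-periodic function on the plane associated with the Zak transform. -/
def zakFun (ℓ : ℝ) (f : ℝ → ℂ) (y : Plane) : ℂ :=
  ((ℓ * √side)⁻¹ : ℝ) *
    (exp (I * ((y 0 / ℓ * (y 1 / ℓ) / 2 : ℝ) : ℂ)) * zak f (y 0 / ℓ) (y 1 / ℓ))

/-- The Zak transform as a map into the fiber space. -/
def zakFiber (ℓ : ℝ) (f : ℝ → ℂ) : Fiber ℓ := toL2 _ (zakFun ℓ f)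

theorem continuous_zakFun (ℓ : ℝ) (hf : f ∈ decaying) : Continuous (zakFun ℓ f) := by
  have := continuous_zak hf
  unfold zakFun
  have h2 : Continuous fun y : Plane => zak f (y 0 / ℓ) (y 1 / ℓ) :=
    this.comp (g := fun p : ℝ × ℝ => zak f p.1 p.2) (f := fun y : Plane => (y 0 / ℓ, y 1 / ℓ))
      (by fun_prop)
  fun_prop

/-- The gauge phases cancel. The squared normalisation `1 / (ℓ² side)` offsets the area factor `ℓ²`
of the rescaled cell and the factor `side` of the Plancherel formula. -/
theorem inner_zakFiber (hℓ : 0 < ℓ) (hf : f ∈ decaying) (hg : g ∈ decaying) :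
    inner ℂ (zakFiber ℓ f) (zakFiber ℓ g) = ∫ s, starRingEnd ℂ (f s) * g s := by
  rw [zakFiber, zakFiber, inner_toL2 (memLp_unitCell (continuous_zakFun ℓ hf))
    (memLp_unitCell (continuous_zakFun ℓ hg))]
  have e : ∀ y : Plane, starRingEnd ℂ (zakFun ℓ f y) * zakFun ℓ g y =
      ((ℓ ^ 2 * side)⁻¹ : ℝ) *
        (starRingEnd ℂ (zak f (y 0 / ℓ) (y 1 / ℓ)) * zak g (y 0 / ℓ) (y 1 / ℓ)) := fun y => by
    have h1 : starRingEnd ℂ (exp (I * ((y 0 / ℓ * (y 1 / ℓ) / 2 : ℝ) : ℂ))) *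
        exp (I * ((y 0 / ℓ * (y 1 / ℓ) / 2 : ℝ) : ℂ)) = 1 := by
      rw [Complex.conj_mul', norm_exp_I_mul]
      simp
    have h2 : ((ℓ ^ 2 * side)⁻¹ : ℝ) = (ℓ * √side)⁻¹ * (ℓ * √side)⁻¹ := by
      rw [← mul_inv, mul_mul_mul_comm, Real.mul_self_sqrt side_pos.le, sq]
    rw [zakFun, zakFun, map_mul, map_mul, Complex.conj_ofReal, h2, Complex.ofReal_mul]
    linear_combination ((((ℓ * √side)⁻¹ : ℝ) : ℂ) * (((ℓ * √side)⁻¹ : ℝ) : ℂ) *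
      (starRingEnd ℂ (zak f (y 0 / ℓ) (y 1 / ℓ)) * zak g (y 0 / ℓ) (y 1 / ℓ))) * h1
  simp only [e]
  rw [integral_const_mul]
  have hfz := continuous_zak hf
  have hgz := continuous_zak hg
  have h3 := setIntegral_square_div
    (F := fun s t => starRingEnd ℂ (zak f s t) * zak g s t) (by fun_prop) side_pos.le hℓ
  rw [integral_conj_zak_mul hf hg] at h3
  have h4 : unitCell ℓ = {y : Plane | ∀ i, y i ∈ Set.Icc 0 (side * ℓ)} := rfl
  rw [h4, h3, ← mul_assoc, ← mul_assoc]
  have h5 : (((ℓ ^ 2 * side)⁻¹ : ℝ) : ℂ) * (ℓ : ℂ) ^ 2 * side = 1 := by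
    rw [← Complex.ofReal_pow, ← Complex.ofReal_mul, ← Complex.ofReal_mul, mul_assoc,
      inv_mul_cancel₀ (mul_pos (by positivity) side_pos).ne', Complex.ofReal_one]
  rw [h5, one_mul]

theorem toL2_add {μ : Measure Plane} {F G : Plane → ℂ} (hF : MemLp F 2 μ) (hG : MemLp G 2 μ) :
    toL2 μ (F + G) = toL2 μ F + toL2 μ G := by
  rw [toL2_of_memLp hF, toL2_of_memLp hG, toL2_of_memLp (hF.add hG)]
  exact MemLp.toLp_add hF hG

theorem toL2_smul {μ : Measure Plane} {F : Plane → ℂ} (hF : MemLp F 2 μ) (c : ℂ) :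
    toL2 μ (c • F) = c • toL2 μ F := by
  rw [toL2_of_memLp hF, toL2_of_memLp (hF.const_smul c)]
  exact MemLp.toLp_const_smul c hF

theorem zakFiber_add (hf : f ∈ decaying) (hg : g ∈ decaying) :
    zakFiber ℓ (f + g) = zakFiber ℓ f + zakFiber ℓ g := by
  rw [zakFiber, zakFiber, zakFiber, ← toL2_add (memLp_unitCell (continuous_zakFun ℓ hf))
    (memLp_unitCell (continuous_zakFun ℓ hg))]
  congr 1
  funext y
  rw [Pi.add_apply, zakFun, zak_add hf hg, zakFun, zakFun]
  ring

theorem zakFiber_smul (hf : f ∈ decaying) (c : ℂ) : zakFiber ℓ (c • f) = c • zakFiber ℓ f := by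
  rw [zakFiber, zakFiber, ← toL2_smul (memLp_unitCell (continuous_zakFun ℓ hf))]
  congr 1
  funext y
  rw [Pi.smul_apply, zakFun, zak_smul, zakFun, smul_eq_mul]
  ring

/-- It turns pointwise decay on the line into fiber norm estimates, by `|f|² ≤ C · C / (1 + s²)` and
`∫ ds / (1 + s²) = π`. The differentiability of the Bloch waves is derived from it. -/
theorem norm_zakFiber_le (hℓ : 0 < ℓ) (hf : Continuous f) {C : ℝ}
    (hC : ∀ t, ‖f t‖ ≤ C / (1 + t ^ 2)) : ‖zakFiber ℓ f‖ ≤ C * √Real.pi := by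
  have hfd : f ∈ decaying := ⟨hf, C, hC⟩
  have hC0 : 0 ≤ C := (norm_nonneg _).trans (bounded_of_decay hC 0)
  have h := inner_zakFiber hℓ hfd hfd
  rw [inner_self_eq_norm_sq_to_K] at h
  have h1 : ∀ s, starRingEnd ℂ (f s) * f s = ((‖f s‖ ^ 2 : ℝ) : ℂ) := fun s => by
    rw [Complex.conj_mul', Complex.ofReal_pow]
  simp only [h1] at h
  rw [integral_complex_ofReal] at h
  have h2 : ‖zakFiber ℓ f‖ ^ 2 = ∫ s, ‖f s‖ ^ 2 :=
    Complex.ofReal_injective ((Complex.ofReal_pow _ _).trans h)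
  have h3 : ∫ s, ‖f s‖ ^ 2 ≤ ∫ s, C ^ 2 * (1 + s ^ 2)⁻¹ := by
    refine integral_mono_of_nonneg (Eventually.of_forall fun s => by positivity)
      (integrable_inv_one_add_sq.const_mul _) (Eventually.of_forall fun s => ?_)
    have h4 := hC s
    have h5 := bounded_of_decay hC s
    calc ‖f s‖ ^ 2 = ‖f s‖ * ‖f s‖ := sq _
      _ ≤ C * (C / (1 + s ^ 2)) := mul_le_mul h5 h4 (norm_nonneg _) hC0
      _ = _ := by
        rw [div_eq_mul_inv]
        ring
  rw [integral_const_mul, integral_univ_inv_one_add_sq] at h3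
  refine le_of_sq_le_sq ?_ (by positivity)
  rw [h2, mul_pow, Real.sq_sqrt Real.pi_pos.le]
  exact h3

end FiberMap

/-! ### Unfolding integrals over the unit cell to the plane. -/

section Unfolding

variable {ℓ : ℝ}

/-- The half-open magnetic unit cell. -/
def halfOpenCell (ℓ : ℝ) : Set Plane := {y | ∀ i, y i ∈ Set.Ico 0 (side * ℓ)}

theorem unitCell_ae_eq (ℓ : ℝ) : unitCell ℓ =ᵐ[volume] halfOpenCell ℓ := by
  have h := (Measure.univ_pi_Ico_ae_eq_Icc (μ := fun _ : Fin 2 => (volume : Measure ℝ))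
    (f := fun _ => 0) (g := fun _ => side * ℓ))
  have h2 := (PiLp.volume_preserving_ofLp (Fin 2)).quasiMeasurePreserving.preimage_ae_eq h
  have e1 : (WithLp.ofLp : Plane → _) ⁻¹' Set.univ.pi (fun _ => Set.Ico 0 (side * ℓ)) =
      halfOpenCell ℓ := by
    ext y
    simp [halfOpenCell]
  have e2 : (WithLp.ofLp : Plane → _) ⁻¹' Set.Icc (fun _ => 0) (fun _ => side * ℓ) =
      unitCell ℓ := by
    ext y
    simp only [Set.mem_preimage, Set.mem_Icc, Pi.le_def, unitCell, Set.mem_ofPred_eq, forall_and]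
    rfl
  rw [e1, e2] at h2
  exact h2.symm

theorem measurableSet_halfOpenCell (ℓ : ℝ) : MeasurableSet (halfOpenCell ℓ) := by
  have : halfOpenCell ℓ = ⋂ i, (fun y : Plane => y i) ⁻¹' Set.Ico 0 (side * ℓ) := by
    ext y
    simp [halfOpenCell]
  rw [this]
  exact MeasurableSet.iInter fun i =>
    (by fun_prop : Measurable fun y : Plane => y i) measurableSet_Ico

theorem latticePt_apply (m : Fin 2 → ℤ) (i : Fin 2) : latticePt m i = m i := rfl

theorem mem_halfOpenCell_iff (hℓ : 0 < ℓ) (x : Plane) (m : Fin 2 → ℤ) :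
    x + (side * ℓ) • latticePt m ∈ halfOpenCell ℓ ↔ m = fun i => -⌊x i / (side * ℓ)⌋ := by
  have hpos : 0 < side * ℓ := mul_pos side_pos hℓ
  rw [funext_iff]
  refine forall_congr' fun i => ?_
  rw [PiLp.add_apply, PiLp.smul_apply, latticePt_apply, smul_eq_mul, Set.mem_Ico, eq_comm,
    neg_eq_iff_eq_neg, Int.floor_eq_iff, le_div_iff₀ hpos, div_lt_iff₀ hpos, Int.cast_neg]
  constructor
  · rintro ⟨h1, h2⟩
    constructor <;> linarith
  · rintro ⟨h1, h2⟩
    constructor <;> linarith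

/-- The translates of the half-open cell tile the plane, and it differs from the closed cell by a
null set. -/
theorem hasSum_integral_cell (hℓ : 0 < ℓ) {G : Plane → ℂ} (hG : Integrable G) :
    HasSum (fun m : Fin 2 → ℤ => ∫ y in unitCell ℓ, G (y - (side * ℓ) • latticePt m))
      (∫ x, G x) := by
  set s : (Fin 2 → ℤ) → Set Plane := fun m =>
    (fun x => x + (side * ℓ) • latticePt m) ⁻¹' halfOpenCell ℓ
  have hs : ∀ m, ∫ y in unitCell ℓ, G (y - (side * ℓ) • latticePt m) = ∫ x in s m, G x := fun m => by
    rw [setIntegral_congr_set (unitCell_ae_eq ℓ)]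
    have := (measurePreserving_add_right volume ((side * ℓ) • latticePt m)).setIntegral_preimage_emb
      (measurableEmbedding_addRight _) (fun y => G (y - (side * ℓ) • latticePt m)) (halfOpenCell ℓ)
    rw [← this]
    simp only [add_sub_cancel_right]
    rfl
  have hU : ⋃ m, s m = Set.univ := by
    refine Set.eq_univ_of_forall fun x => Set.mem_iUnion.2 ⟨fun i => -⌊x i / (side * ℓ)⌋, ?_⟩
    exact (mem_halfOpenCell_iff hℓ x _).2 rfl
  have h := hasSum_integral_iUnion (f := G) (μ := volume) (s := s)
    (fun m => (measurable_add_const _) (measurableSet_halfOpenCell ℓ)) ?_ (by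
      rw [hU]
      exact hG.integrableOn)
  · rw [hU, Measure.restrict_univ] at h
    simpa only [hs] using h
  · intro m m' hmm'
    refine Set.disjoint_left.2 fun x hx hx' => hmm' ?_
    exact ((mem_halfOpenCell_iff hℓ x m).1 hx).trans ((mem_halfOpenCell_iff hℓ x m').1 hx').symm

theorem exists_finset_translate (hℓ : 0 < ℓ) {φ : Plane → ℂ} (hc : HasCompactSupport φ) :
    ∃ M : Finset (Fin 2 → ℤ), ∀ m ∉ M, ∀ y ∈ unitCell ℓ,
      φ (y - (side * ℓ) • latticePt m) = 0 := by
  obtain ⟨R, hR⟩ := hc.isCompact.isBounded.exists_norm_le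
  have hpos : 0 < side * ℓ := mul_pos side_pos hℓ
  obtain ⟨N, hN⟩ := exists_nat_ge ((R + side * ℓ) / (side * ℓ))
  refine ⟨Fintype.piFinset fun _ => Finset.Icc (-(N : ℤ)) N, fun m hm y hy => ?_⟩
  by_contra h
  refine hm (Fintype.mem_piFinset.2 fun i => ?_)
  have h1 := (PiLp.norm_apply_le (y - (side * ℓ) • latticePt m) i).trans
    (hR _ (subset_tsupport _ h))
  rw [PiLp.sub_apply, PiLp.smul_apply, latticePt_apply, smul_eq_mul, Real.norm_eq_abs, abs_le] at h1
  have h2 : y i ∈ Set.Icc 0 (side * ℓ) := hy i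
  rw [div_le_iff₀ hpos] at hN
  rw [Finset.mem_Icc]
  constructor
  · have : (-(N : ℝ)) * (side * ℓ) ≤ m i * (side * ℓ) := by nlinarith [h2.1, h2.2]
    exact_mod_cast le_of_mul_le_mul_right this hpos
  · have : (m i : ℝ) * (side * ℓ) ≤ N * (side * ℓ) := by nlinarith [h2.1, h2.2]
    exact_mod_cast le_of_mul_le_mul_right this hpos

theorem exists_finset_blochZakFun (hℓ : 0 < ℓ) {φ : Plane → ℂ} (hc : HasCompactSupport φ) :
    ∃ M : Finset (Fin 2 → ℤ), ∀ k, ∀ y ∈ unitCell ℓ, blochZakFun ℓ φ k y = ∑ m ∈ M,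
      exp (-I * ((inner ℝ k (y - (√(2 * Real.pi) * ℓ) • latticePt m) : ℝ) : ℂ)) *
        magneticTranslation ℓ m φ y := by
  obtain ⟨M, hM⟩ := exists_finset_translate hℓ hc
  refine ⟨M, fun k y hy => tsum_eq_sum fun m hm => ?_⟩
  have : φ (y - (√(2 * Real.pi) * ℓ) • latticePt m) = 0 := hM m hm y hy
  rw [magneticTranslation, this, mul_zero, mul_zero]

theorem memLp_blochZakFun (hℓ : 0 < ℓ) {φ : Plane → ℂ} (hφ : Continuous φ)
    (hc : HasCompactSupport φ) (k : Plane) :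
    MemLp (blochZakFun ℓ φ k) 2 ((volume : Measure Plane).restrict (unitCell ℓ)) := by
  obtain ⟨M, hM⟩ := exists_finset_blochZakFun hℓ hc
  have hcont : Continuous fun y => ∑ m ∈ M,
      exp (-I * ((inner ℝ k (y - (√(2 * Real.pi) * ℓ) • latticePt m) : ℝ) : ℂ)) *
        magneticTranslation ℓ m φ y := by
    unfold magneticTranslation
    fun_prop
  refine (memLp_unitCell hcont).ae_eq ?_
  exact (ae_restrict_iff' (isCompact_unitCell ℓ).measurableSet).2
    (Eventually.of_forall fun y hy => (hM k y hy).symm)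

/-- Quasi-periodicity under the magnetic translations. -/
def IsQuasiPeriodic (ℓ : ℝ) (χ : Plane → ℂ) : Prop :=
  ∀ x m, χ (x + (side * ℓ) • latticePt m) = (-1 : ℂ) ^ (m 0 * m 1) *
    exp (-I * ((√(Real.pi / 2) * (m 0 * x 1 - m 1 * x 0) / ℓ : ℝ) : ℂ)) * χ x

theorem sqrt_pi_div_two : √(Real.pi / 2) = side / 2 := by
  rw [Real.sqrt_eq_iff_mul_self_eq (by positivity) (by have := side_pos; positivity)]
  linear_combination -side_mul_self / 4

/-- The phase `e^{iuv/2}` converts the one-sided multiplier of the Zak transform into that of the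
symmetric gauge. The sign comes from `side² m₁ m₂ / 2 = π m₁ m₂`. -/
theorem isQuasiPeriodic_zakFun (hℓ : 0 < ℓ) (f : ℝ → ℂ) : IsQuasiPeriodic ℓ (zakFun ℓ f) := by
  intro x m
  have e : ∀ i, (x + (side * ℓ) • latticePt m) i / ℓ = x i / ℓ + side * m i := fun i => by
    rw [PiLp.add_apply, PiLp.smul_apply, latticePt_apply, smul_eq_mul]
    field_simp
  rw [zakFun, e, e, zak_add_side, zakFun, sqrt_pi_div_two]
  have h1 : (-1 : ℂ) ^ (m 0 * m 1) = exp (I * ((Real.pi * (m 0 * m 1) : ℝ) : ℂ)) := by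
    rw [← Complex.exp_pi_mul_I, ← Complex.exp_int_mul]
    push_cast
    ring_nf
  have h2 : exp (I * (((x 0 / ℓ + side * m 0) * (x 1 / ℓ + side * m 1) / 2 : ℝ) : ℂ)) *
      character (-m 0) (x 1 / ℓ) = exp (I * ((Real.pi * (m 0 * m 1) : ℝ) : ℂ)) *
        exp (-I * ((side / 2 * (m 0 * x 1 - m 1 * x 0) / ℓ : ℝ) : ℂ)) *
        exp (I * ((x 0 / ℓ * (x 1 / ℓ) / 2 : ℝ) : ℂ)) := by
    rw [character, ← Complex.exp_add, ← Complex.exp_add, ← Complex.exp_add]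
    congr 1
    have h3 : (side : ℂ) * side = 2 * Real.pi := by exact_mod_cast side_mul_self
    push_cast
    linear_combination (I * (m 0 * m 1) / 2) * h3
  rw [h1]
  linear_combination ((((ℓ * √side)⁻¹ : ℝ) : ℂ) * zak f (x 0 / ℓ) (x 1 / ℓ)) * h2

theorem exp_neg_I_mul (r : ℝ) : exp (-I * (r : ℂ)) = starRingEnd ℂ (exp (I * (r : ℂ))) := by
  rw [← Complex.exp_conj, map_mul, Complex.conj_I, Complex.conj_ofReal]

theorem conj_exp_mul_exp (r : ℝ) :
    starRingEnd ℂ (exp (I * (r : ℂ))) * exp (I * (r : ℂ)) = 1 := by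
  rw [Complex.conj_mul', norm_exp_I_mul]
  simp

/-- Unfolding of the integral over the unit cell of the Bloch–Floquet–Zak transform. -/
theorem integral_conj_mul_blochZakFun (hℓ : 0 < ℓ) {φ χ : Plane → ℂ} (hφ : Continuous φ)
    (hc : HasCompactSupport φ) (hχ : Continuous χ) (hq : IsQuasiPeriodic ℓ χ) (k : Plane) :
    ∫ y in unitCell ℓ, starRingEnd ℂ (χ y) * blochZakFun ℓ φ k y =
      ∫ x, starRingEnd ℂ (χ x * exp (I * ((inner ℝ k x : ℝ) : ℂ))) * φ x := by
  set G : Plane → ℂ := fun x => starRingEnd ℂ (χ x * exp (I * ((inner ℝ k x : ℝ) : ℂ))) * φ x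
    with hGdef
  have hGcont : Continuous G := by fun_prop
  have hGc : HasCompactSupport G := hc.mul_left
  have hG : Integrable G := hGcont.integrable_of_hasCompactSupport hGc
  -- The multiplier of `χ` and that of the magnetic translation are conjugate and cancel, so all
  -- terms are translates of one function `G`.
  have hterm : ∀ y m, starRingEnd ℂ (χ y) *
      (exp (-I * ((inner ℝ k (y - (√(2 * Real.pi) * ℓ) • latticePt m) : ℝ) : ℂ)) *
        magneticTranslation ℓ m φ y) = G (y - (side * ℓ) • latticePt m) := fun y m => by
    obtain ⟨x, rfl⟩ : ∃ x, y = x + (side * ℓ) • latticePt m :=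
      ⟨y - (side * ℓ) • latticePt m, by abel⟩
    have hx : x + (side * ℓ) • latticePt m - (√(2 * Real.pi) * ℓ) • latticePt m = x :=
      add_sub_cancel_right _ _
    have hw : (m 0 : ℝ) * (x + (side * ℓ) • latticePt m) 1 -
        m 1 * (x + (side * ℓ) • latticePt m) 0 = m 0 * x 1 - m 1 * x 0 := by
      simp only [PiLp.add_apply, PiLp.smul_apply, latticePt_apply, smul_eq_mul]
      ring
    rw [magneticTranslation, hx, hw, hq, add_sub_cancel_right, hGdef]
    have h1 : starRingEnd ℂ ((-1 : ℂ) ^ (m 0 * m 1)) * (-1 : ℂ) ^ (m 0 * m 1) = 1 := by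
      rw [map_zpow₀, map_neg, map_one, ← mul_zpow]
      simp
    have h2 := conj_exp_mul_exp (√(Real.pi / 2) * (m 0 * x 1 - m 1 * x 0) / ℓ)
    simp only [exp_neg_I_mul, map_mul, Complex.conj_conj]
    linear_combination (starRingEnd ℂ (χ x) * starRingEnd ℂ (exp (I * ((inner ℝ k x : ℝ) : ℂ))) *
      φ x) * (starRingEnd ℂ (exp (I * ((√(Real.pi / 2) * (m 0 * x 1 - m 1 * x 0) / ℓ : ℝ) : ℂ))) *
      exp (I * ((√(Real.pi / 2) * (m 0 * x 1 - m 1 * x 0) / ℓ : ℝ) : ℂ)) * h1 + h2)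
  obtain ⟨M, hM⟩ := exists_finset_translate hℓ hGc
  have h1 : ∀ y ∈ unitCell ℓ, starRingEnd ℂ (χ y) * blochZakFun ℓ φ k y =
      ∑ m ∈ M, G (y - (side * ℓ) • latticePt m) := fun y hy => by
    rw [blochZakFun, ← tsum_mul_left]
    simp only [hterm]
    exact tsum_eq_sum fun m hm => hM m hm y hy
  rw [setIntegral_congr_fun (isCompact_unitCell ℓ).measurableSet h1, integral_finsetSum,
    ← (hasSum_integral_cell hℓ hG).tsum_eq, tsum_eq_sum (s := M)]
  · intro m hm
    rw [setIntegral_congr_fun (isCompact_unitCell ℓ).measurableSet (hM m hm)]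
    simp
  · intro m _
    exact (by fun_prop : Continuous fun y => G (y - (side * ℓ) • latticePt m)).continuousOn
      |>.integrableOn_compact (isCompact_unitCell ℓ)

end Unfolding

/-! ### Bloch waves from phase-space translates. -/

section Bloch

variable {ℓ : ℝ}

/-- The phase-space translate `e^{-i q₁ t} f(t + q₂)`. -/
def phaseShift (q₁ q₂ : ℝ) (f : ℝ → ℂ) (t : ℝ) : ℂ := exp (-I * ((q₁ * t : ℝ) : ℂ)) * f (t + q₂)

theorem norm_phaseShift (q₁ q₂ : ℝ) (f : ℝ → ℂ) (t : ℝ) : ‖phaseShift q₁ q₂ f t‖ = ‖f (t + q₂)‖ := by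
  rw [phaseShift, norm_mul, exp_neg_I_mul, RCLike.norm_conj, norm_exp_I_mul, one_mul]

theorem phaseShift_mem_decaying (q₁ q₂ : ℝ) {f : ℝ → ℂ} (hf : f ∈ decaying) :
    phaseShift q₁ q₂ f ∈ decaying := by
  obtain ⟨hf, C, hC⟩ := hf
  refine ⟨by unfold phaseShift; fun_prop, 2 * C * (1 + |q₂| ^ 2), fun t => ?_⟩
  rw [norm_phaseShift, add_comm]
  exact decay_translate hC le_rfl t

/-- The Bloch functions attached to a function on the line. -/
def blochWave (ℓ : ℝ) (f : ℝ → ℂ) (k : Plane) : Fiber ℓ :=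
  zakFiber ℓ (phaseShift (ℓ * k 0) (ℓ * k 1) f)

/-- Phase-space translations preserve the inner product, so Gram matrices of Bloch waves do not
depend on `k`. This is the source of the constant curvature. -/
theorem inner_blochWave (hℓ : 0 < ℓ) {f g : ℝ → ℂ} (hf : f ∈ decaying) (hg : g ∈ decaying)
    (k : Plane) :
    inner ℂ (blochWave ℓ f k) (blochWave ℓ g k) = ∫ s, starRingEnd ℂ (f s) * g s := by
  rw [blochWave, blochWave, inner_zakFiber hℓ (phaseShift_mem_decaying _ _ hf)
    (phaseShift_mem_decaying _ _ hg),
    ← integral_add_right_eq_self (fun s => starRingEnd ℂ (f s) * g s) (ℓ * k 1)]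
  refine integral_congr_ae (Eventually.of_forall fun s => ?_)
  have h := conj_exp_mul_exp (ℓ * k 0 * s)
  simp only [phaseShift, exp_neg_I_mul, map_mul, Complex.conj_conj]
  linear_combination (starRingEnd ℂ (f (s + ℓ * k 1)) * g (s + ℓ * k 1)) * h

theorem inner_blochWave_schwartz (hℓ : 0 < ℓ) (f g : 𝓢(ℝ, ℂ)) (k : Plane) :
    inner ℂ (blochWave ℓ f k) (blochWave ℓ g k) = inner ℂ (lineIncl f) (lineIncl g) := by
  rw [inner_blochWave hℓ (schwartz_mem_decaying f) (schwartz_mem_decaying g), inner_lineIncl]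
  refine integral_congr_ae (Eventually.of_forall fun s => ?_)
  simp only [RCLike.inner_apply, mul_comm]

/-- Multiplied by `e^{ik·x}`, a Bloch wave is the superposition of the planar waves whose parameters
run through the coset `ℓ k₂ + side ℤ`. -/
theorem hasSum_zakFun_mul_exp (ℓ : ℝ) (j : ℕ) (k x : Plane) :
    HasSum (fun n : ℤ => (((ℓ * √side)⁻¹ : ℝ) : ℂ) * (character (-n) (ℓ * k 0) *
      planarWave ℓ j (ℓ * k 1 + side * n) x))
      (zakFun ℓ (phaseShift (ℓ * k 0) (ℓ * k 1) (hermiteFun j)) x *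
        exp (I * ((ℓ * k 0 * (x 0 / ℓ) + ℓ * k 1 * (x 1 / ℓ) : ℝ) : ℂ))) := by
  have h := (((summable_zak (phaseShift_mem_decaying (ℓ * k 0) (ℓ * k 1)
    (schwartz_mem_decaying (hermiteFun j))) (x 0 / ℓ) (x 1 / ℓ)).hasSum.mul_left
      (exp (I * ((x 0 / ℓ * (x 1 / ℓ) / 2 : ℝ) : ℂ)))).mul_left (((ℓ * √side)⁻¹ : ℝ) : ℂ)).mul_right
      (exp (I * ((ℓ * k 0 * (x 0 / ℓ) + ℓ * k 1 * (x 1 / ℓ) : ℝ) : ℂ)))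
  refine (congrArg (HasSum · _) (funext fun n => ?_)).mp h
  have e : exp (I * ((x 0 / ℓ * (x 1 / ℓ) / 2 : ℝ) : ℂ)) *
      exp (-I * ((ℓ * k 0 * (x 0 / ℓ + side * n) : ℝ) : ℂ)) * character n (x 1 / ℓ) *
      exp (I * ((ℓ * k 0 * (x 0 / ℓ) + ℓ * k 1 * (x 1 / ℓ) : ℝ) : ℂ)) =
      character (-n) (ℓ * k 0) * exp (I * ((x 0 / ℓ * (x 1 / ℓ) / 2 +
        (ℓ * k 1 + side * n) * (x 1 / ℓ) : ℝ) : ℂ)) := by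
    rw [character, character, ← Complex.exp_add, ← Complex.exp_add, ← Complex.exp_add,
      ← Complex.exp_add]
    congr 1
    push_cast
    ring
  rw [phaseShift, planarWave, show x 0 / ℓ + side * n + ℓ * k 1 = x 0 / ℓ + (ℓ * k 1 + side * n) by
    ring]
  linear_combination ((((ℓ * √side)⁻¹ : ℝ) : ℂ) * hermiteFun j (x 0 / ℓ + (ℓ * k 1 + side * n))) * e

/-- Unfolding the cell and inserting the expansion into planar waves produces the Zak series of the
coefficient function. The components of `k` enter it in reversed order. -/
theorem inner_blochWave_blochZak (hℓ : 0 < ℓ) (j : ℕ) {φ : Plane → ℂ} (hφ : Continuous φ)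
    (hc : HasCompactSupport φ) (k : Plane) :
    inner ℂ (blochWave ℓ (hermiteFun j) k) (blochZak ℓ φ k) =
      (((ℓ * √side)⁻¹ : ℝ) : ℂ) * zak (waveCoeff ℓ j φ) (ℓ * k 1) (ℓ * k 0) := by
  have hd := phaseShift_mem_decaying (ℓ * k 0) (ℓ * k 1) (schwartz_mem_decaying (hermiteFun j))
  have hint : Integrable φ := hφ.integrable_of_hasCompactSupport hc
  rw [blochWave, zakFiber, blochZak, inner_toL2 (memLp_unitCell (continuous_zakFun ℓ hd))
    (memLp_blochZakFun hℓ hφ hc k), integral_conj_mul_blochZakFun hℓ hφ hc (continuous_zakFun ℓ hd)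
    (isQuasiPeriodic_zakFun hℓ _)]
  have hk : ∀ x : Plane, inner ℝ k x = ℓ * k 0 * (x 0 / ℓ) + ℓ * k 1 * (x 1 / ℓ) := fun x => by
    rw [PiLp.inner_apply, Fin.sum_univ_two]
    simp only [RCLike.inner_apply, conj_trivial]
    field_simp
  simp only [hk]
  obtain ⟨R, hR⟩ := hc.isCompact.isBounded.exists_norm_le
  obtain ⟨b, hb, hfb⟩ := exists_translate_bound (schwartz_mem_decaying (hermiteFun j))
    (R / ℓ + |ℓ * k 1|)
  have hx : ∀ x, φ x ≠ 0 → |x 0 / ℓ + ℓ * k 1| ≤ R / ℓ + |ℓ * k 1| := fun x hx => by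
    refine (abs_add_le _ _).trans (add_le_add_left ?_ _)
    rw [abs_div, abs_of_pos hℓ, ← Real.norm_eq_abs]
    exact div_le_div_of_nonneg_right ((PiLp.norm_apply_le x 0).trans (hR x (subset_tsupport _ hx)))
      hℓ.le
  have h := hasSum_integral_of_dominated_convergence (μ := (volume : Measure Plane))
    (F := fun (n : ℤ) x => starRingEnd ℂ ((((ℓ * √side)⁻¹ : ℝ) : ℂ) * (character (-n) (ℓ * k 0) *
      planarWave ℓ j (ℓ * k 1 + side * n) x)) * φ x)
    (f := fun x => starRingEnd ℂ (zakFun ℓ (phaseShift (ℓ * k 0) (ℓ * k 1) (hermiteFun j)) x *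
        exp (I * ((ℓ * k 0 * (x 0 / ℓ) + ℓ * k 1 * (x 1 / ℓ) : ℝ) : ℂ))) * φ x)
    (fun n x => |(ℓ * √side)⁻¹| * b n * ‖φ x‖) (fun n => ?_)
    (fun n => Eventually.of_forall fun x => ?_)
    (Eventually.of_forall fun x => (hb.mul_left _).mul_right _) ?_
    (Eventually.of_forall fun x => (Complex.hasSum_conj'.2
      (by simpa using hasSum_zakFun_mul_exp ℓ j k x)).mul_right _)
  · rw [← h.tsum_eq, zak, ← tsum_mul_left]
    refine tsum_congr fun n => ?_
    have e : ∀ x, starRingEnd ℂ ((((ℓ * √side)⁻¹ : ℝ) : ℂ) * (character (-n) (ℓ * k 0) *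
      planarWave ℓ j (ℓ * k 1 + side * n) x)) * φ x =
      (((ℓ * √side)⁻¹ : ℝ) : ℂ) * character n (ℓ * k 0) *
        (starRingEnd ℂ (planarWave ℓ j (ℓ * k 1 + side * n) x) * φ x) := fun x => by
      rw [map_mul, map_mul, conj_character, neg_neg, Complex.conj_ofReal]
      ring
    simp only [e]
    rw [integral_const_mul, waveCoeff]
    ring
  · have := continuous_planarWave ℓ j
    exact Continuous.aestronglyMeasurable (by fun_prop)
  · rw [norm_mul, RCLike.norm_conj, norm_mul, norm_mul, norm_character, one_mul, norm_planarWave,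
      Complex.norm_real, Real.norm_eq_abs]
    by_cases h0 : φ x = 0
    · simp [h0]
    · refine mul_le_mul_of_nonneg_right (mul_le_mul_of_nonneg_left ?_ (abs_nonneg _)) (norm_nonneg _)
      rw [← add_assoc]
      exact hfb n _ (hx x h0)
  · simp only [tsum_mul_right]
    exact hint.norm.const_mul _

end Bloch

/-! ### The rank-one projections `blochProjection` decompose `Π_j` equivariantly. -/

section Family

variable {ℓ : ℝ}

/-- The Bloch projections onto the lines spanned by the Bloch waves of the Hermite functions. -/
def blochProjection (ℓ : ℝ) (j : ℕ) (k : Plane) : Fiber ℓ →L[ℂ] Fiber ℓ :=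
  InnerProductSpace.rankOne ℂ (blochWave ℓ (hermiteFun j) k) (blochWave ℓ (hermiteFun j) k)

theorem blochProjection_apply (j : ℕ) (k : Plane) (v : Fiber ℓ) : blochProjection ℓ j k v =
    inner ℂ (blochWave ℓ (hermiteFun j) k) v • blochWave ℓ (hermiteFun j) k := rfl

theorem norm_blochWave_hermiteFun (hℓ : 0 < ℓ) (j : ℕ) (k : Plane) :
    ‖blochWave ℓ (hermiteFun j) k‖ = 1 := by
  have h := inner_blochWave_schwartz hℓ (hermiteFun j) (hermiteFun j) k
  rw [inner_self_eq_norm_sq_to_K, inner_self_eq_norm_sq_to_K, orthonormal_hermiteFun.1 j] at h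
  have h2 : ‖blochWave ℓ (hermiteFun j) k‖ ^ 2 = 1 := by
    refine Complex.ofReal_injective ((Complex.ofReal_pow _ _).trans (h.trans ?_))
    simp
  exact (pow_eq_one_iff_of_nonneg (norm_nonneg _) two_ne_zero).1 h2

theorem isStarProjection_blochProjection (hℓ : 0 < ℓ) (j : ℕ) (k : Plane) :
    IsStarProjection (blochProjection ℓ j k) :=
  InnerProductSpace.isStarProjection_rankOne_self (norm_blochWave_hermiteFun hℓ j k)

theorem finrank_range_blochProjection (hℓ : 0 < ℓ) (j : ℕ) (k : Plane) :
    Module.finrank ℂ (LinearMap.range (blochProjection ℓ j k).toLinearMap) = 1 := by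
  have hu := norm_blochWave_hermiteFun hℓ j k
  have hne : blochWave ℓ (hermiteFun j) k ≠ 0 := by
    rw [← norm_ne_zero_iff, hu]
    exact one_ne_zero
  have h : LinearMap.range (blochProjection ℓ j k).toLinearMap =
      Submodule.span ℂ {blochWave ℓ (hermiteFun j) k} := by
    refine le_antisymm ?_ ?_
    · rintro _ ⟨v, rfl⟩
      exact Submodule.smul_mem _ _ (Submodule.mem_span_singleton_self _)
    · rw [Submodule.span_singleton_le_iff_mem]
      refine ⟨blochWave ℓ (hermiteFun j) k, ?_⟩
      refine (blochProjection_apply j k _).trans ?_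
      rw [inner_self_eq_norm_sq_to_K, hu]
      simp
  rw [h, finrank_span_singleton hne]

theorem continuous_conj_zak_mul {f g : ℝ → ℂ} (hf : f ∈ decaying) (hg : g ∈ decaying) :
    Continuous (Function.uncurry fun t s => starRingEnd ℂ (zak f s t) * zak g s t) := by
  have h1 := continuous_zak hf
  have h2 := continuous_zak hg
  have h3 : Continuous (Function.uncurry fun s t => starRingEnd ℂ (zak f s t) * zak g s t) :=
    (Complex.continuous_conj.comp h1).mul h2
  exact h3.comp continuous_swap

theorem integral_conj_zak_mul_swap {f g : ℝ → ℂ} (hf : f ∈ decaying) (hg : g ∈ decaying) :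
    ∫ t in (0 : ℝ)..side, ∫ s in (0 : ℝ)..side, starRingEnd ℂ (zak f s t) * zak g s t =
      side * ∫ s, starRingEnd ℂ (f s) * g s := by
  rw [← integral_conj_zak_mul hf hg, intervalIntegral_intervalIntegral_swap
    (F := fun t s => starRingEnd ℂ (zak f s t) * zak g s t)]
  exact ((continuous_conj_zak_mul hf hg).continuousOn.integrableOn_compact
    (isCompact_uIcc.prod isCompact_uIcc)).mono_set
    (Set.prod_mono Set.uIoc_subset_uIcc Set.uIoc_subset_uIcc)

/-- Plancherel for the Zak transform over the Brillouin cell recovers the line integral of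
`inner_landauProjection_toL2`. The constants agree: `ℓ² / (2π) · 1 / (ℓ² side) · ℓ⁻² · side = 1 /
(2π ℓ²)`. -/
theorem decomposition_blochProjection {ε : ℝ} (hε : 0 < ε) (hℓ : 0 < ℓ) (j : ℕ) {φ ψ : Plane → ℂ}
    (hφ : Continuous φ) (hφc : HasCompactSupport φ) (hψ : Continuous ψ)
    (hψc : HasCompactSupport ψ) :
    inner ℂ (toL2 volume φ) (landauProjection ε ℓ j (toL2 volume ψ)) =
      ((ℓ ^ 2 / (2 * Real.pi) : ℝ) : ℂ) *
        ∫ k in brillouinCell ℓ, inner ℂ (blochZak ℓ φ k) (blochProjection ℓ j k (blochZak ℓ ψ k)) := by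
  have hdφ := waveCoeff_mem_decaying ℓ j hφ hφc
  have hdψ := waveCoeff_mem_decaying ℓ j hψ hψc
  have hr : ((ℓ * √side)⁻¹ : ℝ) * (ℓ * √side)⁻¹ = (ℓ ^ 2 * side)⁻¹ := by
    rw [← mul_inv, mul_mul_mul_comm, Real.mul_self_sqrt side_pos.le, sq]
  have e : ∀ k, inner ℂ (blochZak ℓ φ k) (blochProjection ℓ j k (blochZak ℓ ψ k)) =
      (((ℓ ^ 2 * side)⁻¹ : ℝ) : ℂ) * (starRingEnd ℂ (zak (waveCoeff ℓ j φ) (k 1 / ℓ⁻¹) (k 0 / ℓ⁻¹)) *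
        zak (waveCoeff ℓ j ψ) (k 1 / ℓ⁻¹) (k 0 / ℓ⁻¹)) := fun k => by
    rw [blochProjection_apply, inner_smul_right, ← inner_conj_symm (blochZak ℓ φ k),
      inner_blochWave_blochZak hℓ j hφ hφc, inner_blochWave_blochZak hℓ j hψ hψc, ← hr, map_mul,
      Complex.conj_ofReal, div_inv_eq_mul, div_inv_eq_mul, mul_comm (k 0), mul_comm (k 1),
      Complex.ofReal_mul]
    ring
  have h3 := setIntegral_square_div (F := fun s t => starRingEnd ℂ (zak (waveCoeff ℓ j φ) t s) *
      zak (waveCoeff ℓ j ψ) t s) (continuous_conj_zak_mul hdφ hdψ) side_pos.le (inv_pos.2 hℓ)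
  rw [integral_conj_zak_mul_swap hdφ hdψ] at h3
  simp only [e]
  have h4 : brillouinCell ℓ = {k : Plane | ∀ i, k i ∈ Set.Icc 0 (side * ℓ⁻¹)} := rfl
  rw [integral_const_mul, h4, h3, inner_landauProjection_toL2 hε hℓ j hφ hφc hψ hψc]
  have hl : (ℓ : ℂ) ≠ 0 := by exact_mod_cast hℓ.ne'
  have hq : (side : ℂ) ≠ 0 := by exact_mod_cast side_pos.ne'
  have hpi : (Real.pi : ℂ) ≠ 0 := by exact_mod_cast Real.pi_ne_zero
  push_cast
  field_simp

/-! ### Equivariance -/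

theorem memLp_phase (n : Fin 2 → ℤ) (f : Fiber ℓ) : MemLp (fun y =>
    exp (-I * ((inner ℝ ((√(2 * Real.pi) / ℓ) • latticePt n) y : ℝ) : ℂ)) * f y) 2
    ((volume : Measure Plane).restrict (unitCell ℓ)) := by
  refine (Lp.memLp f).of_le ?_ (Eventually.of_forall fun y => ?_)
  · exact (Continuous.aestronglyMeasurable (by fun_prop)).mul (Lp.aestronglyMeasurable f)
  · rw [norm_mul, exp_neg_I_mul, RCLike.norm_conj, norm_exp_I_mul, one_mul]

theorem phaseMul_coeFn (n : Fin 2 → ℤ) (f : Fiber ℓ) : phaseMul ℓ n f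
    =ᵐ[(volume : Measure Plane).restrict (unitCell ℓ)] fun y =>
    exp (-I * ((inner ℝ ((√(2 * Real.pi) / ℓ) • latticePt n) y : ℝ) : ℂ)) * f y :=
  toL2_coeFn (memLp_phase n f)

theorem inner_phaseMul (n : Fin 2 → ℤ) (f g : Fiber ℓ) :
    inner ℂ (phaseMul ℓ n f) (phaseMul ℓ n g) = inner ℂ f g := by
  rw [L2.inner_def, L2.inner_def]
  refine integral_congr_ae ?_
  filter_upwards [phaseMul_coeFn n f, phaseMul_coeFn n g] with y h1 h2
  have h := conj_exp_mul_exp (inner ℝ ((√(2 * Real.pi) / ℓ) • latticePt n) y)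
  rw [h1, h2, RCLike.inner_apply, RCLike.inner_apply, map_mul]
  simp only [exp_neg_I_mul, Complex.conj_conj]
  linear_combination (starRingEnd ℂ (f y) * g y) * h

theorem phaseMul_smul (n : Fin 2 → ℤ) (c : ℂ) (f : Fiber ℓ) :
    phaseMul ℓ n (c • f) = c • phaseMul ℓ n f := by
  refine Lp.ext ?_
  filter_upwards [phaseMul_coeFn n (c • f), phaseMul_coeFn n f, Lp.coeFn_smul c f,
    Lp.coeFn_smul c (phaseMul ℓ n f)] with y h1 h2 h3 h4
  rw [h1, h4, h3, Pi.smul_apply, Pi.smul_apply, h2, smul_eq_mul, smul_eq_mul]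
  ring

theorem zak_phaseShift_add (q₁ q₂ : ℝ) (n₁ n₂ : ℤ) (f : ℝ → ℂ) (s t : ℝ) :
    zak (phaseShift (q₁ + side * n₁) (q₂ + side * n₂) f) s t =
      character n₂ q₁ * (character (-n₁) s * character (-n₂) t * zak (phaseShift q₁ q₂ f) s t) := by
  rw [zak, zak, ← mul_assoc, ← tsum_mul_left, ← (Equiv.subRight n₂).tsum_eq]
  refine tsum_congr fun l => ?_
  have e : exp (-I * (((q₁ + side * n₁) * (s + side * ((l - n₂ : ℤ) : ℝ)) : ℝ) : ℂ)) =
      character n₂ q₁ * character (-n₁) s * exp (-I * ((q₁ * (s + side * l) : ℝ) : ℂ)) *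
        character (-n₁) (side * ((l - n₂ : ℤ) : ℝ)) := by
    rw [character, character, character, ← Complex.exp_add, ← Complex.exp_add, ← Complex.exp_add]
    congr 1
    push_cast
    ring
  rw [Equiv.subRight_apply, phaseShift, phaseShift, e, character_side, sub_eq_add_neg,
    character_add]
  push_cast
  ring_nf

/-- The wave is equivariant only up to a `k`-dependent phase, so it is a global frame over the plane
but does not descend to the torus. The phase drops out of the projection. -/
theorem blochWave_add_lattice (hℓ : 0 < ℓ) {f : ℝ → ℂ} (hf : f ∈ decaying) (n : Fin 2 → ℤ)
    (k : Plane) : blochWave ℓ f (k + (√(2 * Real.pi) / ℓ) • latticePt n) =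
      character (n 1) (ℓ * k 0) • phaseMul ℓ n (blochWave ℓ f k) := by
  have hcoord : ∀ i, ℓ * (k + (√(2 * Real.pi) / ℓ) • latticePt n) i = ℓ * k i + side * n i := fun i => by
    rw [PiLp.add_apply, PiLp.smul_apply, latticePt_apply, smul_eq_mul, side]
    field_simp
  have hd := memLp_unitCell (ℓ := ℓ) (continuous_zakFun ℓ
    (phaseShift_mem_decaying (ℓ * k 0) (ℓ * k 1) hf))
  have hd' := memLp_unitCell (ℓ := ℓ) (continuous_zakFun ℓ
    (phaseShift_mem_decaying (ℓ * k 0 + side * n 0) (ℓ * k 1 + side * n 1) hf))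
  rw [blochWave, hcoord, hcoord, zakFiber, blochWave]
  refine Lp.ext ?_
  filter_upwards [toL2_coeFn hd', Lp.coeFn_smul (character (n 1) (ℓ * k 0))
    (phaseMul ℓ n (zakFiber ℓ (phaseShift (ℓ * k 0) (ℓ * k 1) f))), phaseMul_coeFn n
    (zakFiber ℓ (phaseShift (ℓ * k 0) (ℓ * k 1) f)), toL2_coeFn hd] with y h1 h2 h3 h4
  rw [h1, h2, Pi.smul_apply, h3, zakFiber, h4, zakFun, zakFun, zak_phaseShift_add, smul_eq_mul]
  have e : exp (-I * ((inner ℝ ((√(2 * Real.pi) / ℓ) • latticePt n) y : ℝ) : ℂ)) =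
      character (-n 0) (y 0 / ℓ) * character (-n 1) (y 1 / ℓ) := by
    rw [character, character, ← Complex.exp_add, PiLp.inner_apply, Fin.sum_univ_two]
    simp only [RCLike.inner_apply, conj_trivial, PiLp.smul_apply, latticePt_apply, smul_eq_mul, side]
    congr 1
    push_cast
    field_simp
    ring
  rw [e]
  ring

theorem blochProjection_equivariant (hℓ : 0 < ℓ) (j : ℕ) (n : Fin 2 → ℤ) (k : Plane) (f : Fiber ℓ) :
    blochProjection ℓ j (k + (√(2 * Real.pi) / ℓ) • latticePt n) (phaseMul ℓ n f) =
      phaseMul ℓ n (blochProjection ℓ j k f) := by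
  rw [blochProjection_apply, blochProjection_apply, phaseMul_smul,
    blochWave_add_lattice hℓ (schwartz_mem_decaying (hermiteFun j)), inner_smul_left,
    inner_phaseMul, smul_smul]
  congr 1
  have : starRingEnd ℂ (character (n 1) (ℓ * k 0)) * character (n 1) (ℓ * k 0) = 1 :=
    conj_exp_mul_exp _
  linear_combination inner ℂ (blochWave ℓ (hermiteFun j) k) f * this

end Family

/-! ### Differentiability of the Bloch waves and projections. -/

section Smooth

/-- The spare factor `1 / (1 + t²)` will absorb the `t²` in the second-order remainder of
`e^{-iδt}`. -/
theorem schwartz_translate_decay (f : 𝓢(ℝ, ℂ)) (A : ℝ) :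
    ∃ C, 0 ≤ C ∧ ∀ a, |a| ≤ A → ∀ t, ‖f (t + a)‖ ≤ C / (1 + t ^ 2) ^ 2 := by
  obtain ⟨C0, hC0⟩ := schwartz_decay f 0
  obtain ⟨C2, hC2⟩ := schwartz_decay f 2
  obtain ⟨C4, hC4⟩ := schwartz_decay f 4
  have hC : ∀ u, (1 + u ^ 2) ^ 2 * ‖f u‖ ≤ C0 + 2 * C2 + C4 := fun u => by
    have h0 := hC0 u
    have h2 := hC2 u
    have h4 := hC4 u
    rw [sq_abs] at h2
    rw [show |u| ^ 4 = (|u| ^ 2) ^ 2 by ring, sq_abs] at h4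
    rw [pow_zero, one_mul] at h0
    nlinarith
  have hpos : 0 ≤ C0 + 2 * C2 + C4 := le_trans (by positivity) (hC 0)
  refine ⟨(2 * (1 + A ^ 2)) ^ 2 * (C0 + 2 * C2 + C4), by positivity, fun a ha t => ?_⟩
  have h3 : a ^ 2 ≤ A ^ 2 := sq_le_sq' (by linarith [neg_abs_le a]) ((le_abs_self _).trans ha)
  have h4 : 1 + t ^ 2 ≤ 2 * (1 + A ^ 2) * (1 + (t + a) ^ 2) := by
    nlinarith [sq_nonneg (t + a + a), sq_nonneg (t + a), sq_nonneg A,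
      mul_nonneg (sq_nonneg A) (sq_nonneg (t + a))]
  rw [le_div_iff₀ (by positivity)]
  calc ‖f (t + a)‖ * (1 + t ^ 2) ^ 2 ≤ ‖f (t + a)‖ * (2 * (1 + A ^ 2) * (1 + (t + a) ^ 2)) ^ 2 :=
        mul_le_mul_of_nonneg_left (pow_le_pow_left₀ (by positivity) h4 2) (norm_nonneg _)
    _ = (2 * (1 + A ^ 2)) ^ 2 * ((1 + (t + a) ^ 2) ^ 2 * ‖f (t + a)‖) := by ring
    _ ≤ _ := mul_le_mul_of_nonneg_left (hC _) (by positivity)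

/-- The constant `3` covers `|x| > 1`, where the trivial bound `2 + |x|` is at most `3 x²`. -/
theorem norm_exp_neg_I_sub_le (x : ℝ) : ‖exp (-I * (x : ℂ)) - 1 + I * x‖ ≤ 3 * x ^ 2 := by
  have hn : ‖-I * (x : ℂ)‖ = |x| := by
    rw [norm_mul, norm_neg, Complex.norm_I, one_mul, Complex.norm_real, Real.norm_eq_abs]
  rcases le_or_gt |x| 1 with h | h
  · have := Complex.norm_exp_sub_one_sub_id_le (x := -I * (x : ℂ)) (hn.trans_le h)
    rw [hn, sq_abs, neg_mul, sub_neg_eq_add] at this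
    rw [neg_mul]
    nlinarith [sq_nonneg x]
  · have h1 : ‖exp (-I * (x : ℂ))‖ = 1 := by
      rw [exp_neg_I_mul, RCLike.norm_conj, norm_exp_I_mul]
    calc _ ≤ ‖exp (-I * (x : ℂ)) - 1‖ + ‖I * (x : ℂ)‖ := norm_add_le _ _
      _ ≤ (1 + 1) + |x| := by
          refine add_le_add ((norm_sub_le _ _).trans ?_) ?_
          · rw [h1, norm_one]
          · rw [norm_mul, Complex.norm_I, one_mul, Complex.norm_real, Real.norm_eq_abs]
      _ ≤ 3 * x ^ 2 := by
          rw [← sq_abs x]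
          nlinarith

theorem schwartz_increment (f : 𝓢(ℝ, ℂ)) (A : ℝ) :
    ∃ C, 0 ≤ C ∧ ∀ a b, |a| ≤ A → |b| ≤ A → ∀ t,
      ‖f (t + b) - f (t + a)‖ ≤ C / (1 + t ^ 2) ^ 2 * |b - a| := by
  obtain ⟨C, hC0, hC⟩ := schwartz_translate_decay (lineD f) A
  refine ⟨C, hC0, fun a b ha hb t => ?_⟩
  have := (convex_Icc (-A) A).norm_image_sub_le_of_norm_hasDerivWithin_le
    (f := fun x => f (t + x)) (f' := fun x => lineD f (t + x)) (C := C / (1 + t ^ 2) ^ 2)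
    (fun x _ => ((hasDerivAt_lineD f (t + x)).comp_const_add t x).hasDerivWithinAt)
    (fun x hx => hC x (abs_le.2 hx) t) (abs_le.1 ha) (abs_le.1 hb)
  rwa [Real.norm_eq_abs] at this

theorem schwartz_taylor (f : 𝓢(ℝ, ℂ)) (A : ℝ) :
    ∃ C, 0 ≤ C ∧ ∀ a b, |a| ≤ A → |b| ≤ A → ∀ t,
      ‖f (t + b) - f (t + a) - ((b - a : ℝ) : ℂ) * lineD f (t + a)‖ ≤
        C / (1 + t ^ 2) ^ 2 * |b - a| ^ 2 := by
  obtain ⟨C, hC0, hC⟩ := schwartz_increment (lineD f) A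
  refine ⟨C, hC0, fun a b ha hb t => ?_⟩
  have hsub : ∀ x ∈ Set.uIcc a b, |x| ≤ A ∧ |x - a| ≤ |b - a| := fun x hx =>
    ⟨abs_le.2 (Set.uIcc_subset_Icc (abs_le.1 ha) (abs_le.1 hb) hx),
      Set.abs_sub_left_of_mem_uIcc hx⟩
  have := (convex_uIcc a b).norm_image_sub_le_of_norm_hasDerivWithin_le
    (f := fun x => f (t + x) - ((x - a : ℝ) : ℂ) * lineD f (t + a))
    (f' := fun x => lineD f (t + x) - lineD f (t + a)) (C := C / (1 + t ^ 2) ^ 2 * |b - a|)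
    (fun x _ => ?_) (fun x hx => ?_) Set.left_mem_uIcc Set.right_mem_uIcc
  · rw [Real.norm_eq_abs] at this
    refine (le_of_eq ?_).trans (this.trans (le_of_eq (by ring)))
    congr 1
    simp
    ring
  · have h1 := (hasDerivAt_lineD f (t + x)).comp_const_add t x
    have h2 := ((((hasDerivAt_id x).sub_const a).ofReal_comp).mul_const (lineD f (t + a)))
    refine ((h1.sub h2).congr_deriv ?_).hasDerivWithinAt
    simp
  · obtain ⟨h1, h2⟩ := hsub x hx
    exact (hC a x ha h1 t).trans (mul_le_mul_of_nonneg_left h2 (by positivity))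

/-- Second order estimate for the phase-space translations. -/
theorem phaseShift_taylor (f : 𝓢(ℝ, ℂ)) (q₂ : ℝ) : ∃ C, 0 ≤ C ∧ ∀ q₁ δ₁ δ₂ : ℝ, |δ₂| ≤ 1 → ∀ t,
    ‖phaseShift (q₁ + δ₁) (q₂ + δ₂) f t - phaseShift q₁ q₂ f t -
      (-I * δ₁ * (phaseShift q₁ q₂ (lineMul f) t - q₂ * phaseShift q₁ q₂ f t) +
        δ₂ * phaseShift q₁ q₂ (lineD f) t)‖ ≤ C * (|δ₁| + |δ₂|) ^ 2 / (1 + t ^ 2) := by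
  obtain ⟨C, hC0, hC⟩ := schwartz_translate_decay f (|q₂| + 1)
  obtain ⟨C', hC0', hC'⟩ := schwartz_increment f (|q₂| + 1)
  obtain ⟨D, hD0, hD⟩ := schwartz_taylor f (|q₂| + 1)
  refine ⟨3 * C + C' + D, by positivity, fun q₁ δ₁ δ₂ hδ t => ?_⟩
  have hq : |q₂| ≤ |q₂| + 1 := by linarith
  have hqd : |q₂ + δ₂| ≤ |q₂| + 1 := (abs_add_le _ _).trans (by linarith)
  have e1 : exp (-I * (((q₁ + δ₁) * t : ℝ) : ℂ)) =
      exp (-I * ((q₁ * t : ℝ) : ℂ)) * exp (-I * ((δ₁ * t : ℝ) : ℂ)) := by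
    rw [← Complex.exp_add]
    congr 1
    push_cast
    ring
  -- The remainder splits into the second-order error of the exponential, a mixed term of order `δ₁
  -- δ₂`, and the Taylor error of `f`.
  have e : phaseShift (q₁ + δ₁) (q₂ + δ₂) f t - phaseShift q₁ q₂ f t -
      (-I * δ₁ * (phaseShift q₁ q₂ (lineMul f) t - q₂ * phaseShift q₁ q₂ f t) +
        δ₂ * phaseShift q₁ q₂ (lineD f) t) = exp (-I * ((q₁ * t : ℝ) : ℂ)) *
      ((exp (-I * ((δ₁ * t : ℝ) : ℂ)) - 1 + I * ((δ₁ * t : ℝ) : ℂ)) * f (t + (q₂ + δ₂)) -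
        I * ((δ₁ * t : ℝ) : ℂ) * (f (t + (q₂ + δ₂)) - f (t + q₂)) +
        (f (t + (q₂ + δ₂)) - f (t + q₂) - ((q₂ + δ₂ - q₂ : ℝ) : ℂ) * lineD f (t + q₂))) := by
    simp only [phaseShift, e1, lineMul_apply]
    push_cast
    ring
  have ht : 0 < 1 + t ^ 2 := by positivity
  have i1 : t ^ 2 / (1 + t ^ 2) ^ 2 ≤ 1 / (1 + t ^ 2) := by
    rw [div_le_div_iff₀ (by positivity) ht]
    nlinarith [sq_nonneg t, sq_nonneg (t ^ 2)]
  have i2 : |t| / (1 + t ^ 2) ^ 2 ≤ 1 / (1 + t ^ 2) := by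
    rw [div_le_div_iff₀ (by positivity) ht]
    have : |t| ≤ 1 + t ^ 2 := by
      rw [← sq_abs]
      nlinarith [sq_nonneg (|t| - 1), abs_nonneg t]
    nlinarith
  have i3 : 1 / (1 + t ^ 2) ^ 2 ≤ 1 / (1 + t ^ 2) := by
    refine one_div_le_one_div_of_le ht ?_
    nlinarith [sq_nonneg t]
  have b1 : ‖(exp (-I * ((δ₁ * t : ℝ) : ℂ)) - 1 + I * ((δ₁ * t : ℝ) : ℂ)) * f (t + (q₂ + δ₂))‖ ≤
      3 * C * |δ₁| ^ 2 * (1 / (1 + t ^ 2)) := by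
    rw [norm_mul]
    calc _ ≤ 3 * (δ₁ * t) ^ 2 * (C / (1 + t ^ 2) ^ 2) :=
          mul_le_mul (norm_exp_neg_I_sub_le _) (hC _ hqd t) (norm_nonneg _) (by positivity)
      _ = 3 * C * |δ₁| ^ 2 * (t ^ 2 / (1 + t ^ 2) ^ 2) := by
          rw [sq_abs]
          ring
      _ ≤ _ := mul_le_mul_of_nonneg_left i1 (by positivity)
  have b2 : ‖I * ((δ₁ * t : ℝ) : ℂ) * (f (t + (q₂ + δ₂)) - f (t + q₂))‖ ≤
      C' * (|δ₁| * |δ₂|) * (1 / (1 + t ^ 2)) := by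
    rw [norm_mul, norm_mul, Complex.norm_I, one_mul, Complex.norm_real, Real.norm_eq_abs, abs_mul]
    have := hC' q₂ (q₂ + δ₂) hq hqd t
    rw [add_sub_cancel_left] at this
    calc _ ≤ |δ₁| * |t| * (C' / (1 + t ^ 2) ^ 2 * |δ₂|) :=
          mul_le_mul_of_nonneg_left this (by positivity)
      _ = C' * (|δ₁| * |δ₂|) * (|t| / (1 + t ^ 2) ^ 2) := by ring
      _ ≤ _ := mul_le_mul_of_nonneg_left i2 (by positivity)
  have b3 := hD q₂ (q₂ + δ₂) hq hqd t
  rw [add_sub_cancel_left] at b3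
  have b4 : D / (1 + t ^ 2) ^ 2 * |δ₂| ^ 2 ≤ D * |δ₂| ^ 2 * (1 / (1 + t ^ 2)) := by
    calc _ = D * |δ₂| ^ 2 * (1 / (1 + t ^ 2) ^ 2) := by ring
      _ ≤ _ := mul_le_mul_of_nonneg_left i3 (by positivity)
  rw [e, norm_mul, exp_neg_I_mul, RCLike.norm_conj, norm_exp_I_mul, one_mul, add_sub_cancel_left]
  refine ((norm_add_le _ _).trans (add_le_add ((norm_sub_le _ _).trans (add_le_add b1 b2))
    (b3.trans b4))).trans ?_
  rw [← add_mul, ← add_mul, mul_one_div]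
  refine div_le_div_of_nonneg_right ?_ ht.le
  nlinarith [abs_nonneg δ₁, abs_nonneg δ₂, mul_nonneg (abs_nonneg δ₁) (abs_nonneg δ₂),
    mul_nonneg hC0 (sq_nonneg |δ₂|), mul_nonneg hC0 (mul_nonneg (abs_nonneg δ₁) (abs_nonneg δ₂)),
    mul_nonneg hC0' (mul_nonneg (abs_nonneg δ₁) (abs_nonneg δ₂)), mul_nonneg hC0' (sq_nonneg |δ₂|),
    mul_nonneg hC0' (sq_nonneg |δ₁|), mul_nonneg hD0 (sq_nonneg |δ₁|),
    mul_nonneg hD0 (mul_nonneg (abs_nonneg δ₁) (abs_nonneg δ₂))]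

variable {ℓ : ℝ}

/-- The partial derivatives of `blochWave`. -/
def blochWaveDeriv (ℓ : ℝ) (f : 𝓢(ℝ, ℂ)) (i : Fin 2) (k : Plane) : Fiber ℓ :=
  if i = 0 then (ℓ * -I : ℂ) • (blochWave ℓ (lineMul f) k - ((ℓ * k 1 : ℝ) : ℂ) • blochWave ℓ f k)
  else (ℓ : ℂ) • blochWave ℓ (lineD f) k

/-- The derivative of `blochWave`. -/
def blochWaveFDeriv (ℓ : ℝ) (f : 𝓢(ℝ, ℂ)) (k : Plane) : Plane →L[ℝ] Fiber ℓ :=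
  (EuclideanSpace.proj 0 : Plane →L[ℝ] ℝ).smulRight (blochWaveDeriv ℓ f 0 k) +
    (EuclideanSpace.proj 1 : Plane →L[ℝ] ℝ).smulRight (blochWaveDeriv ℓ f 1 k)

/-- By linearity the remainder is the Zak image of a single function, to which `phaseShift_taylor`
and `norm_zakFiber_le` apply; it is therefore quadratic in `h`. -/
theorem hasFDerivAt_blochWave (hℓ : 0 < ℓ) (f : 𝓢(ℝ, ℂ)) (k : Plane) :
    HasFDerivAt (blochWave ℓ f) (blochWaveFDeriv ℓ f k) k := by
  obtain ⟨C, hC0, hC⟩ := phaseShift_taylor f (ℓ * k 1)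
  have hd : ∀ q₁ q₂ (g : 𝓢(ℝ, ℂ)), phaseShift q₁ q₂ g ∈ decaying := fun q₁ q₂ g =>
    phaseShift_mem_decaying q₁ q₂ (schwartz_mem_decaying g)
  rw [hasFDerivAt_iff_isLittleO_nhds_zero]
  refine Asymptotics.IsBigO.trans_isLittleO (g := fun h : Plane => ‖h‖ ^ 2) ?_
    (Asymptotics.isLittleO_norm_pow_id one_lt_two)
  refine Asymptotics.IsBigO.of_bound (4 * ℓ ^ 2 * C * √Real.pi) ?_
  -- The radius `ℓ⁻¹` guarantees `|δ₂| ≤ 1`.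
  filter_upwards [Metric.ball_mem_nhds (0 : Plane) (inv_pos.2 hℓ)] with h hh
  rw [mem_ball_zero_iff] at hh
  set q₁ := ℓ * k 0
  set q₂ := ℓ * k 1
  set δ₁ := ℓ * h 0
  set δ₂ := ℓ * h 1
  have hcoord : ∀ i, |ℓ * h i| ≤ ℓ * ‖h‖ := fun i => by
    rw [abs_mul, abs_of_pos hℓ, ← Real.norm_eq_abs]
    exact mul_le_mul_of_nonneg_left (PiLp.norm_apply_le h i) hℓ.le
  have hδ : |δ₂| ≤ 1 := (hcoord 1).trans (by
    rw [← mul_inv_cancel₀ hℓ.ne']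
    exact mul_le_mul_of_nonneg_left hh.le hℓ.le)
  have hmem : phaseShift q₁ q₂ (lineMul f) + (-(q₂ : ℂ)) • phaseShift q₁ q₂ f ∈ decaying :=
    decaying.add_mem (hd _ _ _) (decaying.smul_mem _ (hd _ _ _))
  have e : blochWave ℓ f (k + h) - blochWave ℓ f k - blochWaveFDeriv ℓ f k h =
      zakFiber ℓ (phaseShift (q₁ + δ₁) (q₂ + δ₂) f + ((-1 : ℂ) • phaseShift q₁ q₂ f +
        ((I * δ₁ : ℂ) • (phaseShift q₁ q₂ (lineMul f) + (-(q₂ : ℂ)) • phaseShift q₁ q₂ f) +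
          (-(δ₂ : ℂ)) • phaseShift q₁ q₂ (lineD f)))) := by
    rw [zakFiber_add (hd _ _ _) (decaying.add_mem (decaying.smul_mem _ (hd _ _ _))
      (decaying.add_mem (decaying.smul_mem _ hmem) (decaying.smul_mem _ (hd _ _ _)))),
      zakFiber_add (decaying.smul_mem _ (hd _ _ _))
      (decaying.add_mem (decaying.smul_mem _ hmem) (decaying.smul_mem _ (hd _ _ _))),
      zakFiber_add (decaying.smul_mem _ hmem) (decaying.smul_mem _ (hd _ _ _)),
      zakFiber_smul (hd _ _ _), zakFiber_smul hmem, zakFiber_smul (hd _ _ _),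
      zakFiber_add (hd _ _ _) (decaying.smul_mem _ (hd _ _ _)), zakFiber_smul (hd _ _ _)]
    have h1 : blochWave ℓ f (k + h) = zakFiber ℓ (phaseShift (q₁ + δ₁) (q₂ + δ₂) f) := by
      rw [blochWave, PiLp.add_apply, PiLp.add_apply, mul_add, mul_add]
    have h2 : ∀ (r : ℝ) (v : Fiber ℓ), r • v = (r : ℂ) • v := fun r v => (Complex.coe_smul r v).symm
    rw [h1]
    change _ - _ - (h 0 • blochWaveDeriv ℓ f 0 k + h 1 • blochWaveDeriv ℓ f 1 k) = _
    rw [h2, h2, blochWaveDeriv, blochWaveDeriv, if_pos rfl, if_neg one_ne_zero]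
    simp only [blochWave, δ₁, δ₂, q₁, q₂, Complex.ofReal_mul]
    module
  rw [e]
  refine (norm_zakFiber_le hℓ (C := C * (|δ₁| + |δ₂|) ^ 2) ?_ (fun t => ?_)).trans ?_
  · exact (decaying.add_mem (hd _ _ _) (decaying.add_mem (decaying.smul_mem _ (hd _ _ _))
      (decaying.add_mem (decaying.smul_mem _ hmem) (decaying.smul_mem _ (hd _ _ _))))).1
  · refine (le_of_eq (congrArg norm ?_)).trans (hC q₁ δ₁ δ₂ hδ t)
    simp only [Pi.add_apply, Pi.smul_apply, smul_eq_mul]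
    ring
  · rw [norm_pow, norm_norm]
    have : (|δ₁| + |δ₂|) ^ 2 ≤ (2 * (ℓ * ‖h‖)) ^ 2 :=
      pow_le_pow_left₀ (by positivity) (by linarith [hcoord 0, hcoord 1]) 2
    calc _ ≤ C * (2 * (ℓ * ‖h‖)) ^ 2 * √Real.pi :=
          mul_le_mul_of_nonneg_right (mul_le_mul_of_nonneg_left this hC0) (Real.sqrt_nonneg _)
      _ = _ := by ring

theorem differentiable_blochWave (hℓ : 0 < ℓ) (f : 𝓢(ℝ, ℂ)) :
    Differentiable ℝ (fun k => blochWave ℓ f k) :=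
  fun k => (hasFDerivAt_blochWave hℓ f k).differentiableAt

theorem contDiff_blochWave (hℓ : 0 < ℓ) (f : 𝓢(ℝ, ℂ)) :
    ContDiff ℝ 1 (fun k => blochWave ℓ f k) := by
  rw [contDiff_one_iff_fderiv]
  refine ⟨differentiable_blochWave hℓ f, ?_⟩
  have e : fderiv ℝ (fun k => blochWave ℓ f k) = blochWaveFDeriv ℓ f :=
    funext fun k => (hasFDerivAt_blochWave hℓ f k).fderiv
  have h1 := (differentiable_blochWave hℓ f).continuous
  have h2 := (differentiable_blochWave hℓ (lineMul f)).continuous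
  have h3 := (differentiable_blochWave hℓ (lineD f)).continuous
  have c0 : Continuous (blochWaveDeriv ℓ f 0) := by
    unfold blochWaveDeriv
    simp only [if_true]
    fun_prop
  have c1 : Continuous (blochWaveDeriv ℓ f 1) := by
    unfold blochWaveDeriv
    simp only [one_ne_zero, if_false]
    fun_prop
  rw [e]
  unfold blochWaveFDeriv
  refine Continuous.add ?_ ?_
  · exact (ContinuousLinearMap.smulRightL ℝ Plane (Fiber ℓ) (EuclideanSpace.proj 0)).continuous.comp c0
  · exact (ContinuousLinearMap.smulRightL ℝ Plane (Fiber ℓ) (EuclideanSpace.proj 1)).continuous.comp c1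

/-- Bilinear only over the reals, since it is conjugate-linear in the second argument; real
differentiation needs no more. -/
theorem isBoundedBilinearMap_rankOne {H : Type*} [NormedAddCommGroup H] [InnerProductSpace ℂ H] :
    IsBoundedBilinearMap ℝ (fun p : H × H => InnerProductSpace.rankOne ℂ p.1 p.2) where
  add_left x y z := by rw [map_add, add_apply]
  smul_left c x y := by
    ext v
    simp only [InnerProductSpace.rankOne_apply, smul_apply]
    rw [smul_comm]
  add_right x y z := by rw [map_add]
  smul_right c x y := by
    ext v
    simp only [InnerProductSpace.rankOne_apply, smul_apply]
    rw [← Complex.coe_smul, inner_smul_left, Complex.conj_ofReal, mul_smul, Complex.coe_smul]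
  bound := ⟨1, one_pos, fun x y => by rw [InnerProductSpace.norm_rankOne, one_mul]⟩

theorem contDiff_rankOne_self {V H : Type*} [NormedAddCommGroup V] [NormedSpace ℝ V]
    [NormedAddCommGroup H] [InnerProductSpace ℂ H] {u : V → H} (h : ContDiff ℝ 1 u) :
    ContDiff ℝ 1 (fun k => InnerProductSpace.rankOne ℂ (u k) (u k)) :=
  ContDiff.comp (g := fun p : H × H => InnerProductSpace.rankOne ℂ p.1 p.2)
    isBoundedBilinearMap_rankOne.contDiff (h.prodMk h)

theorem contDiff_blochProjection (hℓ : 0 < ℓ) (j : ℕ) : ContDiff ℝ 1 (blochProjection ℓ j) :=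
  contDiff_rankOne_self (contDiff_blochWave hℓ (hermiteFun j))

theorem fderiv_rankOne_self {V H : Type*} [NormedAddCommGroup V] [NormedSpace ℝ V]
    [NormedAddCommGroup H] [InnerProductSpace ℂ H] {u : V → H} {u' : V →L[ℝ] H} {k : V}
    (h : HasFDerivAt u u' k) (v : V) :
    fderiv ℝ (fun k => InnerProductSpace.rankOne ℂ (u k) (u k)) k v =
      InnerProductSpace.rankOne ℂ (u k) (u' v) + InnerProductSpace.rankOne ℂ (u' v) (u k) := by
  have h2 := HasFDerivAt.comp (f := fun k => (u k, u k))
    (g := fun p : H × H => InnerProductSpace.rankOne ℂ p.1 p.2) k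
    (isBoundedBilinearMap_rankOne.hasFDerivAt (u k, u k)) (h.prodMk h)
  have h3 := DFunLike.congr_fun h2.fderiv v
  refine h3.trans ?_
  rfl

theorem familyDeriv_blochProjection (hℓ : 0 < ℓ) (j : ℕ) (i : Fin 2) (k : Plane) :
    familyDeriv (blochProjection ℓ j) i k =
      InnerProductSpace.rankOne ℂ (blochWave ℓ (hermiteFun j) k)
        (blochWaveDeriv ℓ (hermiteFun j) i k) +
      InnerProductSpace.rankOne ℂ (blochWaveDeriv ℓ (hermiteFun j) i k)
        (blochWave ℓ (hermiteFun j) k) := by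
  have h3 : blochWaveFDeriv ℓ (hermiteFun j) k (EuclideanSpace.single i 1) =
      blochWaveDeriv ℓ (hermiteFun j) i k := by
    change (EuclideanSpace.single i (1 : ℝ) : Plane) 0 • blochWaveDeriv ℓ (hermiteFun j) 0 k +
      (EuclideanSpace.single i (1 : ℝ) : Plane) 1 • blochWaveDeriv ℓ (hermiteFun j) 1 k = _
    fin_cases i <;> simp
  rw [← h3]
  exact fderiv_rankOne_self (hasFDerivAt_blochWave hℓ (hermiteFun j) k) _

end Smooth

/-! ### The Berry curvature and the Chern number. -/

section Chern

variable {ℓ : ℝ}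

/-- Parseval in the chosen basis; the result no longer refers to that choice. -/
theorem opTrace_rankOne_mul {H : Type*} [NormedAddCommGroup H] [InnerProductSpace ℂ H]
    [CompleteSpace H] (u : H) (M : H →L[ℂ] H) :
    opTrace (InnerProductSpace.rankOne ℂ u u * M) = inner ℂ u (M u) := by
  rw [opTrace]
  set b := (exists_hilbertBasis ℂ H).choose_spec.choose
  have h := b.hasSum_inner_mul_inner (ContinuousLinearMap.adjoint M u) u
  rw [ContinuousLinearMap.adjoint_inner_left] at h
  rw [← h.tsum_eq]
  refine tsum_congr fun i => ?_
  change inner ℂ (b i) (inner ℂ u (M (b i)) • u) = _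
  rw [inner_smul_right, ContinuousLinearMap.adjoint_inner_left]

theorem lineMul_hermiteFun (j : ℕ) : lineMul (hermiteFun j) = ((√2 : ℝ) : ℂ)⁻¹ •
    ((√(j : ℝ) : ℂ) • hermiteFun (j - 1) + (√((j : ℝ) + 1) : ℂ) • hermiteFun (j + 1)) := by
  rw [lineMul_eq, lineLower_hermiteFun, lineRaise_hermiteFun]

theorem lineD_hermiteFun (j : ℕ) : lineD (hermiteFun j) = ((√2 : ℝ) : ℂ)⁻¹ •
    ((√(j : ℝ) : ℂ) • hermiteFun (j - 1) - (√((j : ℝ) + 1) : ℂ) • hermiteFun (j + 1)) := by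
  rw [lineD_eq, lineLower_hermiteFun, lineRaise_hermiteFun]

theorem inner_hermiteFun (n m : ℕ) :
    inner ℂ (lineIncl (hermiteFun n)) (lineIncl (hermiteFun m)) = if n = m then (1 : ℂ) else 0 :=
  orthonormal_iff_ite.1 orthonormal_hermiteFun n m

theorem sqrt_mul_inner_sub_one (j : ℕ) : (√(j : ℝ) : ℂ) *
    inner ℂ (lineIncl (hermiteFun j)) (lineIncl (hermiteFun (j - 1))) = 0 := by
  rw [inner_hermiteFun]
  cases j with
  | zero => simp
  | succ j => simp

theorem inner_hermiteFun_lineD (j : ℕ) :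
    inner ℂ (lineIncl (hermiteFun j)) (lineIncl (lineD (hermiteFun j))) = 0 := by
  rw [lineD_hermiteFun]
  simp only [map_smul, map_sub, inner_smul_right, inner_sub_right, sqrt_mul_inner_sub_one]
  simp [inner_hermiteFun]

/-- The neighbours `j - 1` and `j + 1` contribute `j / 2` and `-(j + 1) / 2`, the same cancellation
as in `levelCommutator_mul`. -/
theorem inner_lineMul_lineD (j : ℕ) :
    inner ℂ (lineIncl (lineMul (hermiteFun j))) (lineIncl (lineD (hermiteFun j))) = -1 / 2 := by
  have hs : (√(j : ℝ) : ℂ) * √(j : ℝ) = j := by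
    rw [← Complex.ofReal_mul, Real.mul_self_sqrt (by positivity)]
    simp
  have hs' := sqrt_succ_mul_self j
  rw [lineMul_hermiteFun, lineD_hermiteFun]
  simp only [map_smul, map_add, map_sub, inner_smul_right, inner_smul_left, inner_add_left,
    inner_sub_right, inner_hermiteFun, map_inv₀, Complex.conj_ofReal, if_true]
  rw [if_neg (by omega), if_neg (by omega)]
  linear_combination ((√(j : ℝ) : ℂ) * √(j : ℝ) - (√((j : ℝ) + 1) : ℂ) * √((j : ℝ) + 1)) *
    inv_sqrt_two_mul_self + (1 / 2) * hs - (1 / 2) * hs'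

/-- The Grassmann–Berry curvature of the Landau line bundles is constant. -/
theorem berryCurvature_blochProjection (hℓ : 0 < ℓ) (j : ℕ) (k : Plane) :
    berryCurvature (blochProjection ℓ j) k = -I * (ℓ : ℂ) ^ 2 := by
  have hx : blochWaveDeriv ℓ (hermiteFun j) 0 k = (ℓ * -I : ℂ) •
    (blochWave ℓ (lineMul (hermiteFun j)) k -
      ((ℓ * k 1 : ℝ) : ℂ) • blochWave ℓ (hermiteFun j) k) := if_pos rfl
  have hy : blochWaveDeriv ℓ (hermiteFun j) 1 k = (ℓ : ℂ) • blochWave ℓ (lineD (hermiteFun j)) k :=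
    if_neg one_ne_zero
  rw [berryCurvature, familyDeriv_blochProjection hℓ, familyDeriv_blochProjection hℓ]
  rw [show blochProjection ℓ j k = InnerProductSpace.rankOne ℂ (blochWave ℓ (hermiteFun j) k)
    (blochWave ℓ (hermiteFun j) k) from rfl, opTrace_rankOne_mul]
  set u := blochWave ℓ (hermiteFun j) k with hu
  set x := blochWaveDeriv ℓ (hermiteFun j) 0 k
  set y := blochWaveDeriv ℓ (hermiteFun j) 1 k
  have huu : inner ℂ u u = (1 : ℂ) := by
    rw [hu, inner_blochWave_schwartz hℓ, inner_hermiteFun, if_pos rfl]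
  have huy : inner ℂ u y = (0 : ℂ) := by
    rw [hy, inner_smul_right, hu, inner_blochWave_schwartz hℓ, inner_hermiteFun_lineD, mul_zero]
  have hyu : inner ℂ y u = (0 : ℂ) := by rw [← inner_conj_symm, huy, map_zero]
  have hxy : inner ℂ x y = -I * (ℓ : ℂ) ^ 2 / 2 := by
    rw [hx, hy, inner_smul_left, inner_smul_right, inner_sub_left, inner_smul_left,
      inner_blochWave_schwartz hℓ, hu, inner_blochWave_schwartz hℓ, inner_lineMul_lineD,
      inner_hermiteFun_lineD]
    simp only [map_mul, map_neg, Complex.conj_I, Complex.conj_ofReal]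
    ring
  have hyx : inner ℂ y x = I * (ℓ : ℂ) ^ 2 / 2 := by
    rw [← inner_conj_symm, hxy, map_div₀, map_mul, map_neg, map_pow, Complex.conj_I,
      Complex.conj_ofReal, Complex.conj_ofNat, neg_neg]
  -- The vector `x` has a component along `u`, but it drops out because `y ⊥ u`. What remains is
  -- `⟨x, y⟩ - ⟨y, x⟩`.
  change inner ℂ u ((inner ℂ x (inner ℂ y u • u + inner ℂ u u • y) • u +
    inner ℂ u (inner ℂ y u • u + inner ℂ u u • y) • x) -
    (inner ℂ y (inner ℂ x u • u + inner ℂ u u • x) • u +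
    inner ℂ u (inner ℂ x u • u + inner ℂ u u • x) • y)) = _
  simp only [inner_add_right, inner_sub_right, inner_smul_right, huu, huy, hyu, hxy, hyx]
  ring

theorem chernNumber_blochProjection (hℓ : 0 < ℓ) (j : ℕ) :
    chernNumber (blochProjection ℓ j) = 1 := by
  rw [chernNumber]
  simp only [berryCurvature_blochProjection hℓ]
  have h := setIntegral_square_div (F := fun _ _ => I / (2 * (Real.pi : ℂ)) * (-I * (ℓ : ℂ) ^ 2))
    continuous_const side_pos.le (inv_pos.2 hℓ)
  have h4 : brillouinCell ℓ = {k : Plane | ∀ i, k i ∈ Set.Icc 0 (side * ℓ⁻¹)} := rfl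
  rw [h4, h]
  simp only [intervalIntegral.integral_const, sub_zero, Complex.real_smul]
  have hl : (ℓ : ℂ) ≠ 0 := by exact_mod_cast hℓ.ne'
  have hpi : (Real.pi : ℂ) ≠ 0 := by exact_mod_cast Real.pi_ne_zero
  have hs : (side : ℂ) * side = 2 * Real.pi := by exact_mod_cast side_mul_self
  rw [← mul_assoc (side : ℂ), hs]
  push_cast
  field_simp
  rw [I_sq]
  ring

end Chern

/-! ### Vanishing of continuous periodic functions with zero Fourier coefficients. -/

section Fourier

/-- A continuous function with summable Fourier coefficients is the pointwise sum of its Fourier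
series, which here is zero. -/
theorem eq_zero_of_integral_character {c : ℝ → ℂ} (hc : Continuous c)
    (hp : Function.Periodic c side)
    (h : ∀ n : ℤ, ∫ t in (0 : ℝ)..side, character n t * c t = 0) (t : ℝ) : c t = 0 := by
  have : Fact (0 < side) := ⟨side_pos⟩
  let g : C(AddCircle side, ℂ) := ⟨hp.lift, continuous_coinduced_dom.2 hc⟩
  have hg : ∀ n : ℤ, fourierCoeff g n = 0 := fun n => by
    rw [fourierCoeff_eq_intervalIntegral g n 0, zero_add]
    have e : ∀ x : ℝ, (fourier (-n) : AddCircle side → ℂ) x • g x = character (-n) x * c x :=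
      fun x => by
        have hs : (side : ℂ) ≠ 0 := by exact_mod_cast side_pos.ne'
        have hss : (side : ℂ) * side = 2 * Real.pi := by exact_mod_cast side_mul_self
        rw [fourier_coe_apply, smul_eq_mul, character, ← hss]
        congr 2
        push_cast
        field_simp
    simp only [e]
    rw [h, smul_zero]
  have hsum := has_pointwise_sum_fourier_series_of_summable (f := g)
    (by rw [funext hg]; exact summable_zero) (t : AddCircle side)
  simp only [hg, zero_smul] at hsum
  exact hsum.unique hasSum_zero

theorem eq_zero_of_integral_character_mul {F : ℝ → ℝ → ℂ} (hF : Continuous (Function.uncurry F))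
    (hp₁ : ∀ s t, F (s + side) t = F s t) (hp₂ : ∀ s t, F s (t + side) = F s t)
    (h : ∀ m n : ℤ, ∫ s in (0 : ℝ)..side, ∫ t in (0 : ℝ)..side,
      character m s * character n t * F s t = 0) (s t : ℝ) : F s t = 0 := by
  have hn := continuous_character
  have hG : ∀ n : ℤ, ∀ s, ∫ t in (0 : ℝ)..side, character n t * F s t = 0 := fun n => by
    refine eq_zero_of_integral_character ?_ (fun s => ?_) (fun m => ?_)
    · refine intervalIntegral.continuous_parametric_intervalIntegral_of_continuous' ?_ _ _
      exact ((hn n).comp continuous_snd).mul hF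
    · simp only [hp₁]
    · rw [← h m n]
      refine intervalIntegral.integral_congr fun s _ => ?_
      simp only [mul_assoc, intervalIntegral.integral_const_mul]
  exact eq_zero_of_integral_character (hF.comp (Continuous.prodMk continuous_const continuous_id))
    (hp₂ s) (fun n => hG n s) t

theorem latticePt_single (i l : Fin 2) : latticePt (Pi.single i 1) l = if l = i then 1 else 0 := by
  rw [latticePt_apply, Pi.single_apply]
  split_ifs <;> simp

/-- A continuous periodic function on the Brillouin torus vanishes if all its Fourier coefficients
do. -/
theorem eq_zero_of_setIntegral_brillouinCell {ℓ : ℝ} (hℓ : 0 < ℓ) {c : Plane → ℂ}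
    (hc : Continuous c)
    (hp : ∀ (n : Fin 2 → ℤ) k, c (k + (√(2 * Real.pi) / ℓ) • latticePt n) = c k)
    (h : ∀ m : Fin 2 → ℤ, ∫ k in brillouinCell ℓ,
      exp (I * ((inner ℝ k ((√(2 * Real.pi) * ℓ) • latticePt m) : ℝ) : ℂ)) * c k = 0) (k : Plane) :
    c k = 0 := by
  let F : ℝ → ℝ → ℂ := fun s t => c (WithLp.toLp 2 ![s * ℓ⁻¹, t * ℓ⁻¹])
  have hF : Continuous (Function.uncurry F) := by
    refine hc.comp ((PiLp.continuous_toLp 2 _).comp (continuous_pi fun i => ?_))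
    fin_cases i
    · exact continuous_fst.mul continuous_const
    · exact continuous_snd.mul continuous_const
  have hFc : ∀ k : Plane, F (k 0 / ℓ⁻¹) (k 1 / ℓ⁻¹) = c k := fun k => by
    refine congrArg c (PiLp.ext fun i => ?_)
    fin_cases i <;> simp [hℓ.ne']
  have hshift : ∀ s t (i : Fin 2), F (s + if 0 = i then side else 0) (t + if 1 = i then side else 0) =
      F s t := fun s t i => by
    refine Eq.trans (congrArg c (PiLp.ext fun l => ?_)) (hp (Pi.single i 1) _)
    rw [PiLp.add_apply, PiLp.smul_apply, latticePt_single, smul_eq_mul, ← side]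
    fin_cases l <;> fin_cases i <;> simp <;> ring
  rw [← hFc]
  refine eq_zero_of_integral_character_mul hF (fun s t => ?_) (fun s t => ?_) (fun m n => ?_) _ _
  · simpa using hshift s t 0
  · simpa using hshift s t 1
  · have h1 := h ![m, n]
    have h4 : brillouinCell ℓ = {k : Plane | ∀ i, k i ∈ Set.Icc 0 (side * ℓ⁻¹)} := rfl
    have e : ∀ k : Plane,
        exp (I * ((inner ℝ k ((√(2 * Real.pi) * ℓ) • latticePt ![m, n]) : ℝ) : ℂ)) * c k =
        character m (k 0 / ℓ⁻¹) * character n (k 1 / ℓ⁻¹) * F (k 0 / ℓ⁻¹) (k 1 / ℓ⁻¹) := fun k => by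
      rw [hFc, character, character, ← Complex.exp_add, PiLp.inner_apply, Fin.sum_univ_two]
      simp only [RCLike.inner_apply, conj_trivial, PiLp.smul_apply, latticePt_apply, smul_eq_mul,
        side, Matrix.cons_val_zero, Matrix.cons_val_one]
      congr 2
      push_cast
      field_simp
    simp only [e] at h1
    have h2 := setIntegral_square_div (F := fun s t => character m s * character n t * F s t)
      ((((continuous_character m).comp continuous_fst).mul
        ((continuous_character n).comp continuous_snd)).mul hF) side_pos.le (inv_pos.2 hℓ)
    rw [h4, h2] at h1
    refine (mul_eq_zero.1 h1).resolve_left (pow_ne_zero 2 ?_)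
    exact_mod_cast (inv_pos.2 hℓ).ne'

end Fourier

/-! ### Uniqueness of the fiber operators. -/

section Uniqueness

variable {ℓ : ℝ}

/-- The open magnetic unit cell. -/
def openCell (ℓ : ℝ) : Set Plane := {y | ∀ i, y i ∈ Set.Ioo 0 (side * ℓ)}

theorem unitCell_ae_eq_openCell (ℓ : ℝ) : unitCell ℓ =ᵐ[volume] openCell ℓ := by
  have h := (Measure.univ_pi_Ioo_ae_eq_Icc (μ := fun _ : Fin 2 => (volume : Measure ℝ))
    (f := fun _ => 0) (g := fun _ => side * ℓ))
  have h2 := (PiLp.volume_preserving_ofLp (Fin 2)).quasiMeasurePreserving.preimage_ae_eq h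
  have e1 : (WithLp.ofLp : Plane → _) ⁻¹' Set.univ.pi (fun _ => Set.Ioo 0 (side * ℓ)) =
      openCell ℓ := by
    ext y
    simp [openCell]
  have e2 : (WithLp.ofLp : Plane → _) ⁻¹' Set.Icc (fun _ => 0) (fun _ => side * ℓ) =
      unitCell ℓ := by
    ext y
    simp only [Set.mem_preimage, Set.mem_Icc, Pi.le_def, unitCell, Set.mem_ofPred_eq, forall_and]
    rfl
  rw [e1, e2] at h2
  exact h2.symm

theorem isOpen_openCell (ℓ : ℝ) : IsOpen (openCell ℓ) := by
  have : openCell ℓ = ⋂ i, (fun y : Plane => y i) ⁻¹' Set.Ioo 0 (side * ℓ) := by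
    ext y
    simp [openCell]
  rw [this]
  exact isOpen_iInter_of_finite fun i => isOpen_Ioo.preimage (by fun_prop)

theorem openCell_subset_halfOpenCell (ℓ : ℝ) : openCell ℓ ⊆ halfOpenCell ℓ :=
  fun _ hy i => Set.Ioo_subset_Ico_self (hy i)

theorem ae_mem_openCell (ℓ : ℝ) :
    ∀ᵐ y ∂(volume : Measure Plane).restrict (unitCell ℓ), y ∈ openCell ℓ := by
  rw [Measure.restrict_congr_set (unitCell_ae_eq_openCell ℓ)]
  exact ae_restrict_mem (isOpen_openCell ℓ).measurableSet

/-- The plane wave `y ↦ e^{-i k·y} φ(y)` in the fiber. -/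
def cellWave (ℓ : ℝ) (φ : Plane → ℂ) (k : Plane) : Fiber ℓ :=
  toL2 _ fun y => exp (-I * ((inner ℝ k y : ℝ) : ℂ)) * φ y

theorem memLp_cellWave {φ : Plane → ℂ} (hφ : Continuous φ) (k : Plane) :
    MemLp (fun y => exp (-I * ((inner ℝ k y : ℝ) : ℂ)) * φ y) 2
      ((volume : Measure Plane).restrict (unitCell ℓ)) :=
  memLp_unitCell (by fun_prop)

theorem continuous_cellWave {φ : Plane → ℂ} (hφ : Continuous φ) : Continuous (cellWave ℓ φ) := by
  obtain ⟨C, hC⟩ := (isCompact_unitCell ℓ).exists_bound_of_continuousOn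
    (f := fun y => (‖y‖ : ℂ) * φ y) (by fun_prop)
  have hC' : ∀ᵐ y ∂(volume : Measure Plane).restrict (unitCell ℓ), ‖(‖y‖ : ℂ) * φ y‖ ≤ max C 0 :=
    (ae_restrict_iff' (isCompact_unitCell ℓ).measurableSet).2
      (Eventually.of_forall fun y hy => (hC y hy).trans (le_max_left _ _))
  set M : NNReal := (measureUnivNNReal ((volume : Measure Plane).restrict (unitCell ℓ))) ^
    (2 : ℝ≥0∞).toReal⁻¹ * (max C 0).toNNReal
  refine (LipschitzWith.of_dist_le_mul (K := M) fun k k' => ?_).continuous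
  rw [dist_eq_norm, dist_eq_norm]
  have hb := Lp.norm_le_of_ae_bound (f := cellWave ℓ φ k - cellWave ℓ φ k')
    (C := max C 0 * ‖k - k'‖) (by positivity) ?_
  · refine hb.trans (le_of_eq ?_)
    simp only [M, NNReal.coe_mul, NNReal.coe_rpow, Real.coe_toNNReal _ (le_max_right C 0)]
    ring
  · filter_upwards [hC', toL2_coeFn (memLp_cellWave (ℓ := ℓ) hφ k),
      toL2_coeFn (memLp_cellWave (ℓ := ℓ) hφ k'),
      Lp.coeFn_sub (cellWave ℓ φ k) (cellWave ℓ φ k')] with y h1 h2 h3 h4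
    rw [h4, Pi.sub_apply, cellWave, cellWave, h2, h3]
    have e : exp (-I * ((inner ℝ k y : ℝ) : ℂ)) * φ y - exp (-I * ((inner ℝ k' y : ℝ) : ℂ)) * φ y =
        exp (-I * ((inner ℝ k' y : ℝ) : ℂ)) * ((exp (I * ((inner ℝ (k' - k) y : ℝ) : ℂ)) - 1) * φ y) := by
      have : exp (-I * ((inner ℝ k y : ℝ) : ℂ)) = exp (-I * ((inner ℝ k' y : ℝ) : ℂ)) *
          exp (I * ((inner ℝ (k' - k) y : ℝ) : ℂ)) := by
        rw [← Complex.exp_add, inner_sub_left]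
        push_cast
        ring_nf
      rw [this]
      ring
    rw [e, norm_mul, exp_neg_I_mul, RCLike.norm_conj, norm_exp_I_mul, one_mul, norm_mul]
    rw [norm_mul, norm_real, norm_norm] at h1
    have h5 : ‖exp (I * ((inner ℝ (k' - k) y : ℝ) : ℂ)) - 1‖ ≤ ‖k - k'‖ * ‖y‖ := by
      refine Real.norm_exp_I_mul_ofReal_sub_one_le.trans ((norm_inner_le_norm _ _).trans_eq ?_)
      rw [norm_sub_rev]
    calc _ ≤ ‖k - k'‖ * ‖y‖ * ‖φ y‖ := mul_le_mul_of_nonneg_right h5 (norm_nonneg _)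
      _ = ‖k - k'‖ * (‖y‖ * ‖φ y‖) := mul_assoc _ _ _
      _ ≤ ‖k - k'‖ * max C 0 := mul_le_mul_of_nonneg_left h1 (norm_nonneg _)
      _ = _ := mul_comm _ _

theorem phaseMul_cellWave {φ : Plane → ℂ} (hφ : Continuous φ) (n : Fin 2 → ℤ) (k : Plane) :
    phaseMul ℓ n (cellWave ℓ φ k) = cellWave ℓ φ (k + (√(2 * Real.pi) / ℓ) • latticePt n) := by
  refine Lp.ext ?_
  filter_upwards [phaseMul_coeFn n (cellWave ℓ φ k), toL2_coeFn (memLp_cellWave (ℓ := ℓ) hφ k),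
    toL2_coeFn (memLp_cellWave (ℓ := ℓ) hφ (k + (√(2 * Real.pi) / ℓ) • latticePt n))] with y h1 h2 h3
  rw [h1, cellWave, cellWave, h2, h3, ← mul_assoc, ← Complex.exp_add, inner_add_left]
  push_cast
  ring_nf

/-- The inverse magnetic translate of a function. -/
def magneticShift (ℓ : ℝ) (m : Fin 2 → ℤ) (ψ : Plane → ℂ) (x : Plane) : ℂ :=
  ((-1 : ℂ) ^ (m 0 * m 1)) *
    exp (I * ((√(Real.pi / 2) * (m 0 * x 1 - m 1 * x 0) / ℓ : ℝ) : ℂ)) *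
    ψ (x + (√(2 * Real.pi) * ℓ) • latticePt m)

theorem continuous_magneticShift (m : Fin 2 → ℤ) {ψ : Plane → ℂ} (hψ : Continuous ψ) :
    Continuous (magneticShift ℓ m ψ) := by
  unfold magneticShift
  fun_prop

theorem hasCompactSupport_magneticShift (m : Fin 2 → ℤ) {ψ : Plane → ℂ}
    (hψ : HasCompactSupport ψ) : HasCompactSupport (magneticShift ℓ m ψ) :=
  (hψ.comp_homeomorph (Homeomorph.addRight ((√(2 * Real.pi) * ℓ) • latticePt m))).mul_left

/-- For a bump inside the open cell only one lattice term survives. The shift by `m` multiplies the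
transform by a Fourier mode in `k`, and all modes arise in this way. -/
theorem blochZak_magneticShift (hℓ : 0 < ℓ) (m : Fin 2 → ℤ) {ψ : Plane → ℂ} (hψ : Continuous ψ)
    (hs : tsupport ψ ⊆ openCell ℓ) (k : Plane) :
    blochZak ℓ (magneticShift ℓ m ψ) k =
      exp (I * ((inner ℝ k ((√(2 * Real.pi) * ℓ) • latticePt m) : ℝ) : ℂ)) • cellWave ℓ ψ k := by
  rw [cellWave, ← toL2_smul (memLp_cellWave hψ k)]
  refine toL2_congr ((memLp_cellWave hψ k).const_smul _) ?_
  filter_upwards [ae_mem_openCell ℓ] with y hy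
  have hy' := openCell_subset_halfOpenCell ℓ hy
  rw [blochZakFun, tsum_eq_single m fun m' hm' => ?_]
  · have hmm : (m 0 : ℝ) * (y 1 - √(2 * Real.pi) * ℓ * m 1) - m 1 * (y 0 - √(2 * Real.pi) * ℓ * m 0)
      = m 0 * y 1 - m 1 * y 0 := by ring
    have h1 : ((-1 : ℂ) ^ (m 0 * m 1)) * (-1 : ℂ) ^ (m 0 * m 1) = 1 := by
      rw [← mul_zpow]
      simp
    have h2 := Complex.exp_neg (I * ((√(Real.pi / 2) * (m 0 * y 1 - m 1 * y 0) / ℓ : ℝ) : ℂ))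
    have h3 := Complex.exp_ne_zero (I * ((√(Real.pi / 2) * (m 0 * y 1 - m 1 * y 0) / ℓ : ℝ) : ℂ))
    have h4 : exp (-I * ((inner ℝ k (y - (√(2 * Real.pi) * ℓ) • latticePt m) : ℝ) : ℂ)) =
        exp (I * ((inner ℝ k ((√(2 * Real.pi) * ℓ) • latticePt m) : ℝ) : ℂ)) *
          exp (-I * ((inner ℝ k y : ℝ) : ℂ)) := by
      rw [← Complex.exp_add, inner_sub_right]
      push_cast
      ring_nf
    rw [magneticTranslation, magneticShift, sub_add_cancel, h4]
    simp only [PiLp.sub_apply, PiLp.smul_apply, latticePt_apply, smul_eq_mul, Pi.smul_apply, hmm]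
    simp only [neg_mul, h2]
    generalize (-1 : ℂ) ^ (m 0 * m 1) = a at h1 ⊢
    generalize exp (I * ((√(Real.pi / 2) * (m 0 * y 1 - m 1 * y 0) / ℓ : ℝ) : ℂ)) = b at h3 ⊢
    generalize exp (I * ((inner ℝ k ((√(2 * Real.pi) * ℓ) • latticePt m) : ℝ) : ℂ)) = c
    generalize exp (-(I * ((inner ℝ k y : ℝ) : ℂ))) = d
    rw [show c * d * (a * b⁻¹ * (a * b * ψ y)) = c * (d * ψ y) * (a * a) * (b⁻¹ * b) by ring, h1,
      inv_mul_cancel₀ h3, mul_one, mul_one]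
  · rw [magneticTranslation, magneticShift]
    have h0 : ψ (y - (√(2 * Real.pi) * ℓ) • latticePt m' + (√(2 * Real.pi) * ℓ) • latticePt m) = 0 := by
      by_contra hne
      have h1 := openCell_subset_halfOpenCell ℓ (hs (subset_tsupport _ hne))
      have h2 : y - (√(2 * Real.pi) * ℓ) • latticePt m' + (√(2 * Real.pi) * ℓ) • latticePt m =
          y + (side * ℓ) • latticePt (m - m') := by
        refine PiLp.ext fun i => ?_
        simp only [PiLp.add_apply, PiLp.sub_apply, PiLp.smul_apply, latticePt_apply, smul_eq_mul,
          Pi.sub_apply, Int.cast_sub, side]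
        ring
      have h3 : y + (side * ℓ) • latticePt 0 = y := by
        refine PiLp.ext fun i => ?_
        simp only [PiLp.add_apply, PiLp.smul_apply, latticePt_apply, Pi.zero_apply, Int.cast_zero,
          smul_zero, add_zero]
      rw [h2, mem_halfOpenCell_iff hℓ] at h1
      rw [← h3, mem_halfOpenCell_iff hℓ] at hy'
      exact hm' (sub_eq_zero.1 (h1.trans hy'.symm)).symm
    rw [h0, mul_zero, mul_zero, mul_zero]

/-- The fiber matrix element is continuous in `k`, periodic by equivariance, and its Fourier
coefficients are matrix elements of `T` up to a fixed factor. Two families for the same `T`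
therefore have the same matrix elements. -/
theorem inner_cellWave_eq_of_isBlochFamily (hℓ : 0 < ℓ) {T : L2 →L[ℂ] L2}
    {P P' : Plane → Fiber ℓ →L[ℂ] Fiber ℓ} (hP : IsBlochFamily ℓ T P) (hP' : IsBlochFamily ℓ T P')
    {φ ψ : Plane → ℂ} (hφ : Continuous φ) (hφc : HasCompactSupport φ) (hφs : tsupport φ ⊆ openCell ℓ)
    (hψ : Continuous ψ) (hψc : HasCompactSupport ψ) (hψs : tsupport ψ ⊆ openCell ℓ) (k : Plane) :
    inner ℂ (cellWave ℓ φ k) ((P k - P' k) (cellWave ℓ ψ k)) = 0 := by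
  have hcφ := continuous_cellWave (ℓ := ℓ) hφ
  have hcψ := continuous_cellWave (ℓ := ℓ) hψ
  have hper : ∀ {Q : Plane → Fiber ℓ →L[ℂ] Fiber ℓ}, IsBlochFamily ℓ T Q → ∀ (n : Fin 2 → ℤ) k,
      inner ℂ (cellWave ℓ φ (k + (√(2 * Real.pi) / ℓ) • latticePt n))
        (Q (k + (√(2 * Real.pi) / ℓ) • latticePt n)
          (cellWave ℓ ψ (k + (√(2 * Real.pi) / ℓ) • latticePt n))) =
      inner ℂ (cellWave ℓ φ k) (Q k (cellWave ℓ ψ k)) := fun hQ n k => by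
    rw [← phaseMul_cellWave hφ, ← phaseMul_cellWave hψ, hQ.equivariant, inner_phaseMul]
  have hcont : ∀ {Q : Plane → Fiber ℓ →L[ℂ] Fiber ℓ}, IsBlochFamily ℓ T Q →
      Continuous fun k => inner ℂ (cellWave ℓ φ k) (Q k (cellWave ℓ ψ k)) := fun hQ =>
    hcφ.inner (hQ.continuous.clm_apply hcψ)
  have hconst : ((ℓ ^ 2 / (2 * Real.pi) : ℝ) : ℂ) ≠ 0 := by
    have : ℓ ^ 2 / (2 * Real.pi) ≠ 0 := by positivity
    exact_mod_cast this
  have hcoef : ∀ {Q : Plane → Fiber ℓ →L[ℂ] Fiber ℓ}, IsBlochFamily ℓ T Q → ∀ m : Fin 2 → ℤ,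
      inner ℂ (toL2 volume (magneticShift ℓ 0 φ)) (T (toL2 volume (magneticShift ℓ m ψ))) =
      ((ℓ ^ 2 / (2 * Real.pi) : ℝ) : ℂ) * ∫ k in brillouinCell ℓ,
        exp (I * ((inner ℝ k ((√(2 * Real.pi) * ℓ) • latticePt m) : ℝ) : ℂ)) *
          inner ℂ (cellWave ℓ φ k) (Q k (cellWave ℓ ψ k)) := fun {Q} hQ m => by
    rw [hQ.decomposition _ _ (continuous_magneticShift 0 hφ) (hasCompactSupport_magneticShift 0 hφc)
      (continuous_magneticShift m hψ) (hasCompactSupport_magneticShift m hψc)]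
    congr 1
    refine integral_congr_ae (Eventually.of_forall fun k => ?_)
    have h0 : latticePt 0 = 0 := PiLp.ext fun i => by simp [latticePt_apply]
    simp only [blochZak_magneticShift hℓ _ hφ hφs, blochZak_magneticShift hℓ _ hψ hψs, h0, smul_zero,
      inner_zero_right, Complex.ofReal_zero, mul_zero, Complex.exp_zero, one_smul, map_smul,
      inner_smul_right]
  have key := eq_zero_of_setIntegral_brillouinCell hℓ (c := fun k =>
    inner ℂ (cellWave ℓ φ k) (P k (cellWave ℓ ψ k)) - inner ℂ (cellWave ℓ φ k) (P' k (cellWave ℓ ψ k)))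
    ((hcont hP).sub (hcont hP')) (fun n k => by rw [hper hP, hper hP']) (fun m => ?_) k
  · rw [sub_apply, inner_sub_right]
    exact key
  · have hint : ∀ {Q : Plane → Fiber ℓ →L[ℂ] Fiber ℓ}, IsBlochFamily ℓ T Q → IntegrableOn (fun k =>
        exp (I * ((inner ℝ k ((√(2 * Real.pi) * ℓ) • latticePt m) : ℝ) : ℂ)) *
          inner ℂ (cellWave ℓ φ k) (Q k (cellWave ℓ ψ k))) (brillouinCell ℓ) := fun hQ => by
      refine ContinuousOn.integrableOn_compact (isCompact_brillouinCell ℓ) (Continuous.continuousOn ?_)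
      exact Continuous.mul (by fun_prop) (hcont hQ)
    simp only [mul_sub]
    rw [integral_sub (hint hP) (hint hP'), sub_eq_zero]
    exact mul_left_cancel₀ hconst ((hcoef hP m).symm.trans (hcoef hP' m))

theorem eq_zero_of_inner_cellWave {k : Plane} {v : Fiber ℓ}
    (h : ∀ φ : Plane → ℂ, Continuous φ → HasCompactSupport φ → tsupport φ ⊆ openCell ℓ →
      inner ℂ (cellWave ℓ φ k) v = 0) : v = 0 := by
  rw [Lp.eq_zero_iff_ae_eq_zero]
  set f : Plane → ℂ := fun y => exp (I * ((inner ℝ k y : ℝ) : ℂ)) * v y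
  have hv : Integrable v ((volume : Measure Plane).restrict (unitCell ℓ)) :=
    (Lp.memLp v).integrable one_le_two
  have hf : Integrable f ((volume : Measure Plane).restrict (unitCell ℓ)) := by
    refine hv.mono ?_ (Eventually.of_forall fun y => ?_)
    · exact (Continuous.aestronglyMeasurable (by fun_prop)).mul hv.aestronglyMeasurable
    · rw [norm_mul, norm_exp_I_mul, one_mul]
  have key := (isOpen_openCell ℓ).ae_eq_zero_of_integral_contDiff_smul_eq_zero
    (hf.locallyIntegrable.locallyIntegrableOn _) fun g hg hgc hgs => ?_
  · filter_upwards [key, ae_mem_openCell ℓ] with y h1 h2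
    exact (mul_eq_zero.1 (h1 h2)).resolve_left (Complex.exp_ne_zero _)
  · have hgcont : Continuous fun y => (g y : ℂ) := Complex.continuous_ofReal.comp hg.continuous
    have hsub : Function.support (fun y => (g y : ℂ)) = Function.support g := by
      ext y
      simp
    have h1 := h (fun y => (g y : ℂ)) hgcont (hgc.comp_left Complex.ofReal_zero)
      (by rw [tsupport, hsub]; exact hgs)
    rw [L2.inner_def] at h1
    rw [← h1]
    refine integral_congr_ae ?_
    filter_upwards [toL2_coeFn (memLp_cellWave (ℓ := ℓ) hgcont k)] with y hy
    rw [RCLike.inner_apply, cellWave, hy, map_mul, exp_neg_I_mul, Complex.conj_conj,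
      Complex.conj_ofReal, Complex.real_smul]
    ring

/-- The fiber operators of a decomposable operator are unique. -/
theorem IsBlochFamily.unique (hℓ : 0 < ℓ) {T : L2 →L[ℂ] L2}
    {P P' : Plane → Fiber ℓ →L[ℂ] Fiber ℓ} (hP : IsBlochFamily ℓ T P)
    (hP' : IsBlochFamily ℓ T P') : P = P' := by
  funext k
  rw [← sub_eq_zero]
  set D := P k - P' k with hD
  have h1 : ∀ ψ : Plane → ℂ, Continuous ψ → HasCompactSupport ψ → tsupport ψ ⊆ openCell ℓ →
      D (cellWave ℓ ψ k) = 0 := fun ψ hψ hψc hψs =>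
    eq_zero_of_inner_cellWave (k := k) fun φ hφ hφc hφs =>
      inner_cellWave_eq_of_isBlochFamily hℓ hP hP' hφ hφc hφs hψ hψc hψs k
  -- `D` vanishes on the cell waves. Passing to the adjoint uses `eq_zero_of_inner_cellWave` a
  -- second time and avoids a density statement for their span.
  have h2 : ∀ w, ContinuousLinearMap.adjoint D w = 0 := fun w =>
    eq_zero_of_inner_cellWave (k := k) fun ψ hψ hψc hψs => by
      rw [ContinuousLinearMap.adjoint_inner_right, h1 ψ hψ hψc hψs, inner_zero_left]
  refine ContinuousLinearMap.ext fun w => ?_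
  refine ext_inner_left ℂ fun x => ?_
  rw [← ContinuousLinearMap.adjoint_inner_left, h2, inner_zero_left, zero_apply, inner_zero_right]

end Uniqueness

/-! ### Identification of the chosen family with the explicit one. -/

section LandauFamily

variable {ε ℓ : ℝ}

theorem isBlochFamily_blochProjection (hε : 0 < ε) (hℓ : 0 < ℓ) (j : ℕ) :
    IsBlochFamily ℓ (landauProjection ε ℓ j) (blochProjection ℓ j) where
  continuous := (contDiff_blochProjection hℓ j).continuous
  equivariant := blochProjection_equivariant hℓ j
  decomposition := fun _ _ hφ hφc hψ hψc => decomposition_blochProjection hε hℓ j hφ hφc hψ hψc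

theorem landauFamily_eq (hε : 0 < ε) (hℓ : 0 < ℓ) (j : ℕ) :
    landauFamily ε ℓ j = blochProjection ℓ j := by
  have h : ∃ P, IsBlochFamily ℓ (landauProjection ε ℓ j) P :=
    ⟨_, isBlochFamily_blochProjection hε hℓ j⟩
  rw [landauFamily, dif_pos h]
  exact h.choose_spec.unique hℓ (isBlochFamily_blochProjection hε hℓ j)

end LandauFamily

end Landau

end

theorem mainTheorem9 (ε ℓ ξ : ℝ) (hε : 0 < ε) (hℓ : 0 < ℓ) (hξ : 0 ≤ ξ) (j : ℕ) :
    -- the Landau line bundle: a `C¹` family of rank-one projections which decomposes `Π_j`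
    (Landau.IsBlochFamily ℓ (Landau.landauProjection ε ℓ j) (Landau.landauFamily ε ℓ j) ∧
      ContDiff ℝ 1 (Landau.landauFamily ε ℓ j) ∧
      (∀ k, IsStarProjection (Landau.landauFamily ε ℓ j k)) ∧
      ∀ k, Module.finrank ℂ (Landau.landauBundle ε ℓ j k) = 1) ∧
    -- `Π_j [∂₁(Π_j), ∂₂(Π_j)] = -i ℓ² Π_j`
    Landau.curvatureOperator ε ℓ j = (-Complex.I * (ℓ : ℂ) ^ 2) • Landau.landauProjection ε ℓ j ∧
    -- the operator under the Dixmier trace is a measurable element of the Dixmier ideal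
    Landau.IsDixmierMeasurable
      (Landau.oscillatorResolvent ℓ ξ * Landau.curvatureOperator ε ℓ j) ∧
    -- the Chern number formula, for every Dixmier trace
    (∀ t₀ : ℝ, Real.exp 1 < t₀ → ∀ ω : Landau.DixmierState t₀,
      Landau.chernNumber (Landau.landauFamily ε ℓ j) =
        Complex.I / (ℓ : ℂ) ^ 2 * Landau.dixmierTrace ω
          (Landau.oscillatorResolvent ℓ ξ * Landau.curvatureOperator ε ℓ j)) ∧
    Landau.chernNumber (Landau.landauFamily ε ℓ j) = 1 := by 
  have hfam := Landau.landauFamily_eq hε hℓ j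
  obtain ⟨hmeas, htrace⟩ := Landau.dixmier_resolvent_curvature hε hℓ hξ j
  have hchern := Landau.chernNumber_blochProjection hℓ j
  refine ⟨⟨?_, ?_, fun k => ?_, fun k => ?_⟩, Landau.curvatureOperator_eq hε hℓ j, hmeas,
    fun t₀ ht₀ ω => ?_, ?_⟩
  · rw [hfam]
    exact Landau.isBlochFamily_blochProjection hε hℓ j
  · rw [hfam]
    exact Landau.contDiff_blochProjection hℓ j
  · rw [hfam]
    exact Landau.isStarProjection_blochProjection hℓ j k
  · rw [Landau.landauBundle, hfam]
    exact Landau.finrank_range_blochProjection hℓ j k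
  · have hl : (ℓ : ℂ) ≠ 0 := by exact_mod_cast hℓ.ne'
    rw [hfam, hchern, htrace t₀ ht₀ ω]
    field_simp
    rw [Complex.I_sq, neg_neg]
  · rw [hfam, hchern]
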